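/- Let $K$ be a field of characteristic $0$ and $X=\{x<y\}$. Order words lexicographically by $<$ (a proper prefix of a word is smaller than the word), and let $u\prec v$ iff $|u|<|v|$, or $|u|=|v|$ and $u>v$. A word is Lyndon if it is nonempty and strictly smaller than all its proper rotations. A pair $(N,W)$ of sets of words is a Lyndon pair if $W$ is a set of Lyndon words of length $\ge 2$, none of which is a proper subword of another, and $N$ is the set of all Lyndon words that contain no subword from $W$. For a Lyndon word $w$ let $[w]\in \mathrm{Lie}(X)$ be its standard bracketing: $[x]=x$, $[y]=y$ and $[w]=[[u],[v]]$ where $w=uv$ and $v$ is the longest proper right segment of $w$ that is a Lyndon word. Put $[W]=\{[w] : w\in W\}$, let $J=([W])_{Lie}$ be the Lie ideal of $\mathrm{Lie}(X)$ generated by $[W]$, and let $\mathfrak g=\mathrm{Lie}(X)/J$. We say that $[W]$ is a Gröbner–Shirshov basis of $J$ if every nonzero $f\in J$ has the form $f=c[u]+\sum_{v\prec u}c_v[v]$ (over Lyndon words), where $c\neq 0$, $u$ is the $\prec$-highest word of $f$ as a noncommutative polynomial, and $u$ contains a subword from $W$. Let $\mathcal L_n$ and (for odd $n$) $\mathcal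 Q_n$ be the Lie algebras with basis $X_0,\dots,X_n$ whose nonzero brackets are, up to skew-symmetry, $[X_0,X_j]=X_{j+1}$ for $1\le j\le n-1$, and for $\mathcal Q_n$ also $[X_j,X_{n-j}]=(-1)^jX_n$ for $1\le j\le n-1$. Let $\mathfrak M_0$ be the Lie algebra with basis $e_1,e_2,\dots$ whose nonzero brackets are, up to skew-symmetry, $[e_1,e_i]=e_{i+1}$ for $i\ge 2$. **Theorem.** Let $(N,W)$ be a Lyndon pair such that $|N|\ge 4$, $N$ has at most one word of each length $m\ge 2$, and $N$ is connected (if $N$ has a word of length $m\geq 2$, then it has words of all lengths $1\le s\le m$). Then $xyy\in N$ or $xxy\in N$. If $xxy\in N$, let $N',W'$ be obtained from $N,W$ by exchanging the letters $x,y$ in every word and reversing it. Then $N'$ is connected, $|N'|\ge4$, $N'$ has at most one word of each length $\geq 2$, and $xyy\in N'$. Moreover, $[W]$ is a Gröbner–Shirshov basis of $([W])_{Lie}$ if and only if $(N',W')$ is a Lyndon pair and $[W']$ is a Gröbner–Shirshov basis of $([W'])_{Lie}$; in this case $[N]$ induces a $K$-basis of $\mathfrak g$, and $\mathfrak g\cong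 \mathrm{Lie}(X)/([W'])_{Lie}$. If $xyy\in N$, then the following hold. 1. $N=\{xy^k : k\ge 0\}\cup\{y\}$ if and only if $W=\{xy^kxy^{k+1} : k\ge 0\}$. If $[W]$ is a Gröbner–Shirshov basis of $J$, then $N$ is infinite if and only if $N=\{xy^k: k\ge0\}\cup\{y\}$. Conversely, for this $N$, $[W]$ is a Gröbner–Shirshov basis of $J$, $[N]$ induces a $K$-basis of $\mathfrak g$, and $\mathfrak g\cong\mathfrak M_0$. 2. Let $d\ge 0$ be an integer. If $[W]$ is a Gröbner–Shirshov basis of $J$, then $N$ is finite of order $d$ if and only if one of the following holds: (a) $N=\{xy^k : 0\le k\le d-2\}\cup\{y\}$ and $W=\{xy^kxy^{k+1} : 0\le k\le d-3\}\cup\{xy^{d-1}\}$; (b) $d=2m\ge 6$, $N=\{xy^j : 0\le j\le 2m-3\}\cup\{xy^{m-2}xy^{m-1}\}\cup\{y\}$ and $$W=\{xy^{2m-2},\ xy^{m-2}xy^{m},\ (xy^{m-2})(xy^{m-2}xy^{m-1}),\ (xy^{m-2}xy^{m-1})(xy^{m-1})\}\cup\{xy^kxy^{k+1} : 0\le k\le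 2m-4,\ k\ne m-2\}.$$ Conversely, in each of the cases (a) and (b), $[W]$ is a Gröbner–Shirshov basis of $J$, $[N]$ induces a $K$-basis of $\mathfrak g$, and $\mathfrak g$ has dimension $d$ and nilpotency class $d-1$; in case (a) $\mathfrak g\cong\mathcal L_{d-1}$, and in case (b) $\mathfrak g\cong\mathcal Q_{2m-1}$. -/

import Mathlib

/-! ### Words and Lyndon words in the alphabet `{x < y}` -/

/-- Words in the alphabet `{x < y}`; the letter `x` is `0 : Fin 2`, the letter `y` is `1 : Fin 2`.
The order `<` on words is the lexicographic order of lists, in which a proper prefix of a word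
is smaller than the word. -/
abbrev Word : Type := List (Fin 2)

/-- A Lyndon word: a nonempty word that is strictly smaller than all its proper rotations. -/
def IsLyndon (w : Word) : Prop :=
  w ≠ [] ∧ ∀ a b : Word, a ≠ [] → b ≠ [] → w = a ++ b → w < b ++ a

/-- The degree-lexicographic order `u ≺ v` on words, with `x ≻ y`: shorter words are smaller, and
words of the same length are compared by the reverse of the lexicographic order. -/
def DegLexLT (u v : Word) : Prop :=
  u.length < v.length ∨ (u.length = v.length ∧ v < u)

/-- `(N, W)` is a Lyndon pair: `W` is an antichain (for the subword order) of Lyndon words, none of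
which is a letter, and `N` consists of the Lyndon words without a subword in `W`. -/
structure IsLyndonPair (N W : Set Word) : Prop where
  lyndon : ∀ w ∈ W, IsLyndon w
  antichain : IsAntichain (fun u v : Word => u <:+: v) W
  no_letter : ∀ w ∈ W, 2 ≤ w.length
  atoms : N = {u : Word | IsLyndon u ∧ ∀ w ∈ W, ¬ w <:+: u}

/-- If `N` has a word of length `m ≥ 2`, then it has words of all lengths `1 ≤ s ≤ m`. -/
def IsConnectedSet (N : Set Word) : Prop :=
  ∀ m : ℕ, 2 ≤ m → (∃ u ∈ N, u.length = m) → ∀ s : ℕ, 1 ≤ s → s ≤ m → ∃ u ∈ N, u.length = s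

/-- `N` has at most one word of each length `m ≥ 2`. -/
def IsNarrow (N : Set Word) : Prop :=
  ∀ u ∈ N, ∀ v ∈ N, 2 ≤ u.length → u.length = v.length → u = v

/-- The word `x y ^ k`. -/
def xyPow (k : ℕ) : Word := 0 :: List.replicate k 1

/-- Exchange the two letters and read the word backwards. -/
def mirror (w : Word) : Word := (w.map (Equiv.swap 0 1)).reverse

/-! ### Standard bracketing -/

/-- The start of the longest proper right segment that is a Lyndon word. -/
noncomputable def stdCut (w : Word) : ℕ :=
  sInf {k : ℕ | 1 ≤ k ∧ k < w.length ∧ IsLyndon (w.drop k)}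

theorem isLyndon_singleton (a : Fin 2) : IsLyndon [a] := by
  refine ⟨by simp, fun p q hp hq h => ?_⟩
  have := congrArg List.length h
  have h1 := List.length_pos_of_ne_nil hp
  have h2 := List.length_pos_of_ne_nil hq
  simp at this
  omega

theorem stdCut_spec (w : Word) (h : 2 ≤ w.length) : 1 ≤ stdCut w ∧ stdCut w < w.length := by
  have hne : {k : ℕ | 1 ≤ k ∧ k < w.length ∧ IsLyndon (w.drop k)}.Nonempty := by
    refine ⟨w.length - 1, by omega, by omega, ?_⟩
    have hl : (w.drop (w.length - 1)).length = 1 := by simp; omega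
    obtain ⟨a, ha⟩ := List.length_eq_one_iff.mp hl
    rw [ha]
    exact isLyndon_singleton a
  have := Nat.sInf_mem hne
  exact ⟨this.1, this.2.1⟩

section LieIdeals

variable (K : Type*) [Field K]

attribute [local instance] LieRing.ofAssociativeRing

/-- The right standard bracketing `[w]` in the free Lie algebra: `[a] = a` for a letter `a`, and
`[w] = [[u], [v]]` if `w = u v` with `v` the longest proper right segment of `w` that is Lyndon.
(Only its values on Lyndon words matter.) -/
noncomputable def stdBracket (w : Word) : FreeLieAlgebra K (Fin 2) :=
  if _h : 2 ≤ w.length then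
    ⁅stdBracket (w.take (stdCut w)), stdBracket (w.drop (stdCut w))⁆
  else
    match w with
    | [] => 0
    | a :: _ => FreeLieAlgebra.of K a
termination_by w.length
decreasing_by
  · have := stdCut_spec w _h
    simp
    omega
  · have := stdCut_spec w _h
    simp
    omega

/-- The Lie ideal `J` of the free Lie algebra generated by `[W]`. -/
noncomputable def monomialIdeal (W : Set Word) : LieIdeal K (FreeLieAlgebra K (Fin 2)) :=
  LieSubmodule.lieSpan K (FreeLieAlgebra K (Fin 2)) (stdBracket K '' W)

/-- The monomial Lie algebra `g = Lie(x, y) / J`. -/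
abbrev MonomialLie (W : Set Word) : Type _ :=
  FreeLieAlgebra K (Fin 2) ⧸ monomialIdeal K W

/-- The canonical map from the free Lie algebra to the free associative algebra. -/
noncomputable def toAssoc : FreeLieAlgebra K (Fin 2) →ₗ⁅K⁆ FreeAlgebra K (Fin 2) :=
  FreeLieAlgebra.lift K (FreeAlgebra.ι K)

/-- The coefficient of a word in a noncommutative polynomial. -/
noncomputable def wordCoeff (p : FreeAlgebra K (Fin 2)) (w : Word) : K :=
  (FreeAlgebra.equivMonoidAlgebraFreeMonoid p).coeff (FreeMonoid.ofList w)

/-- `u` is the highest word of the polynomial `p` with respect to `≺`. -/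
def IsHighestWord (p : FreeAlgebra K (Fin 2)) (u : Word) : Prop :=
  wordCoeff K p u ≠ 0 ∧ ∀ v : Word, wordCoeff K p v ≠ 0 → v = u ∨ DegLexLT v u

/-- `[W]` is a Gröbner–Shirshov basis of the Lie ideal `J` that it generates: every nonzero `f ∈ J`
is of the form `c [u] + ∑ c_v [v]`, with `c ≠ 0` and the sum over Lyndon words `v ≺ u`, where `u` is
the highest word of `f` and has a subword in `W`. -/
def IsGroebnerShirshov (W : Set Word) : Prop :=
  ∀ f ∈ monomialIdeal K W, f ≠ 0 →
    ∃ u : Word, IsLyndon u ∧ IsHighestWord K (toAssoc K f) u ∧ (∃ w ∈ W, w <:+: u) ∧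
      ∃ c : K, c ≠ 0 ∧
        f - c • stdBracket K u ∈
          Submodule.span K (stdBracket K '' {v : Word | IsLyndon v ∧ DegLexLT v u})

/-- The classes of the standard bracketings `[u]`, `u ∈ N`, form a `K`-basis of `g`. -/
def IsBracketBasis (N W : Set Word) : Prop :=
  LinearIndependent K
      (fun u : N => (LieSubmodule.Quotient.mk (stdBracket K (u : Word)) : MonomialLie K W)) ∧
    Submodule.span K (Set.range
      (fun u : N => (LieSubmodule.Quotient.mk (stdBracket K (u : Word)) : MonomialLie K W))) = ⊤

end LieIdeals

/-- `g` is nilpotent of class `m`: `m` is minimal with `g ^ (m + 1) = 0` for the lower central series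
`g ^ 1 = g`, `g ^ (t + 1) = [g, g ^ t]` (Mathlib's series starts at index `0`). -/
def HasNilpotencyClass (K g : Type*) [CommRing K] [LieRing g] [LieAlgebra K g] (m : ℕ) : Prop :=
  IsLeast {k : ℕ | LieModule.lowerCentralSeries K g g k = ⊥} m

/-! ### Lie algebras given by a multiplication table on a basis -/

section Table

variable {K ι : Type*} [CommRing K]

/-- The bilinear extension of a multiplication table `t`. -/
noncomputable def tableMul (t : ι → ι → ι →₀ K) : (ι →₀ K) →ₗ[K] (ι →₀ K) →ₗ[K] (ι →₀ K) :=
  Finsupp.linearCombination K fun i => Finsupp.linearCombination K (t i)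

theorem tableMul_single (t : ι → ι → ι →₀ K) (i j : ι) :
    tableMul t (Finsupp.single i 1) (Finsupp.single j 1) = t i j := by
  simp [tableMul]

/-- A multiplication table on a basis indexed by `ι` that satisfies the axioms of a Lie algebra. -/
structure LieTable (K ι : Type*) [CommRing K] where
  t : ι → ι → ι →₀ K
  self : ∀ i, t i i = 0
  skew : ∀ i j, t i j = -t j i
  leibniz : ∀ i j k, tableMul t (Finsupp.single i 1) (t j k) =
    tableMul t (t i j) (Finsupp.single k 1) + tableMul t (Finsupp.single j 1) (t i k)

/-- The Lie algebra with the given multiplication table; its underlying vector space has the basis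
`Finsupp.single i 1`. -/
def LieTable.Alg (_T : LieTable K ι) : Type _ := ι →₀ K

noncomputable instance (T : LieTable K ι) : AddCommGroup T.Alg :=
  inferInstanceAs (AddCommGroup (ι →₀ K))

noncomputable instance (T : LieTable K ι) : Module K T.Alg :=
  inferInstanceAs (Module K (ι →₀ K))

theorem LieTable.mul_skew (T : LieTable K ι) (v w : ι →₀ K) :
    tableMul T.t v w = -tableMul T.t w v := by
  induction v using Finsupp.induction_linear with
  | zero => simp
  | add f g hf hg => simp only [map_add, LinearMap.add_apply, hf, hg]; abel
  | single i a =>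
  induction w using Finsupp.induction_linear with
  | zero => simp
  | add f g hf hg => simp only [map_add, LinearMap.add_apply, hf, hg]; abel
  | single j b =>
    have hi : Finsupp.single i a = a • Finsupp.single i (1 : K) := by simp
    have hj : Finsupp.single j b = b • Finsupp.single j (1 : K) := by simp
    rw [hi, hj]
    simp only [map_smul, LinearMap.smul_apply, tableMul_single, T.skew i j]
    module

theorem LieTable.mul_self (T : LieTable K ι) (v : ι →₀ K) : tableMul T.t v v = 0 := by
  induction v using Finsupp.induction_linear with
  | zero => simp
  | add f g hf hg =>
    simp only [map_add, LinearMap.add_apply, hf, hg]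
    rw [T.mul_skew f g]
    simp
  | single i a =>
    have : Finsupp.single i a = a • Finsupp.single i (1 : K) := by simp
    rw [this]
    simp only [map_smul, LinearMap.smul_apply, tableMul_single, T.self, smul_zero]

theorem LieTable.mul_leibniz (T : LieTable K ι) (u v w : ι →₀ K) :
    tableMul T.t u (tableMul T.t v w) =
      tableMul T.t (tableMul T.t u v) w + tableMul T.t v (tableMul T.t u w) := by
  induction u using Finsupp.induction_linear with
  | zero => simp
  | add f g hf hg => simp only [map_add, LinearMap.add_apply, hf, hg]; abel
  | single i a =>
  induction v using Finsupp.induction_linear with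
  | zero => simp
  | add f g hf hg => simp only [map_add, LinearMap.add_apply, hf, hg]; abel
  | single j b =>
  induction w using Finsupp.induction_linear with
  | zero => simp
  | add f g hf hg => simp only [map_add, hf, hg]; abel
  | single k c =>
    have hi : Finsupp.single i a = a • Finsupp.single i (1 : K) := by simp
    have hj : Finsupp.single j b = b • Finsupp.single j (1 : K) := by simp
    have hk : Finsupp.single k c = c • Finsupp.single k (1 : K) := by simp
    rw [hi, hj, hk]
    simp only [map_smul, LinearMap.smul_apply, tableMul_single, T.leibniz i j k]
    module

noncomputable instance (T : LieTable K ι) : LieRing T.Alg where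
  bracket v w := tableMul T.t v w
  add_lie u v w := LinearMap.congr_fun ((tableMul T.t).map_add u v) w
  lie_add u v w := (tableMul T.t u).map_add v w
  lie_self v := T.mul_self v
  leibniz_lie u v w := T.mul_leibniz u v w

noncomputable instance (T : LieTable K ι) : LieAlgebra K T.Alg where
  lie_smul a v w := (tableMul T.t v).map_smul a w

end Table

/-! ### The filiform Lie algebras -/

section Filiform

variable (K : Type*) [Field K]

/-- The basis vector `X_k` of a space with basis `X_0, …, X_n`; zero if `k > n`. -/
noncomputable def basisVec (n k : ℕ) : Fin (n + 1) →₀ K :=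
  if h : k < n + 1 then Finsupp.single ⟨k, h⟩ 1 else 0

/-- `[X_0, X_j] = X_{j+1}` for `1 ≤ j ≤ n - 1`, hence `[X_j, X_0] = -X_{j+1}`, and all other brackets
of basis vectors are zero. -/
noncomputable def filiformLTable (n : ℕ) (i j : Fin (n + 1)) : Fin (n + 1) →₀ K :=
  if i.val = 0 ∧ 1 ≤ j.val ∧ j.val < n then basisVec K n (j.val + 1)
  else if j.val = 0 ∧ 1 ≤ i.val ∧ i.val < n then -basisVec K n (i.val + 1)
  else 0

/-- `[X_0, X_j] = X_{j+1}` for `1 ≤ j ≤ n - 1`, hence `[X_j, X_0] = -X_{j+1}`, and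
`[X_j, X_{n-j}] = (-1)^j X_n` for `1 ≤ j ≤ n - 1`; all other brackets of basis vectors are zero. -/
noncomputable def filiformQTable (n : ℕ) (i j : Fin (n + 1)) : Fin (n + 1) →₀ K :=
  if i.val = 0 ∧ 1 ≤ j.val ∧ j.val < n then basisVec K n (j.val + 1)
  else if j.val = 0 ∧ 1 ≤ i.val ∧ i.val < n then -basisVec K n (i.val + 1)
  else if 1 ≤ i.val ∧ 1 ≤ j.val ∧ i.val + j.val = n then (-1 : K) ^ i.val • basisVec K n n
  else 0

/-- With `e_{i+1}` in place of the `i`-th basis vector (`i ≥ 0`): `[e_1, e_j] = e_{j+1}` for `j ≥ 2`,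
hence `[e_j, e_1] = -e_{j+1}`, and all other brackets of basis vectors are zero. -/
noncomputable def filiformM0Table (i j : ℕ) : ℕ →₀ K :=
  if i = 0 ∧ 1 ≤ j then Finsupp.single (j + 1) 1
  else if j = 0 ∧ 1 ≤ i then -Finsupp.single (i + 1) 1
  else 0

theorem basisVec_of_lt {n k : ℕ} (h : n < k) : basisVec K n k = 0 := by
  simp [basisVec, Nat.not_lt.mpr (Nat.succ_le_of_lt h)]

theorem basisVec_val {n : ℕ} (i : Fin (n + 1)) :
    basisVec K n i.val = Finsupp.single i 1 := by
  unfold basisVec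
  rw [dif_pos i.isLt]

theorem filiformLTable_eq (n : ℕ) (i j : Fin (n + 1)) : filiformLTable K n i j =
    if i.val = 0 then (if j.val = 0 then 0 else basisVec K n (j.val + 1))
    else if j.val = 0 then -basisVec K n (i.val + 1) else 0 := by
  have hi := i.isLt
  have hj := j.isLt
  unfold filiformLTable
  split_ifs <;> first | rfl | omega | rw [basisVec_of_lt K (by omega)]
  exact neg_zero.symm

theorem filiformLTable_mul (n i j : ℕ) :
    tableMul (filiformLTable K n) (basisVec K n i) (basisVec K n j) =
    if i = 0 then (if j = 0 then 0 else basisVec K n (j + 1))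
    else if j = 0 then -basisVec K n (i + 1) else 0 := by
  by_cases hi : n < i
  · rw [basisVec_of_lt K hi, basisVec_of_lt K (by omega : n < i + 1)]
    have : i ≠ 0 := by omega
    simp [this]
  by_cases hj : n < j
  · rw [basisVec_of_lt K hj, basisVec_of_lt K (by omega : n < j + 1)]
    have : j ≠ 0 := by omega
    simp [this]
  have h := filiformLTable_eq K n ⟨i, by omega⟩ ⟨j, by omega⟩
  rw [← tableMul_single (filiformLTable K n), ← basisVec_val, ← basisVec_val] at h
  exact h

/-- The standard filiform Lie algebra `L_n`, of dimension `n + 1`. -/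
noncomputable def filiformL (n : ℕ) : LieTable K (Fin (n + 1)) where
  t := filiformLTable K n
  self i := by
    unfold filiformLTable
    split_ifs <;> first | rfl | omega
  skew i j := by
    unfold filiformLTable
    split_ifs <;> first | simp | omega
  leibniz i j k := by
    simp only [← tableMul_single (filiformLTable K n), ← basisVec_val]
    generalize i.val = a
    generalize j.val = b
    generalize k.val = c
    rcases a with _ | a <;> rcases b with _ | b <;> rcases c with _ | c <;>
      simp [filiformLTable_mul]

theorem filiformQTable_eq (n : ℕ) (i j : Fin (n + 1)) : filiformQTable K n i j =
    if i.val = 0 then (if j.val = 0 then 0 else basisVec K n (j.val + 1))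
    else if j.val = 0 then -basisVec K n (i.val + 1)
    else if i.val + j.val = n then (-1 : K) ^ i.val • basisVec K n n else 0 := by
  have hi := i.isLt
  have hj := j.isLt
  unfold filiformQTable
  split_ifs <;> first | rfl | omega | rw [basisVec_of_lt K (by omega)]
  exact neg_zero.symm

theorem filiformQTable_mul (n i j : ℕ) :
    tableMul (filiformQTable K n) (basisVec K n i) (basisVec K n j) =
    if i = 0 then (if j = 0 then 0 else basisVec K n (j + 1))
    else if j = 0 then -basisVec K n (i + 1)
    else if i + j = n then (-1 : K) ^ i • basisVec K n n else 0 := by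
  by_cases hi : n < i
  · rw [basisVec_of_lt K hi, basisVec_of_lt K (by omega : n < i + 1)]
    have h1 : i ≠ 0 := by omega
    have h2 : i + j ≠ n := by omega
    simp [h1, h2]
  by_cases hj : n < j
  · rw [basisVec_of_lt K hj, basisVec_of_lt K (by omega : n < j + 1)]
    have h1 : j ≠ 0 := by omega
    have h2 : i + j ≠ n := by omega
    simp [h1, h2]
  have h := filiformQTable_eq K n ⟨i, by omega⟩ ⟨j, by omega⟩
  rw [← tableMul_single (filiformQTable K n), ← basisVec_val, ← basisVec_val] at h
  exact h

/-- The second type filiform Lie algebra `Q_n` for odd `n`, of dimension `n + 1`. -/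
noncomputable def filiformQ (n : ℕ) (hn : Odd n) : LieTable K (Fin (n + 1)) where
  t := filiformQTable K n
  self i := by
    obtain ⟨r, hr⟩ := hn
    unfold filiformQTable
    split_ifs <;> first | rfl | omega
  skew i j := by
    unfold filiformQTable
    split_ifs <;> first | omega | simp | skip
    rename_i h _
    have h2 : (-1 : K) ^ i.val * (-1 : K) ^ j.val = -1 := by
      rw [← pow_add, h.2.2, hn.neg_one_pow]
    have h3 : (-1 : K) ^ j.val * (-1 : K) ^ j.val = 1 := by
      rw [← pow_add, Even.neg_one_pow ⟨_, rfl⟩]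
    have h4 : (-1 : K) ^ i.val = -(-1 : K) ^ j.val := by
      linear_combination (-1 : K) ^ j.val * h2 - (-1 : K) ^ i.val * h3
    rw [h4, neg_smul]
  leibniz i j k := by
    simp only [← tableMul_single (filiformQTable K n), ← basisVec_val]
    have hodd := hn.neg_one_pow (α := K)
    have hz := basisVec_of_lt K (Nat.lt_succ_self n)
    have hn0 : n ≠ 0 := by rintro rfl; simp at hn
    generalize i.val = a
    generalize j.val = b
    generalize k.val = c
    rcases a with _ | a <;> rcases b with _ | b <;> rcases c with _ | c <;>
      simp [filiformQTable_mul]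
    · split_ifs <;> first | omega | simp [filiformQTable_mul, hz, hn0, pow_succ]
    · split_ifs <;> first | omega | simp [filiformQTable_mul, hz, hn0, pow_succ]
    · have hp : a + 1 + (b + 1 + 1) = n → (-1 : K) ^ a = (-1 : K) ^ b := by
        intro h
        have h2 : (-1 : K) ^ a * (-1 : K) ^ b = 1 := by
          rw [← pow_add, Even.neg_one_pow]
          obtain ⟨r, hr⟩ := hn
          exact ⟨r - 1, by omega⟩
        have h3 : (-1 : K) ^ b * (-1 : K) ^ b = 1 := by
          rw [← pow_add, Even.neg_one_pow ⟨_, rfl⟩]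
        linear_combination (-1 : K) ^ b * h2 - (-1 : K) ^ a * h3
      split_ifs with h1 <;> first | omega | simp [filiformQTable_mul, hz, hn0, pow_succ]
      rw [hp h1]
    · split_ifs <;> first | omega | simp [filiformQTable_mul, hn0, pow_succ]

/-- The infinite filiform Lie algebra `M_0`, with basis `e_1, e_2, …`. -/
noncomputable def filiformM0 : LieTable K ℕ where
  t := filiformM0Table K
  self i := by
    unfold filiformM0Table
    split_ifs <;> first | rfl | omega
  skew i j := by
    unfold filiformM0Table
    split_ifs <;> first | simp | omega
  leibniz i j k := by
    simp only [← tableMul_single (filiformM0Table K)]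
    rcases i with _ | i <;> rcases j with _ | j <;> rcases k with _ | k <;>
      simp [tableMul_single, filiformM0Table]

end Filiform

theorem odd_two_mul_sub_one {m : ℕ} (hm : 3 ≤ m) : Odd (2 * m - 1) :=
  ⟨m - 1, by omega⟩

/-! ### The explicit sets of words -/

/-- `{x y ^ k | k ≥ 0} ∪ {y}` -/
def atomsM0 : Set Word := {w | ∃ k : ℕ, w = xyPow k} ∪ {[1]}

/-- `{x y ^ k x y ^ (k + 1) | k ≥ 0}` -/
def obstructionsM0 : Set Word := {w | ∃ k : ℕ, w = xyPow k ++ xyPow (k + 1)}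

/-- `{x y ^ k | 0 ≤ k ≤ d - 2} ∪ {y}` -/
def atomsL (d : ℕ) : Set Word := {w | ∃ k : ℕ, k + 2 ≤ d ∧ w = xyPow k} ∪ {[1]}

/-- `{x y ^ k x y ^ (k + 1) | 0 ≤ k ≤ d - 3} ∪ {x y ^ (d - 1)}` -/
def obstructionsL (d : ℕ) : Set Word :=
  {w | ∃ k : ℕ, k + 3 ≤ d ∧ w = xyPow k ++ xyPow (k + 1)} ∪ {xyPow (d - 1)}

/-- `{x y ^ j | 0 ≤ j ≤ 2 m - 3} ∪ {x y ^ (m - 2) x y ^ (m - 1)} ∪ {y}` (for `m ≥ 3`) -/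
def atomsQ (m : ℕ) : Set Word :=
  {w | ∃ j : ℕ, j + 3 ≤ 2 * m ∧ w = xyPow j} ∪ {xyPow (m - 2) ++ xyPow (m - 1)} ∪ {[1]}

/-- `{x y ^ (2 m - 2), x y ^ (m - 2) x y ^ m, (x y ^ (m - 2)) (x y ^ (m - 2) x y ^ (m - 1)),
(x y ^ (m - 2) x y ^ (m - 1)) (x y ^ (m - 1))}` together with the words `x y ^ k x y ^ (k + 1)` for
`0 ≤ k ≤ 2 m - 4`, `k ≠ m - 2` (for `m ≥ 3`) -/
def obstructionsQ (m : ℕ) : Set Word :=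
  {xyPow (2 * m - 2), xyPow (m - 2) ++ xyPow m,
    xyPow (m - 2) ++ (xyPow (m - 2) ++ xyPow (m - 1)),
    (xyPow (m - 2) ++ xyPow (m - 1)) ++ xyPow (m - 1)} ∪
  {w | ∃ k : ℕ, k + 4 ≤ 2 * m ∧ k ≠ m - 2 ∧ w = xyPow k ++ xyPow (k + 1)}

/-! ### Lexicographic order and concatenation -/

/-! Only brackets with at most two letters x matter. For elements X, Y of a Lie algebra put E_k =
[X, Y, …, Y] with k letters Y. Up to nonzero scalars [xy^k] evaluates to E_k and [xy^k xy^(k+1)] to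
[E_k, E_(k+1)]; a word with two letters x evaluates into the span of the [E_i, E_j] with i + j
fixed. The Leibniz rule [[E_i, E_j], Y] = [E_i, E_(j+1)] + [E_(i+1), E_j] ties these brackets
together. If all those with i + j = n vanish, those with i + j = n + 1 agree up to sign, so they
vanish together with the middle one (`lie_engelElt_eq_zero_of_middle`). If moreover n = 2c and
E_(2c+2) = 0, then in characteristic zero everything with i + j ≥ 2c + 2 vanishes
(`lie_engelElt_eq_zero_above`).

Under the Gröbner–Shirshov property no [u] with u in N lies in J. The two relations, applied in the
quotient, therefore forbid words in N, and a length argument based on narrowness and connectedness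
leaves three shapes of N (`IsFlipPair.classification`). The set W is recovered from N as the set of
its minimal obstructions (`IsFlipPair.unique`).

Conversely, each shape has a filiform model. In the model and in the quotient the [E_i, E_j] vanish
except for multiples of one central element t (`FiliformRel`). Hence [N] spans both algebras. In the
model it is independent, which makes the quotient isomorphic to the model. Every Lyndon word outside
N evaluates in the model to zero or to a multiple of the smaller word xy^c xy^(c+1) in N, and this
gives the Gröbner–Shirshov property (`isGroebnerShirshov_of_reduction`). That criterion needs two
classical facts: [w] is w plus lexicographically larger words of the same length
(`toAssoc_stdBracket`), and the brackets of Lyndon words span the free Lie algebra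
(`lie_stdBracket_mem`).

The mirror image of a Lyndon word need not be Lyndon (xxyyxy is an example), so the case of xxy
cannot be deduced by symmetry. Instead a Boolean s runs through the argument, and words are required
to be Lyndon after mirroring if s is true. The three shapes and their obstructions are valid for
both values of s and have the same model, which yields the comparison of (N, W) with (N', W'). -/

theorem append_lt_append_left_iff {u v w : Word} : u ++ v < u ++ w ↔ v < w := by
  induction u with
  | nil => rfl
  | cons a u ih =>
    rw [List.cons_append, List.cons_append, List.cons_lt_cons_iff, ih]
    simp

theorem le_append_right (u v : Word) : u ≤ u ++ v := by
  rcases eq_or_ne v [] with rfl | hv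
  · simp
  · obtain ⟨a, v, rfl⟩ := List.exists_cons_of_ne_nil hv
    apply le_of_lt
    have : u ++ [] < u ++ a :: v := append_lt_append_left_iff.mpr (List.nil_lt_cons a v)
    simpa using this

/-- The comparison is decided at the first letter where the two words differ, and that letter lies
inside both, so continuations are irrelevant. -/
theorem append_lt_append_of_not_prefix {u v : Word} (h : u < v) (hp : ¬ u <+: v) (s t : Word) :
    u ++ s < v ++ t := by
  induction u generalizing v with
  | nil => exact absurd (List.nil_prefix) hp
  | cons a u ih =>
    cases v with
    | nil => exact absurd h (List.not_lt_nil _)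
    | cons b v =>
      rw [List.cons_lt_cons_iff] at h
      rw [List.cons_append, List.cons_append, List.cons_lt_cons_iff]
      rcases h with h | ⟨rfl, h⟩
      · exact Or.inl h
      · refine Or.inr ⟨rfl, ih h fun hp' => hp ?_⟩
        exact (List.cons_prefix_cons).mpr ⟨rfl, hp'⟩

theorem not_prefix_of_lt_of_length_le {u v : Word} (h : u < v) (hl : v.length ≤ u.length) :
    ¬ u <+: v := fun hp => by
  have := hp.eq_of_length_le hl
  subst this
  exact lt_irrefl _ h

theorem append_lt_append_of_length_le {u v : Word} (h : u < v) (hl : v.length ≤ u.length)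
    (s t : Word) : u ++ s < v ++ t :=
  append_lt_append_of_not_prefix h (not_prefix_of_lt_of_length_le h hl) s t

/-! ### Lyndon words -/

/-- Let w = ab be smaller than its rotations and suppose b < w. If b is not a prefix of w, then ba <
w at once. If w = bc, then w < ba gives c < a, while w < cb contradicts cb < ab, since a and c have
equal length. -/
theorem isLyndon_iff_lt_suffix {w : Word} :
    IsLyndon w ↔ w ≠ [] ∧ ∀ a b : Word, a ≠ [] → b ≠ [] → w = a ++ b → w < b := by
  constructor
  · rintro ⟨hw, h⟩
    refine ⟨hw, fun a b ha hb hab => ?_⟩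
    by_contra hlt
    have hab' := h a b ha hb hab
    have hla := List.length_pos_of_ne_nil ha
    have hlen := congrArg List.length hab
    rw [List.length_append] at hlen
    have hne : b ≠ w := by
      rintro rfl
      omega
    have hbw : b < w := lt_of_le_of_ne (not_lt.mp hlt) hne
    by_cases hp : b <+: w
    · obtain ⟨c, hc⟩ := hp
      have hlc : c.length = a.length := by
        have := congrArg List.length hc
        rw [List.length_append] at this
        omega
      have hca : c < a := by
        rw [← hc] at hab'
        exact append_lt_append_left_iff.mp hab'
      have hc0 : c ≠ [] := by
        rintro rfl
        simp at hlc
        omega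
      have h2 := h b c hb hc0 hc.symm
      rw [hab] at h2
      exact lt_asymm h2 (append_lt_append_of_length_le hca hlc.ge b b)
    · have := append_lt_append_of_not_prefix hbw hp a []
      rw [List.append_nil] at this
      exact lt_asymm this hab'
  · rintro ⟨hw, h⟩
    exact ⟨hw, fun a b ha hb hab => (h a b ha hb hab).trans_le (le_append_right b a)⟩

theorem IsLyndon.ne_nil {w : Word} (h : IsLyndon w) : w ≠ [] := h.1

theorem IsLyndon.length_pos {w : Word} (h : IsLyndon w) : 0 < w.length :=
  List.length_pos_of_ne_nil h.1

theorem IsLyndon.lt_suffix {a b : Word} (h : IsLyndon (a ++ b)) (ha : a ≠ []) (hb : b ≠ []) :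
    a ++ b < b :=
  (isLyndon_iff_lt_suffix.mp h).2 a b ha hb rfl

/-- Once uv < v is known, suffixes inside v are larger still, and a suffix that begins inside u
exceeds u at a letter within it. -/
theorem IsLyndon.append {u v : Word} (hu : IsLyndon u) (hv : IsLyndon v) (h : u < v) :
    IsLyndon (u ++ v) := by
  have huv : u ++ v < v := by
    by_cases hp : u <+: v
    · obtain ⟨c, rfl⟩ := hp
      have hc : c ≠ [] := by
        rintro rfl
        simp at h
      exact append_lt_append_left_iff.mpr (hv.lt_suffix hu.ne_nil hc)
    · simpa using append_lt_append_of_not_prefix h hp v []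
  rw [isLyndon_iff_lt_suffix]
  refine ⟨by simp [hu.ne_nil], fun a b ha hb hab => ?_⟩
  rcases List.append_eq_append_iff.mp hab with ⟨c, rfl, rfl⟩ | ⟨c, rfl, rfl⟩
  · rcases eq_or_ne c [] with rfl | hc
    · exact huv
    · exact huv.trans (hv.lt_suffix hc hb)
  · rcases eq_or_ne c [] with rfl | hc
    · simpa using huv
    · have hla := List.length_pos_of_ne_nil ha
      exact append_lt_append_of_length_le (hu.lt_suffix ha hc) (by simp) _ _

/-! ### The standard factorization -/

theorem stdCut_isLyndon {w : Word} (h : 2 ≤ w.length) : IsLyndon (w.drop (stdCut w)) := by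
  have hne : {k : ℕ | 1 ≤ k ∧ k < w.length ∧ IsLyndon (w.drop k)}.Nonempty := by
    refine ⟨w.length - 1, by omega, by omega, ?_⟩
    have hl : (w.drop (w.length - 1)).length = 1 := by simp; omega
    obtain ⟨a, ha⟩ := List.length_eq_one_iff.mp hl
    rw [ha]
    exact isLyndon_singleton a
  exact (Nat.sInf_mem hne).2.2

theorem stdCut_le {w : Word} {k : ℕ} (h1 : 1 ≤ k) (h2 : k < w.length) (h : IsLyndon (w.drop k)) :
    stdCut w ≤ k :=
  Nat.sInf_le ⟨h1, h2, h⟩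

/-- The smallest proper suffix is smaller than its own suffixes, hence Lyndon, and so it is no
longer than the longest Lyndon suffix. The latter, being Lyndon, is at most its own suffix, the
minimum. -/
theorem drop_stdCut_le {w : Word} (h : 2 ≤ w.length) {k : ℕ} (h1 : 1 ≤ k) (h2 : k < w.length) :
    w.drop (stdCut w) ≤ w.drop k := by
  obtain ⟨k₀, hk₀, hmin⟩ := Finset.exists_min_image (Finset.Ico 1 w.length) (fun k => w.drop k)
    ⟨k, Finset.mem_Ico.mpr ⟨h1, h2⟩⟩
  rw [Finset.mem_Ico] at hk₀
  have hly : IsLyndon (w.drop k₀) := by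
    rw [isLyndon_iff_lt_suffix]
    refine ⟨by simpa using hk₀.2, fun a b ha hb hab => ?_⟩
    have hla := List.length_pos_of_ne_nil ha
    have hlb := List.length_pos_of_ne_nil hb
    have hlen := congrArg List.length hab
    rw [List.length_append, List.length_drop] at hlen
    have hb' : b = w.drop (k₀ + a.length) := by
      rw [← List.drop_drop, hab, List.drop_left]
    refine lt_of_le_of_ne ?_ fun heq => ?_
    · rw [hb']
      exact hmin _ (Finset.mem_Ico.mpr (by omega))
    · have := congrArg List.length heq
      rw [List.length_drop] at this
      omega
  have hle := stdCut_le hk₀.1 hk₀.2 hly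
  have hmk := hmin k (Finset.mem_Ico.mpr ⟨h1, h2⟩)
  suffices w.drop (stdCut w) ≤ w.drop k₀ from this.trans hmk
  rcases hle.eq_or_lt with heq | hlt
  · rw [heq]
  · have hs := stdCut_isLyndon h
    have hdec : w.drop (stdCut w) = (w.drop (stdCut w)).take (k₀ - stdCut w) ++ w.drop k₀ := by
      conv_lhs => rw [← List.take_append_drop (k₀ - stdCut w) (w.drop (stdCut w))]
      rw [List.drop_drop, Nat.add_sub_cancel' hle]
    rw [hdec] at hs ⊢
    refine (hs.lt_suffix ?_ hly.ne_nil).le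
    have hp : 0 < ((w.drop (stdCut w)).take (k₀ - stdCut w)).length := by
      rw [List.length_take, List.length_drop]
      omega
    exact List.length_pos_iff.mp hp

/-- Let w = uv and let b be a proper suffix of u with b < u. If u = bc, then w < bv cancels to cv <
v, against the minimality of v among proper suffixes. Otherwise bv < uv, against w being Lyndon. -/
theorem IsLyndon.take_stdCut {w : Word} (hw : IsLyndon w) (h : 2 ≤ w.length) :
    IsLyndon (w.take (stdCut w)) ∧ w.take (stdCut w) < w.drop (stdCut w) := by
  obtain ⟨h1, h2⟩ := stdCut_spec w h
  have hmin : ∀ k, 1 ≤ k → k < w.length → w.drop (stdCut w) ≤ w.drop k :=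
    fun k => drop_stdCut_le h
  have hdec := List.take_append_drop (stdCut w) w
  have hlu : (w.take (stdCut w)).length = stdCut w := by
    rw [List.length_take]
    omega
  have hlv : (w.drop (stdCut w)).length = w.length - stdCut w := List.length_drop
  generalize w.take (stdCut w) = u at hdec hlu ⊢
  generalize w.drop (stdCut w) = v at hdec hlv hmin ⊢
  generalize stdCut w = n at h1 h2 hlu hlv
  subst hdec
  have hu : u ≠ [] := List.length_pos_iff.mp (by omega)
  have hv : v ≠ [] := List.length_pos_iff.mp (by omega)
  refine ⟨?_, (le_append_right u v).trans_lt (hw.lt_suffix hu hv)⟩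
  rw [isLyndon_iff_lt_suffix]
  refine ⟨hu, ?_⟩
  rintro a b ha hb rfl
  have hla := List.length_pos_of_ne_nil ha
  have hlb := List.length_pos_of_ne_nil hb
  rw [List.append_assoc] at hw hmin
  have hlt := hw.lt_suffix ha (b := b ++ v) (by simp [hb])
  rw [← List.append_assoc] at hlt
  by_contra hcon
  have hle : b ≤ a ++ b := not_lt.mp hcon
  have hne : b ≠ a ++ b := fun heq => by
    have := congrArg List.length heq
    rw [List.length_append] at this
    omega
  have hlt' : b < a ++ b := lt_of_le_of_ne hle hne
  by_cases hp : b <+: a ++ b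
  · obtain ⟨c, hc⟩ := hp
    rw [← hc, List.append_assoc] at hlt
    have h3 := append_lt_append_left_iff.mp hlt
    have hlc := congrArg List.length hc
    rw [List.length_append, List.length_append] at hlc
    have h4 := hmin b.length (by omega) (by simp; omega)
    rw [← List.append_assoc, ← hc, List.append_assoc, List.drop_left] at h4
    exact absurd h3 (not_lt.mpr h4)
  · exact lt_asymm hlt (append_lt_append_of_not_prefix hlt' hp v v)

/-- Every Lyndon word that is not a letter is a product of two smaller ones. -/
theorem IsLyndon.exists_factor {w : Word} (hw : IsLyndon w) (h : 2 ≤ w.length) :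
    ∃ u v : Word, w = u ++ v ∧ IsLyndon u ∧ IsLyndon v ∧ u < v :=
  ⟨_, _, (List.take_append_drop (stdCut w) w).symm, (hw.take_stdCut h).1, stdCut_isLyndon h,
    (hw.take_stdCut h).2⟩

/-- A longer Lyndon suffix would be pv with p a proper suffix of u, so pv < v. But v is at most the
smallest proper suffix of u, hence at most p and pv. -/
theorem stdCut_append {u v : Word} (hu : IsLyndon u) (hv : IsLyndon v)
    (h : u.length = 1 ∨ v ≤ u.drop (stdCut u)) : stdCut (u ++ v) = u.length := by
  have hlu := hu.length_pos
  have hlv := hv.length_pos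
  have hle : stdCut (u ++ v) ≤ u.length := by
    refine stdCut_le hlu (by simpa using hlv) ?_
    rwa [List.drop_left]
  refine le_antisymm hle (not_lt.mp fun hlt => ?_)
  have hlen : 2 ≤ (u ++ v).length := by
    rw [List.length_append]
    omega
  have h1 := (stdCut_spec (u ++ v) hlen).1
  have hly := stdCut_isLyndon hlen
  rw [List.drop_append_of_le_length hle] at hly
  have hne : u.drop (stdCut (u ++ v)) ≠ [] := by simpa using hlt
  have hlt2 := hly.lt_suffix hne hv.ne_nil
  rcases h with h | h
  · omega
  · have h3 := drop_stdCut_le (w := u) (by omega) h1 hlt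
    exact absurd hlt2 (not_lt.mpr ((h.trans h3).trans (le_append_right _ _)))

/-! ### Standard bracketings of Lyndon words -/

section Bracketing

variable (K : Type*) [Field K]

attribute [local instance] LieRing.ofAssociativeRing

theorem stdBracket_letter (a : Fin 2) : stdBracket K [a] = FreeLieAlgebra.of K a := by
  rw [stdBracket]
  simp

theorem stdBracket_of_two_le {w : Word} (h : 2 ≤ w.length) :
    stdBracket K w = ⁅stdBracket K (w.take (stdCut w)), stdBracket K (w.drop (stdCut w))⁆ := by
  rw [stdBracket, dif_pos h]

theorem stdBracket_append {u v : Word} (hu : IsLyndon u) (hv : IsLyndon v)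
    (h : u.length = 1 ∨ v ≤ u.drop (stdCut u)) :
    stdBracket K (u ++ v) = ⁅stdBracket K u, stdBracket K v⁆ := by
  have hlu := hu.length_pos
  have hlv := hv.length_pos
  rw [stdBracket_of_two_le K (by rw [List.length_append]; omega), stdCut_append hu hv h,
    List.take_left, List.drop_left]

/-! ### The highest word of a standard bracketing -/

/-- The word `w` as a noncommutative monomial. -/
noncomputable def wordMonomial (w : Word) : FreeAlgebra K (Fin 2) :=
  (w.map (FreeAlgebra.ι K)).prod

theorem wordMonomial_append (u v : Word) :
    wordMonomial K (u ++ v) = wordMonomial K u * wordMonomial K v := by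
  simp [wordMonomial]

theorem equiv_wordMonomial (w : Word) :
    FreeAlgebra.equivMonoidAlgebraFreeMonoid (wordMonomial K w) =
      MonoidAlgebra.single (FreeMonoid.ofList w) 1 := by
  induction w with
  | nil =>
    simp [wordMonomial]
    rfl
  | cons a w ih =>
    have : wordMonomial K (a :: w) = FreeAlgebra.ι K a * wordMonomial K w := by simp [wordMonomial]
    rw [this, map_mul, ih]
    simp [FreeAlgebra.equivMonoidAlgebraFreeMonoid, MonoidAlgebra.single_mul_single]

theorem wordCoeff_wordMonomial (u v : Word) :
    wordCoeff K (wordMonomial K u) v = if u = v then 1 else 0 := by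
  rw [wordCoeff, equiv_wordMonomial, MonoidAlgebra.coeff_single]
  split_ifs with h
  · rw [h, Finsupp.single_eq_same]
  · exact Finsupp.single_eq_of_ne fun h' => h (FreeMonoid.ofList.injective h').symm

theorem wordCoeff_add (p q : FreeAlgebra K (Fin 2)) (w : Word) :
    wordCoeff K (p + q) w = wordCoeff K p w + wordCoeff K q w := by
  simp [wordCoeff]

theorem wordCoeff_smul (c : K) (p : FreeAlgebra K (Fin 2)) (w : Word) :
    wordCoeff K (c • p) w = c * wordCoeff K p w := by
  simp [wordCoeff]

theorem wordCoeff_zero (w : Word) : wordCoeff K 0 w = 0 := by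
  simp [wordCoeff]

theorem wordCoeff_eq_zero_of_mem_span {S : Set Word} {p : FreeAlgebra K (Fin 2)}
    (hp : p ∈ Submodule.span K (wordMonomial K '' S)) {w : Word} (hw : w ∉ S) :
    wordCoeff K p w = 0 := by
  induction hp using Submodule.span_induction with
  | mem x hx =>
    obtain ⟨u, hu, rfl⟩ := hx
    rw [wordCoeff_wordMonomial, if_neg]
    rintro rfl
    exact hw hu
  | zero => exact wordCoeff_zero K w
  | add x y _ _ hx hy => rw [wordCoeff_add, hx, hy, add_zero]
  | smul c x _ hx => rw [wordCoeff_smul, hx, mul_zero]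

theorem span_mul_mem {S T U : Set Word} (h : ∀ s ∈ S, ∀ t ∈ T, s ++ t ∈ U)
    {p q : FreeAlgebra K (Fin 2)} (hp : p ∈ Submodule.span K (wordMonomial K '' S))
    (hq : q ∈ Submodule.span K (wordMonomial K '' T)) :
    p * q ∈ Submodule.span K (wordMonomial K '' U) := by
  have := Submodule.mul_mem_mul hp hq
  rw [Submodule.span_mul_span] at this
  refine Submodule.span_mono ?_ this
  rintro _ ⟨_, ⟨s, hs, rfl⟩, _, ⟨t, ht, rfl⟩, rfl⟩
  exact ⟨s ++ t, h s hs t ht, wordMonomial_append K s t⟩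

/-- The words of the same length as `w` that are lexicographically larger. -/
def largerWords (w : Word) : Set Word := {v | v.length = w.length ∧ w < v}

/-- By induction on the standard factorization w = uv, the commutator is uv − vu plus products in
which a factor was replaced by a larger word of equal length. Such products exceed uv, or exceed vu,
and vu > uv because w is Lyndon. -/
theorem toAssoc_stdBracket {w : Word} (hw : IsLyndon w) :
    toAssoc K (stdBracket K w) - wordMonomial K w ∈
      Submodule.span K (wordMonomial K '' largerWords w) := by
  induction hn : w.length using Nat.strong_induction_on generalizing w with
  | _ n ih =>
  by_cases h2 : 2 ≤ w.length
  · obtain ⟨hu, huv⟩ := hw.take_stdCut h2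
    have hv := stdCut_isLyndon h2
    have hspec := stdCut_spec w h2
    rw [stdBracket_of_two_le K h2]
    have hdec := List.take_append_drop (stdCut w) w
    have iu := ih (w.take (stdCut w)).length (by rw [List.length_take]; omega) hu rfl
    have iv := ih (w.drop (stdCut w)).length (by rw [List.length_drop]; omega) hv rfl
    generalize w.take (stdCut w) = u at *
    generalize w.drop (stdCut w) = v at *
    subst hdec
    rw [LieHom.map_lie, LieRing.of_associative_ring_bracket]
    generalize toAssoc K (stdBracket K u) = p at *
    generalize toAssoc K (stdBracket K v) = q at *
    have hvu : u ++ v < v ++ u :=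
      (hw.lt_suffix hu.ne_nil hv.ne_nil).trans_le (le_append_right v u)
    have mono : ∀ {w : Word}, wordMonomial K w ∈ Submodule.span K (wordMonomial K '' {w}) :=
      fun {w} => Submodule.subset_span ⟨w, rfl, rfl⟩
    have h1 : (p - wordMonomial K u) * wordMonomial K v ∈
        Submodule.span K (wordMonomial K '' largerWords (u ++ v)) := by
      refine span_mul_mem K ?_ iu mono
      rintro s ⟨hs1, hs2⟩ t rfl
      exact ⟨by simp [hs1], append_lt_append_of_length_le hs2 hs1.le _ _⟩
    have h2 : wordMonomial K u * (q - wordMonomial K v) ∈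
        Submodule.span K (wordMonomial K '' largerWords (u ++ v)) := by
      refine span_mul_mem K ?_ mono iv
      rintro s rfl t ⟨ht1, ht2⟩
      exact ⟨by simp [ht1], append_lt_append_left_iff.mpr ht2⟩
    have h3 : (p - wordMonomial K u) * (q - wordMonomial K v) ∈
        Submodule.span K (wordMonomial K '' largerWords (u ++ v)) := by
      refine span_mul_mem K ?_ iu iv
      rintro s ⟨hs1, hs2⟩ t ⟨ht1, ht2⟩
      exact ⟨by simp [hs1, ht1], append_lt_append_of_length_le hs2 hs1.le _ _⟩
    have h4 : wordMonomial K v * wordMonomial K u ∈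
        Submodule.span K (wordMonomial K '' largerWords (u ++ v)) := by
      refine span_mul_mem K ?_ mono mono
      rintro s rfl t rfl
      exact ⟨by simp [add_comm], hvu⟩
    have h5 : (q - wordMonomial K v) * wordMonomial K u ∈
        Submodule.span K (wordMonomial K '' largerWords (u ++ v)) := by
      refine span_mul_mem K ?_ iv mono
      rintro s ⟨hs1, hs2⟩ t rfl
      exact ⟨by simp [hs1, add_comm],
        hvu.trans (append_lt_append_of_length_le hs2 hs1.le _ _)⟩
    have h6 : wordMonomial K v * (p - wordMonomial K u) ∈
        Submodule.span K (wordMonomial K '' largerWords (u ++ v)) := by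
      refine span_mul_mem K ?_ mono iu
      rintro s rfl t ⟨ht1, ht2⟩
      exact ⟨by simp [ht1, add_comm], hvu.trans (append_lt_append_left_iff.mpr ht2)⟩
    have h7 : (q - wordMonomial K v) * (p - wordMonomial K u) ∈
        Submodule.span K (wordMonomial K '' largerWords (u ++ v)) := by
      refine span_mul_mem K ?_ iv iu
      rintro s ⟨hs1, hs2⟩ t ⟨ht1, ht2⟩
      exact ⟨by simp [hs1, ht1, add_comm],
        hvu.trans (append_lt_append_of_length_le hs2 hs1.le _ _)⟩
    have key : p * q - q * p - wordMonomial K (u ++ v) =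
        (p - wordMonomial K u) * wordMonomial K v + wordMonomial K u * (q - wordMonomial K v) +
        (p - wordMonomial K u) * (q - wordMonomial K v) - wordMonomial K v * wordMonomial K u -
        (q - wordMonomial K v) * wordMonomial K u - wordMonomial K v * (p - wordMonomial K u) -
        (q - wordMonomial K v) * (p - wordMonomial K u) := by
      rw [wordMonomial_append]
      noncomm_ring
    rw [key]
    exact Submodule.sub_mem _ (Submodule.sub_mem _ (Submodule.sub_mem _ (Submodule.sub_mem _
      (Submodule.add_mem _ (Submodule.add_mem _ h1 h2) h3) h4) h5) h6) h7
  · have h1 := hw.length_pos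
    obtain ⟨a, rfl⟩ := List.length_eq_one_iff.mp (by omega : w.length = 1)
    rw [stdBracket_letter]
    simp [toAssoc, wordMonomial]

theorem wordCoeff_stdBracket_self {w : Word} (hw : IsLyndon w) :
    wordCoeff K (toAssoc K (stdBracket K w)) w = 1 := by
  have h := wordCoeff_eq_zero_of_mem_span K (toAssoc_stdBracket K hw)
    (w := w) (fun h => lt_irrefl _ h.2)
  have h2 := wordCoeff_add K (toAssoc K (stdBracket K w) - wordMonomial K w) (wordMonomial K w) w
  rw [sub_add_cancel, h, wordCoeff_wordMonomial, if_pos rfl, zero_add] at h2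
  exact h2

theorem wordCoeff_stdBracket_ne_zero {w v : Word} (hw : IsLyndon w)
    (h : wordCoeff K (toAssoc K (stdBracket K w)) v ≠ 0) : v = w ∨ DegLexLT v w := by
  by_contra hcon
  push Not at hcon
  apply h
  have h := wordCoeff_eq_zero_of_mem_span K (toAssoc_stdBracket K hw)
    (w := v) (fun h => hcon.2 (Or.inr h))
  have h2 := wordCoeff_add K (toAssoc K (stdBracket K w) - wordMonomial K w) (wordMonomial K w) v
  rw [sub_add_cancel, h, wordCoeff_wordMonomial, if_neg hcon.1.symm, zero_add] at h2
  exact h2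

theorem DegLexLT.trans {u v w : Word} (h1 : DegLexLT u v) (h2 : DegLexLT v w) : DegLexLT u w := by
  rcases h1 with h1 | ⟨h1, h1'⟩ <;> rcases h2 with h2 | ⟨h2, h2'⟩
  · exact Or.inl (h1.trans h2)
  · exact Or.inl (by omega)
  · exact Or.inl (by omega)
  · exact Or.inr ⟨by omega, h2'.trans h1'⟩

theorem DegLexLT.irrefl (u : Word) : ¬ DegLexLT u u := by
  rintro (h | ⟨_, h⟩)
  · exact lt_irrefl _ h
  · exact lt_irrefl _ h

theorem DegLexLT.total (u v : Word) : u = v ∨ DegLexLT u v ∨ DegLexLT v u := by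
  rcases lt_trichotomy u.length v.length with h | h | h
  · exact Or.inr (Or.inl (Or.inl h))
  · rcases lt_trichotomy u v with h' | h' | h'
    · exact Or.inr (Or.inr (Or.inr ⟨h.symm, h'⟩))
    · exact Or.inl h'
    · exact Or.inr (Or.inl (Or.inr ⟨h, h'⟩))
  · exact Or.inr (Or.inr (Or.inl h))

theorem IsHighestWord.unique {p : FreeAlgebra K (Fin 2)} {u v : Word} (hu : IsHighestWord K p u)
    (hv : IsHighestWord K p v) : u = v := by
  rcases hu.2 v hv.1 with h | h
  · exact h.symm
  · rcases hv.2 u hu.1 with h' | h'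
    · exact h'
    · exact absurd (h.trans h') (DegLexLT.irrefl _)

theorem isHighestWord_stdBracket {w : Word} (hw : IsLyndon w) :
    IsHighestWord K (toAssoc K (stdBracket K w)) w :=
  ⟨by simp [wordCoeff_stdBracket_self K hw], fun _ h => wordCoeff_stdBracket_ne_zero K hw h⟩

/-- The standard bracketing of a Lyndon word without a subword in `W` is not in the ideal. -/
theorem IsGroebnerShirshov.stdBracket_notMem {W : Set Word} (h : IsGroebnerShirshov K W) {u : Word}
    (hu : IsLyndon u) (hW : ∀ w ∈ W, ¬ w <:+: u) : stdBracket K u ∉ monomialIdeal K W := by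
  intro hmem
  have hne : stdBracket K u ≠ 0 := by
    intro h0
    have := wordCoeff_stdBracket_self K hu
    rw [h0, map_zero, wordCoeff_zero] at this
    exact zero_ne_one this
  obtain ⟨v, _, hv, ⟨w, hw, hwv⟩, _⟩ := h _ hmem hne
  obtain rfl := hv.unique K (isHighestWord_stdBracket K hu)
  exact hW w hw hwv

/-! ### The standard bracketings span the free Lie algebra -/

/-- The lexicographic order itself is not well-founded (y > xy > xxy > …), but there are only
finitely many words of bounded length. -/
theorem wellFounded_lt_of_length_le (n : ℕ) : WellFounded fun u v : Word =>
    u < v ∧ u.length ≤ n ∧ v.length ≤ n := by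
  have hfin : Finite {w : Word // w.length ≤ n} := (List.finite_length_le (Fin 2) n).to_subtype
  have hwf : WellFounded fun u v : {w : Word // w.length ≤ n} => u < v := wellFounded_lt
  refine ⟨fun w => ?_⟩
  by_cases hw : w.length ≤ n
  · have hacc : ∀ u : {w : Word // w.length ≤ n},
        Acc (fun u v : Word => u < v ∧ u.length ≤ n ∧ v.length ≤ n) u.1 := by
      intro u
      induction u using hwf.induction with
      | _ u ih => exact ⟨_, fun v hv => ih ⟨v, hv.2.1⟩ hv.1⟩
    exact hacc ⟨w, hw⟩
  · exact ⟨_, fun v hv => absurd hv.2.2 hw⟩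

/-- The span of the standard bracketings of the Lyndon words of length `n` below `b`. -/
noncomputable def lyndonSpan (n : ℕ) (b : Word) : Submodule K (FreeLieAlgebra K (Fin 2)) :=
  Submodule.span K (stdBracket K '' {w | IsLyndon w ∧ w.length = n ∧ w < b})

theorem lyndonSpan_mono {n : ℕ} {b c : Word} (h : b ≤ c) : lyndonSpan K n b ≤ lyndonSpan K n c :=
  Submodule.span_mono (Set.image_mono fun _ hw => ⟨hw.1, hw.2.1, hw.2.2.trans_le h⟩)

/-- If ab is standardly factored, the bracket is [ab], and ab < b. Otherwise a = cd with c < d < b,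
and the Jacobi identity gives [c, [d, b]] − [d, [c, b]]. The inner brackets are shorter, so they
reduce to words w < b. The outer brackets then involve only words below b, which allows induction on
b. The bound w < b is part of the statement to make this second induction possible. -/
theorem lie_stdBracket_mem {a b : Word} (ha : IsLyndon a) (hb : IsLyndon b) (hab : a < b) :
    ⁅stdBracket K a, stdBracket K b⁆ ∈ lyndonSpan K (a.length + b.length) b := by
  induction hn : a.length + b.length using Nat.strong_induction_on generalizing a b with
  | _ n ihn =>
  induction b using (wellFounded_lt_of_length_le n).induction generalizing a with
  | _ b ihb =>
  have hla := ha.length_pos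
  have hlb := hb.length_pos
  -- Skew-symmetry puts the larger word second, where it is still below b and the inner induction
  -- applies.
  have swap : ∀ {c d : Word}, IsLyndon c → IsLyndon d → c < b → d < b →
      c.length + d.length = n → ⁅stdBracket K c, stdBracket K d⁆ ∈ lyndonSpan K n b := by
    intro c d hc hd hcb hdb hl
    have hlc := hc.length_pos
    have hld := hd.length_pos
    rcases lt_trichotomy c d with h | rfl | h
    · exact lyndonSpan_mono K hdb.le (ihb d ⟨hdb, by omega, by omega⟩ hc hd h hl)
    · rw [lie_self]
      exact Submodule.zero_mem _
    · rw [← lie_skew]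
      exact Submodule.neg_mem _ (lyndonSpan_mono K hcb.le
        (ihb c ⟨hcb, by omega, by omega⟩ hd hc h (by omega)))
  by_cases hstd : a.length = 1 ∨ b ≤ a.drop (stdCut a)
  · rw [← stdBracket_append K ha hb hstd]
    refine Submodule.subset_span ⟨_, ⟨ha.append hb hab, by simpa using hn, ?_⟩, rfl⟩
    exact (ha.append hb hab).lt_suffix ha.ne_nil hb.ne_nil
  · push Not at hstd
    have h2 : 2 ≤ a.length := by omega
    obtain ⟨h1, h12⟩ := ha.take_stdCut h2
    have h2' := stdCut_isLyndon h2
    have hl1 := h1.length_pos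
    have hl2 := h2'.length_pos
    have hlt := hstd.2
    rw [stdBracket_of_two_le K h2]
    have hla' := congrArg List.length (List.take_append_drop (stdCut a) a)
    rw [List.length_append] at hla'
    have hab1 : a.take (stdCut a) < b := h12.trans hlt
    generalize a.take (stdCut a) = c at *
    generalize a.drop (stdCut a) = d at *
    rw [lie_lie]
    have hcb := ihn (c.length + b.length) (by omega) h1 hb hab1 rfl
    have hdb := ihn (d.length + b.length) (by omega) h2' hb hlt rfl
    refine Submodule.sub_mem _ ?_ ?_
    · have : ∀ x ∈ lyndonSpan K (d.length + b.length) b,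
          ⁅stdBracket K c, x⁆ ∈ lyndonSpan K n b := by
        intro x hx
        induction hx using Submodule.span_induction with
        | mem x hx =>
          obtain ⟨w, ⟨hw, hwl, hwb⟩, rfl⟩ := hx
          exact swap h1 hw hab1 hwb (by omega)
        | zero => simp
        | add x y _ _ hx hy => rw [lie_add]; exact Submodule.add_mem _ hx hy
        | smul k x _ hx => rw [lie_smul]; exact Submodule.smul_mem _ _ hx
      exact this _ hdb
    · have : ∀ x ∈ lyndonSpan K (c.length + b.length) b,
          ⁅stdBracket K d, x⁆ ∈ lyndonSpan K n b := by
        intro x hx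
        induction hx using Submodule.span_induction with
        | mem x hx =>
          obtain ⟨w, ⟨hw, hwl, hwb⟩, rfl⟩ := hx
          exact swap h2' hw hlt hwb (by omega)
        | zero => simp
        | add x y _ _ hx hy => rw [lie_add]; exact Submodule.add_mem _ hx hy
        | smul k x _ hx => rw [lie_smul]; exact Submodule.smul_mem _ _ hx
      exact this _ hcb

/-- A subspace of a Lie algebra generated by two elements is everything if it contains the
generators and is stable under bracketing. -/
theorem FreeLieAlgebra.submodule_eq_top (S : Submodule K (FreeLieAlgebra K (Fin 2)))
    (hof : ∀ a, FreeLieAlgebra.of K a ∈ S) (hlie : ∀ x ∈ S, ∀ y ∈ S, ⁅x, y⁆ ∈ S) : S = ⊤ := by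
  let L : LieSubalgebra K (FreeLieAlgebra K (Fin 2)) :=
    { S with lie_mem' := fun {x y} hx hy => hlie x hx y hy }
  let f : FreeLieAlgebra K (Fin 2) →ₗ⁅K⁆ L :=
    FreeLieAlgebra.lift K fun a => (⟨FreeLieAlgebra.of K a, hof a⟩ : L)
  have h : L.incl.comp f = LieHom.id := by
    ext a
    simp [f]
  rw [eq_top_iff]
  intro x _
  have hx := LieHom.congr_fun h x
  have : ((f x : L) : FreeLieAlgebra K (Fin 2)) = x := hx
  rw [← this]
  exact (f x).2

theorem span_stdBracket_lyndon :
    Submodule.span K (stdBracket K '' {w | IsLyndon w}) = ⊤ := by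
  refine FreeLieAlgebra.submodule_eq_top K _ (fun a => ?_) (fun x hx y hy => ?_)
  · rw [← stdBracket_letter]
    exact Submodule.subset_span ⟨_, isLyndon_singleton a, rfl⟩
  · have hle : ∀ n b, lyndonSpan K n b ≤ Submodule.span K (stdBracket K '' {w | IsLyndon w}) :=
      fun n b => Submodule.span_mono (Set.image_mono fun _ hw => hw.1)
    induction hx, hy using Submodule.span_induction₂ with
    | mem_mem x y hx hy =>
      obtain ⟨u, hu, rfl⟩ := hx
      obtain ⟨v, hv, rfl⟩ := hy
      rcases lt_trichotomy u v with h | rfl | h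
      · exact hle _ _ (lie_stdBracket_mem K hu hv h)
      · rw [lie_self]
        exact Submodule.zero_mem _
      · rw [← lie_skew]
        exact Submodule.neg_mem _ (hle _ _ (lie_stdBracket_mem K hv hu h))
    | zero_left y hy => simp
    | zero_right x hx => simp
    | add_left x y z _ _ _ h1 h2 => rw [add_lie]; exact Submodule.add_mem _ h1 h2
    | add_right x y z _ _ _ h1 h2 => rw [lie_add]; exact Submodule.add_mem _ h1 h2
    | smul_left r x y _ _ h => rw [smul_lie]; exact Submodule.smul_mem _ _ h
    | smul_right r x y _ _ h => rw [lie_smul]; exact Submodule.smul_mem _ _ h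

/-- Every nonzero element of the free Lie algebra has the form `c [u] + ∑ c_v [v]`, where `u` is
its highest word and the sum is over Lyndon words `v ≺ u`. -/
theorem exists_highest_lyndon {f : FreeLieAlgebra K (Fin 2)} (hf : f ≠ 0) :
    ∃ u : Word, IsLyndon u ∧ IsHighestWord K (toAssoc K f) u ∧ ∃ c : K, c ≠ 0 ∧
      f - c • stdBracket K u ∈
        Submodule.span K (stdBracket K '' {v : Word | IsLyndon v ∧ DegLexLT v u}) := by
  have hmem : f ∈ Submodule.span K (stdBracket K '' {w | IsLyndon w}) := by
    rw [span_stdBracket_lyndon]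
    trivial
  obtain ⟨l, hl, rfl⟩ := (Finsupp.mem_span_image_iff_linearCombination K).mp hmem
  rw [Finsupp.mem_supported] at hl
  have hne : l.support.Nonempty := by
    rw [Finsupp.support_nonempty_iff]
    rintro rfl
    simp at hf
  -- The highest Lyndon word of the expansion will be the highest word of the polynomial: distinct
  -- brackets have distinct highest words, each with coefficient one.
  have hmax : ∃ u ∈ l.support, ∀ v ∈ l.support, v = u ∨ DegLexLT v u := by
    clear hf hl hmem
    generalize l.support = s at hne ⊢
    induction hne using Finset.Nonempty.cons_induction with
    | singleton a => exact ⟨a, by simp, fun v hv => Or.inl (by simpa using hv)⟩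
    | cons a s ha hs ih =>
      obtain ⟨u, hu, hmax⟩ := ih
      rcases DegLexLT.total u a with h | h | h
      · exact absurd (h ▸ hu) ha
      · refine ⟨a, by simp, fun v hv => ?_⟩
        rw [Finset.mem_cons] at hv
        rcases hv with rfl | hv
        · exact Or.inl rfl
        · rcases hmax v hv with rfl | h'
          · exact Or.inr h
          · exact Or.inr (h'.trans h)
      · refine ⟨u, by simp [hu], fun v hv => ?_⟩
        rw [Finset.mem_cons] at hv
        rcases hv with rfl | hv
        · exact Or.inr h
        · exact hmax v hv
  obtain ⟨u, hu, hmax⟩ := hmax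
  have huL : IsLyndon u := hl hu
  have hcu : l u ≠ 0 := Finsupp.mem_support_iff.mp hu
  have hsum : Finsupp.linearCombination K (stdBracket K) l - l u • stdBracket K u ∈
      Submodule.span K (stdBracket K '' {v : Word | IsLyndon v ∧ DegLexLT v u}) := by
    have hdec : Finsupp.linearCombination K (stdBracket K) l - l u • stdBracket K u =
        Finsupp.linearCombination K (stdBracket K) (l.erase u) := by
      conv_lhs => rw [← Finsupp.single_add_erase u l]
      simp
    rw [hdec, Finsupp.mem_span_image_iff_linearCombination]
    refine ⟨_, ?_, rfl⟩
    rw [Finsupp.mem_supported]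
    intro v hv
    rw [Finset.mem_coe, Finsupp.support_erase, Finset.mem_erase] at hv
    exact ⟨hl hv.2, (hmax v hv.2).resolve_left hv.1⟩
  refine ⟨u, huL, ?_, l u, hcu, hsum⟩
  have hlow : ∀ x ∈ Submodule.span K (stdBracket K '' {v : Word | IsLyndon v ∧ DegLexLT v u}),
      ∀ v, wordCoeff K (toAssoc K x) v ≠ 0 → DegLexLT v u := by
    intro x hx
    induction hx using Submodule.span_induction with
    | mem x hx =>
      obtain ⟨w, ⟨hw, hwu⟩, rfl⟩ := hx
      intro v hv
      rcases wordCoeff_stdBracket_ne_zero K hw hv with rfl | h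
      · exact hwu
      · exact h.trans hwu
    | zero => intro v hv; simp [wordCoeff_zero] at hv
    | add x y _ _ hx hy =>
      intro v hv
      rw [map_add, wordCoeff_add] at hv
      by_cases h : wordCoeff K (toAssoc K x) v = 0
      · rw [h, zero_add] at hv
        exact hy v hv
      · exact hx v h
    | smul c x _ hx =>
      intro v hv
      rw [map_smul, wordCoeff_smul] at hv
      exact hx v (right_ne_zero_of_mul hv)
  have hcoeff : ∀ v, wordCoeff K (toAssoc K (Finsupp.linearCombination K (stdBracket K) l)) v =
      wordCoeff K (toAssoc K (Finsupp.linearCombination K (stdBracket K) l -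
        l u • stdBracket K u)) v + l u * wordCoeff K (toAssoc K (stdBracket K u)) v := by
    intro v
    rw [← wordCoeff_smul, ← wordCoeff_add, ← map_smul, ← map_add, sub_add_cancel]
  constructor
  · rw [hcoeff, wordCoeff_stdBracket_self K huL, mul_one]
    have : wordCoeff K (toAssoc K (Finsupp.linearCombination K (stdBracket K) l -
        l u • stdBracket K u)) u = 0 := by
      by_contra h
      exact DegLexLT.irrefl _ (hlow _ hsum u h)
    rwa [this, zero_add]
  · intro v hv
    rw [hcoeff] at hv
    by_cases h : wordCoeff K (toAssoc K (Finsupp.linearCombination K (stdBracket K) l -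
        l u • stdBracket K u)) v = 0
    · rw [h, zero_add] at hv
      exact wordCoeff_stdBracket_ne_zero K huL (right_ne_zero_of_mul hv)
    · exact Or.inr (hlow _ hsum v h)

/-- A criterion for Gröbner–Shirshov bases: a linear map that kills the ideal, is injective on
the brackets of the words in `N`, and reduces the brackets of all other Lyndon words to smaller
words in `N`. -/
theorem isGroebnerShirshov_of_reduction {N W : Set Word} (hNW : IsLyndonPair N W) {V : Type*}
    [AddCommGroup V] [Module K V] (φ : FreeLieAlgebra K (Fin 2) →ₗ[K] V)
    (hJ : ∀ f ∈ monomialIdeal K W, φ f = 0)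
    (hind : LinearIndependent K fun u : N => φ (stdBracket K (u : Word)))
    (hred : ∀ v, IsLyndon v → v ∉ N → φ (stdBracket K v) ∈
      Submodule.span K ((fun u => φ (stdBracket K u)) '' {u | u ∈ N ∧ DegLexLT u v})) :
    IsGroebnerShirshov K W := by
  intro f hf hf0
  obtain ⟨u, hu, hhigh, c, hc, hsum⟩ := exists_highest_lyndon K hf0
  refine ⟨u, hu, hhigh, ?_, c, hc, hsum⟩
  by_contra hW
  push Not at hW
  have huN : u ∈ N := by
    rw [hNW.atoms]
    exact ⟨hu, hW⟩
  have hlow : φ (f - c • stdBracket K u) ∈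
      Submodule.span K ((fun u => φ (stdBracket K u)) '' {v | v ∈ N ∧ DegLexLT v u}) := by
    generalize f - c • stdBracket K u = g at hsum ⊢
    induction hsum using Submodule.span_induction with
    | mem x hx =>
      obtain ⟨w, ⟨hw, hwu⟩, rfl⟩ := hx
      by_cases hwN : w ∈ N
      · exact Submodule.subset_span ⟨w, ⟨hwN, hwu⟩, rfl⟩
      · refine Submodule.span_mono (Set.image_mono fun v hv => ?_) (hred w hw hwN)
        exact ⟨hv.1, hv.2.trans hwu⟩
    | zero => simp
    | add x y _ _ hx hy => rw [map_add]; exact Submodule.add_mem _ hx hy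
    | smul c x _ hx => rw [map_smul]; exact Submodule.smul_mem _ _ hx
  -- As φ f = 0, the image of [u] would be a combination of the images of smaller words in N,
  -- against their independence.
  rw [map_sub, hJ f hf, zero_sub, map_smul, ← neg_smul] at hlow
  have hlow' := (Submodule.smul_mem_iff _ (neg_ne_zero.mpr hc)).mp hlow
  refine hind.notMem_span_image (s := {v : N | DegLexLT v.1 u}) (x := ⟨u, huN⟩)
    (DegLexLT.irrefl u) ?_
  convert hlow' using 2
  ext x
  constructor
  · rintro ⟨⟨v, hv⟩, hvu, rfl⟩
    exact ⟨v, ⟨hv, hvu⟩, rfl⟩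
  · rintro ⟨v, ⟨hv, hvu⟩, rfl⟩
    exact ⟨⟨v, hv⟩, hvu, rfl⟩

end Bracketing

section FlipWords

/-! ### The mirror image of a word -/

theorem mirror_mirror (w : Word) : mirror (mirror w) = w := by
  simp [mirror, List.map_reverse, Function.comp_def]

theorem mirror_append (u v : Word) : mirror (u ++ v) = mirror v ++ mirror u := by
  simp [mirror]

theorem length_mirror (w : Word) : (mirror w).length = w.length := by
  simp [mirror]

theorem mirror_infix_mirror {u v : Word} : mirror u <:+: mirror v ↔ u <:+: v := by
  have h : ∀ {u v : Word}, u <:+: v → mirror u <:+: mirror v := by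
    rintro u v ⟨s, t, rfl⟩
    exact ⟨mirror t, mirror s, by simp [mirror_append, List.append_assoc]⟩
  exact ⟨fun huv => by simpa only [mirror_mirror] using h huv, h⟩

/-- The word `w` if `s` is false and its mirror image if `s` is true. -/
def flipWord (s : Bool) (w : Word) : Word := if s then mirror w else w

@[simp] theorem flipWord_false (w : Word) : flipWord false w = w := rfl

@[simp] theorem flipWord_true (w : Word) : flipWord true w = mirror w := rfl

theorem flipWord_flipWord (s : Bool) (w : Word) : flipWord s (flipWord s w) = w := by
  cases s
  · rfl
  · exact mirror_mirror w

theorem flipWord_injective (s : Bool) : Function.Injective (flipWord s) :=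
  Function.LeftInverse.injective (flipWord_flipWord s)

theorem length_flipWord (s : Bool) (w : Word) : (flipWord s w).length = w.length := by
  cases s
  · rfl
  · exact length_mirror w

theorem flipWord_infix_flipWord {s : Bool} {u v : Word} :
    flipWord s u <:+: flipWord s v ↔ u <:+: v := by
  cases s
  · rfl
  · exact mirror_infix_mirror

/-- The letter that corresponds to `x`: it is `x` itself, or `y` for mirror images. -/
def flipLetter (s : Bool) : Fin 2 := if s then 1 else 0

theorem count_flipWord (s : Bool) (w : Word) :
    (flipWord s w).count (flipLetter s) = w.count 0 := by
  cases s
  · rfl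
  · have := List.count_map_of_injective w (Equiv.swap (0 : Fin 2) 1) (Equiv.injective _) 0
    rw [Equiv.swap_apply_left] at this
    rw [flipWord_true, mirror, List.count_reverse, flipLetter, if_pos rfl, this]

/-! ### The words `x y ^ k` -/

theorem length_xyPow (k : ℕ) : (xyPow k).length = k + 1 := by
  simp [xyPow]

theorem xyPow_ne_nil (k : ℕ) : xyPow k ≠ [] := by
  simp [xyPow]

theorem xyPow_succ (k : ℕ) : xyPow (k + 1) = xyPow k ++ [1] := by
  simp [xyPow, List.replicate_succ']

theorem count_xyPow (k : ℕ) : (xyPow k).count 0 = 1 := by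
  simp [xyPow, List.count_replicate]

theorem xyPow_injective : Function.Injective xyPow := fun i j h => by
  have := congrArg List.length h
  rw [length_xyPow, length_xyPow] at this
  omega

/-- After the common prefix xy^i the second word continues with y, the first one with x or not at
all. -/
theorem xyPow_append_lt {i j : ℕ} (h : i < j) {u : Word} (hu : u = [] ∨ ∃ u', u = 0 :: u')
    (v : Word) : xyPow i ++ u < xyPow j ++ v := by
  obtain ⟨k, rfl⟩ := Nat.exists_eq_add_of_lt h
  have hdec : xyPow (i + k + 1) ++ v = xyPow i ++ (1 :: (List.replicate k 1 ++ v)) := by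
    rw [xyPow, xyPow, add_assoc, List.replicate_add, List.replicate_succ]
    simp
  rw [hdec, append_lt_append_left_iff]
  rcases hu with rfl | ⟨u', rfl⟩
  · exact List.nil_lt_cons _ _
  · exact List.cons_lt_cons_iff.mpr (Or.inl (by decide))

theorem mirror_xyPow (k : ℕ) : mirror (xyPow k) = List.replicate k 0 ++ [1] := by
  simp [mirror, xyPow]

theorem mirror_xyPow_append_lt {i j : ℕ} (h : i < j) (u v : Word) :
    mirror (xyPow j) ++ u < mirror (xyPow i) ++ v := by
  obtain ⟨k, rfl⟩ := Nat.exists_eq_add_of_lt h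
  rw [mirror_xyPow, mirror_xyPow, add_assoc, List.replicate_add, List.append_assoc,
    List.append_assoc, List.append_assoc, append_lt_append_left_iff]
  simp [List.replicate_succ, List.cons_lt_cons_iff]

/-! ### Lyndon words and their mirror images -/

/-- `w` is a Lyndon word, or the mirror image of a Lyndon word if `s` is true. -/
def FlipLyndon (s : Bool) (w : Word) : Prop := IsLyndon (flipWord s w)

variable {s : Bool}

theorem FlipLyndon.ne_nil {w : Word} (h : FlipLyndon s w) : w ≠ [] := by
  rintro rfl
  apply h.1
  cases s <;> rfl

theorem flipLyndon_singleton (a : Fin 2) : FlipLyndon s [a] := by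
  have h : (flipWord s [a]).length = 1 := by rw [length_flipWord]; rfl
  obtain ⟨b, hb⟩ := List.length_eq_one_iff.mp h
  rw [FlipLyndon, hb]
  exact isLyndon_singleton b

/-- Mirroring interchanges the two factors; their order relation is therefore left out, so that the
conclusion is uniform in s. -/
theorem FlipLyndon.exists_factor {w : Word} (hw : FlipLyndon s w) (h : 2 ≤ w.length) :
    ∃ a b : Word, w = a ++ b ∧ FlipLyndon s a ∧ FlipLyndon s b := by
  rw [← length_flipWord s] at h
  obtain ⟨u, v, huv, hu, hv, _⟩ := IsLyndon.exists_factor hw h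
  cases s
  · exact ⟨u, v, huv, hu, hv⟩
  · refine ⟨mirror v, mirror u, ?_, ?_, ?_⟩
    · rw [← mirror_append, ← huv, flipWord_true, mirror_mirror]
    · simpa [FlipLyndon, mirror_mirror] using hv
    · simpa [FlipLyndon, mirror_mirror] using hu

/-- A Lyndon word of length at least two begins with x and ends with y, and mirroring exchanges
these two conditions. -/
theorem FlipLyndon.eq_or_cons {w : Word} (hw : FlipLyndon s w) : w = [1] ∨ ∃ v, w = 0 :: v := by
  obtain ⟨a, v, rfl⟩ := List.exists_cons_of_ne_nil hw.ne_nil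
  rcases eq_or_ne a 0 with rfl | ha
  · exact Or.inr ⟨v, rfl⟩
  obtain rfl : a = 1 := by omega
  rcases eq_or_ne v [] with rfl | hv
  · exact Or.inl rfl
  exfalso
  cases s
  · have hdec : (1 :: v : Word) = (1 :: v.dropLast) ++ [v.getLast hv] := by
      rw [List.cons_append, List.dropLast_append_getLast hv]
    have hw' : IsLyndon (1 :: v) := hw
    rw [hdec] at hw'
    have hlt := hw'.lt_suffix (by simp) (by simp)
    rw [List.cons_append, List.cons_lt_cons_iff] at hlt
    rcases hlt with h | ⟨_, h⟩
    · generalize v.getLast hv = c at h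
      omega
    · exact List.not_lt_nil _ h
  · have hw' : IsLyndon (mirror v ++ [0]) := by simpa [FlipLyndon, mirror] using hw
    have hm : mirror v ≠ [] := by simpa [mirror] using hv
    have hlt := hw'.lt_suffix hm (by simp)
    obtain ⟨b, u, hbu⟩ := List.exists_cons_of_ne_nil hm
    rw [hbu, List.cons_append, List.cons_lt_cons_iff] at hlt
    rcases hlt with h | ⟨_, h⟩
    · exact absurd h (Fin.not_lt_zero b)
    · exact List.not_lt_nil _ h

theorem flipLyndon_xyPow (k : ℕ) : FlipLyndon s (xyPow k) := by
  induction k with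
  | zero => exact flipLyndon_singleton 0
  | succ k ih =>
    rw [xyPow_succ]
    cases s
    · refine IsLyndon.append ih (isLyndon_singleton 1) ?_
      rw [xyPow, List.cons_lt_cons_iff]
      exact Or.inl (by decide)
    · rw [FlipLyndon, flipWord_true, mirror_append]
      refine IsLyndon.append (isLyndon_singleton 0) ih ?_
      rw [mirror_xyPow]
      have hpos : ∀ l : Word, [] < l ++ [1] := fun l =>
        lt_of_le_of_ne (le_append_right [] (l ++ [1])) (by simp)
      cases k <;> simp [mirror, List.replicate_succ, List.cons_lt_cons_iff, hpos]

/-- A Lyndon word is smaller than its last block. Mirrored, the last block x^i y is compared with an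
initial block x^k y, which again forces i < k. -/
theorem FlipLyndon.lt_of_append {i k : ℕ} {r : Word}
    (h : FlipLyndon s (xyPow i ++ (r ++ xyPow k))) : i < k := by
  by_contra hcon
  cases s
  · have h' : IsLyndon ((xyPow i ++ r) ++ xyPow k) := by simpa [FlipLyndon] using h
    have hlt := h'.lt_suffix (by simp [xyPow]) (xyPow_ne_nil k)
    rcases (not_lt.mp hcon).eq_or_lt with rfl | hlt'
    · rw [List.append_assoc] at hlt
      exact absurd hlt (not_lt.mpr (le_append_right _ _))
    · have := xyPow_append_lt hlt' (Or.inl rfl) (r ++ xyPow k)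
      rw [List.append_nil, ← List.append_assoc] at this
      exact lt_asymm hlt this
  · have h' : IsLyndon ((mirror (xyPow k) ++ mirror r) ++ mirror (xyPow i)) := by
      simpa [FlipLyndon, mirror_append] using h
    have hlt := h'.lt_suffix (by simp [mirror_xyPow]) (by simp [mirror_xyPow])
    rcases (not_lt.mp hcon).eq_or_lt with rfl | hlt'
    · rw [List.append_assoc] at hlt
      exact absurd hlt (not_lt.mpr (le_append_right _ _))
    · have := mirror_xyPow_append_lt hlt' [] (mirror r ++ mirror (xyPow i))
      rw [List.append_nil, ← List.append_assoc] at this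
      exact lt_asymm hlt this

theorem FlipLyndon.lt_of_append₂ {i k : ℕ} (h : FlipLyndon s (xyPow i ++ xyPow k)) : i < k :=
  FlipLyndon.lt_of_append (r := []) h

theorem flipLyndon_append {i j : ℕ} (h : i < j) : FlipLyndon s (xyPow i ++ xyPow j) := by
  cases s
  · refine IsLyndon.append (flipLyndon_xyPow i : FlipLyndon false _)
      (flipLyndon_xyPow j : FlipLyndon false _) ?_
    simpa using xyPow_append_lt h (Or.inl rfl) []
  · rw [FlipLyndon, flipWord_true, mirror_append]
    refine IsLyndon.append (flipLyndon_xyPow j : FlipLyndon true _)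
      (flipLyndon_xyPow i : FlipLyndon true _) ?_
    simpa using mirror_xyPow_append_lt h [] []

theorem FlipLyndon.append_left {i : ℕ} {w : Word} (h : FlipLyndon s (xyPow i ++ w))
    (hw : w ≠ []) : FlipLyndon s (xyPow i ++ (xyPow i ++ w)) := by
  cases s
  · refine IsLyndon.append (flipLyndon_xyPow i : FlipLyndon false _) h ?_
    obtain ⟨a, w, rfl⟩ := List.exists_cons_of_ne_nil hw
    have : xyPow i ++ [] < xyPow i ++ a :: w := append_lt_append_left_iff.mpr (List.nil_lt_cons _ _)
    simpa using this
  · rw [FlipLyndon, flipWord_true, mirror_append] at h ⊢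
    have hm : mirror w ≠ [] := by simpa [mirror] using hw
    rw [mirror_append]
    exact IsLyndon.append h (flipLyndon_xyPow i : FlipLyndon true _)
      (h.lt_suffix hm (by simp [mirror_xyPow]))

theorem FlipLyndon.append_right {k : ℕ} {w : Word} (h : FlipLyndon s (w ++ xyPow k))
    (hw : w ≠ []) : FlipLyndon s ((w ++ xyPow k) ++ xyPow k) := by
  cases s
  · exact IsLyndon.append h (flipLyndon_xyPow k : FlipLyndon false _)
      (IsLyndon.lt_suffix h hw (xyPow_ne_nil k))
  · rw [FlipLyndon, flipWord_true, mirror_append] at h ⊢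
    rw [mirror_append]
    refine IsLyndon.append (flipLyndon_xyPow k : FlipLyndon true _) h ?_
    obtain ⟨a, w', hw'⟩ := List.exists_cons_of_ne_nil (by simpa [mirror] using hw : mirror w ≠ [])
    rw [hw']
    have : mirror (xyPow k) ++ [] < mirror (xyPow k) ++ a :: w' :=
      append_lt_append_left_iff.mpr (List.nil_lt_cons _ _)
    simpa using this

theorem not_flipLyndon_append_self (w : Word) : ¬ FlipLyndon s (w ++ w) := by
  intro h
  have hw : w ≠ [] := by
    rintro rfl
    exact h.ne_nil rfl
  cases s
  · exact absurd (IsLyndon.lt_suffix h hw hw) (not_lt.mpr (le_append_right _ _))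
  · rw [FlipLyndon, flipWord_true, mirror_append] at h
    have hm : mirror w ≠ [] := by simpa [mirror] using hw
    exact absurd (h.lt_suffix hm hm) (not_lt.mpr (le_append_right _ _))

/-- For a fixed sum a smaller i means a larger j, and x^j y decreases in j. Words and mirror images
are thus ordered alike, and for either s the smallest word with respect to `DegLexLT` has i and j as
close as possible. -/
theorem flipWord_append_lt {i j i' j' : ℕ} (hsum : i + j = i' + j') (h : i < i') :
    flipWord s (xyPow i ++ xyPow j) < flipWord s (xyPow i' ++ xyPow j') := by
  cases s
  · exact xyPow_append_lt h (Or.inr ⟨_, rfl⟩) _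
  · rw [flipWord_true, flipWord_true, mirror_append, mirror_append]
    exact mirror_xyPow_append_lt (by omega) _ _

/-! ### Words with few letters `x` -/

/-- A word that begins with `x` is `x y ^ k` followed by nothing or a word that begins with `x`. -/
theorem exists_eq_xyPow_append (v : Word) :
    ∃ k r, (0 :: v : Word) = xyPow k ++ r ∧ (r = [] ∨ ∃ r', r = 0 :: r') := by
  induction v with
  | nil => exact ⟨0, [], rfl, Or.inl rfl⟩
  | cons a v ih =>
    obtain ⟨k, r, hkr, hr⟩ := ih
    rcases eq_or_ne a 0 with rfl | ha
    · exact ⟨0, 0 :: v, rfl, Or.inr ⟨v, rfl⟩⟩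
    · obtain rfl : a = 1 := by omega
      refine ⟨k + 1, r, ?_, hr⟩
      rw [xyPow, List.cons_append, List.cons_inj_right] at hkr ⊢
      rw [List.replicate_succ, List.cons_append, hkr]

theorem FlipLyndon.eq_of_count_eq_zero {w : Word} (hw : FlipLyndon s w) (h : w.count 0 = 0) :
    w = [1] := by
  rcases hw.eq_or_cons with rfl | ⟨v, rfl⟩
  · rfl
  · simp at h

theorem FlipLyndon.eq_of_count_eq_one {w : Word} (hw : FlipLyndon s w) (h : w.count 0 = 1) :
    ∃ k, w = xyPow k := by
  rcases hw.eq_or_cons with rfl | ⟨v, rfl⟩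
  · simp at h
  · obtain ⟨k, r, hkr, rfl | ⟨r', rfl⟩⟩ := exists_eq_xyPow_append v
    · exact ⟨k, by simpa using hkr⟩
    · rw [hkr, List.count_append, count_xyPow, List.count_cons_self] at h
      omega

theorem FlipLyndon.eq_of_count_eq_two {w : Word} (hw : FlipLyndon s w) (h : w.count 0 = 2) :
    ∃ i j, i < j ∧ w = xyPow i ++ xyPow j := by
  rcases hw.eq_or_cons with rfl | ⟨v, rfl⟩
  · simp at h
  · obtain ⟨i, r, hir, rfl | ⟨r', rfl⟩⟩ := exists_eq_xyPow_append v
    · rw [hir, List.count_append, count_xyPow] at h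
      simp at h
    · obtain ⟨j, r, hjr, rfl | ⟨r', rfl⟩⟩ := exists_eq_xyPow_append r'
      · rw [List.append_nil] at hjr
        rw [hjr] at hir
        rw [hir] at hw ⊢
        exact ⟨i, j, hw.lt_of_append₂, rfl⟩
      · rw [hir, hjr, List.count_append, List.count_append, count_xyPow, count_xyPow,
          List.count_cons_self] at h
        omega

end FlipWords

section FlipPairs

/-! ### Subwords of products of words `x y ^ k` -/

theorem xyPow_prefix {i j : ℕ} (h : i ≤ j) : xyPow i <+: xyPow j := by
  obtain ⟨k, rfl⟩ := Nat.exists_eq_add_of_le h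
  exact ⟨List.replicate k 1, by rw [xyPow, xyPow, List.replicate_add, List.cons_append]⟩

/-- This and the next lemmas list the possible Lyndon subwords of a product of up to three blocks:
such a subword is y or begins at the start of a block. -/
theorem prefix_xyPow_append {v r : Word} {i : ℕ} (hv : v ≠ []) (h : v <+: xyPow i ++ r) :
    (∃ k ≤ i, v = xyPow k) ∨ ∃ v', v = xyPow i ++ v' ∧ v' <+: r := by
  obtain ⟨t, ht⟩ := h
  rcases List.append_eq_append_iff.mp ht with ⟨a, ha, _⟩ | ⟨c, hc, hr⟩
  · left
    obtain ⟨b, v, rfl⟩ := List.exists_cons_of_ne_nil hv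
    rw [xyPow, List.cons_append, List.cons_eq_cons] at ha
    obtain ⟨rfl, ha⟩ := ha
    obtain ⟨hle, hva, _⟩ := List.append_eq_replicate_iff.mp ha.symm
    exact ⟨v.length, by omega, by rw [xyPow, ← hva]⟩
  · exact Or.inr ⟨c, hc, t, hr.symm⟩

theorem prefix_xyPow {v : Word} {i : ℕ} (hv : v ≠ []) (h : v <+: xyPow i) :
    ∃ k ≤ i, v = xyPow k := by
  rw [← List.append_nil (xyPow i)] at h
  rcases prefix_xyPow_append hv h with h | ⟨r, hr, h⟩
  · exact h
  · rw [List.prefix_nil] at h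
    exact ⟨i, le_rfl, by rw [hr, h, List.append_nil]⟩

theorem infix_xyPow_append {v r : Word} {i : ℕ} (h : (0 :: v) <:+: xyPow i ++ r) :
    (0 :: v) <+: xyPow i ++ r ∨ (0 :: v) <:+: r := by
  have key : ∀ k : ℕ, (0 :: v) <:+: List.replicate k 1 ++ r → (0 :: v) <:+: r := by
    intro k
    induction k with
    | zero => exact id
    | succ k ih =>
      intro h
      rw [List.replicate_succ, List.cons_append, List.infix_cons_iff] at h
      rcases h with h | h
      · have := (List.cons_prefix_cons.mp h).1
        exact absurd this (by decide)
      · exact ih h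
  rw [xyPow, List.cons_append, List.infix_cons_iff] at h
  exact h.imp id (key i)

variable {s : Bool}

theorem FlipLyndon.infix_xyPow {v : Word} (hv : FlipLyndon s v) {i : ℕ} (h : v <:+: xyPow i) :
    v = [1] ∨ ∃ k ≤ i, v = xyPow k := by
  rcases hv.eq_or_cons with h1 | ⟨v', rfl⟩
  · exact Or.inl h1
  rw [← List.append_nil (xyPow i)] at h
  rcases infix_xyPow_append h with h | h
  · rw [List.append_nil] at h
    exact Or.inr (prefix_xyPow (List.cons_ne_nil _ _) h)
  · simp at h

theorem FlipLyndon.infix_two {v : Word} (hv : FlipLyndon s v) {i j : ℕ}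
    (h : v <:+: xyPow i ++ xyPow j) :
    v = [1] ∨ (∃ k ≤ max i j, v = xyPow k) ∨ ∃ k ≤ j, i < k ∧ v = xyPow i ++ xyPow k := by
  rcases hv.eq_or_cons with h1 | ⟨v', hv'⟩
  · exact Or.inl h1
  rw [hv'] at h
  rcases infix_xyPow_append h with h | h
  · rw [← hv'] at h
    rcases prefix_xyPow_append hv.ne_nil h with ⟨k, hk, h⟩ | ⟨v'', rfl, h2⟩
    · exact Or.inr (Or.inl ⟨k, le_max_of_le_left hk, h⟩)
    · rcases eq_or_ne v'' [] with rfl | hne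
      · exact Or.inr (Or.inl ⟨i, le_max_left _ _, by simp⟩)
      · obtain ⟨k, hk, rfl⟩ := prefix_xyPow hne h2
        exact Or.inr (Or.inr ⟨k, hk, hv.lt_of_append₂, rfl⟩)
  · rw [← hv'] at h
    rcases hv.infix_xyPow h with h | ⟨k, hk, h⟩
    · exact Or.inl h
    · exact Or.inr (Or.inl ⟨k, le_max_of_le_right hk, h⟩)

theorem FlipLyndon.infix_three {v : Word} (hv : FlipLyndon s v) {i j k : ℕ}
    (h : v <:+: xyPow i ++ (xyPow j ++ xyPow k)) :
    v = [1] ∨ (∃ l ≤ max i (max j k), v = xyPow l) ∨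
      (∃ l ≤ j, i < l ∧ v = xyPow i ++ xyPow l) ∨ (∃ l ≤ k, j < l ∧ v = xyPow j ++ xyPow l) ∨
      ∃ l ≤ k, i < l ∧ v = xyPow i ++ (xyPow j ++ xyPow l) := by
  rcases hv.eq_or_cons with h1 | ⟨v', hv'⟩
  · exact Or.inl h1
  rw [hv'] at h
  rcases infix_xyPow_append h with h | h
  · rw [← hv'] at h
    rcases prefix_xyPow_append hv.ne_nil h with ⟨l, hl, h⟩ | ⟨v'', rfl, h2⟩
    · exact Or.inr (Or.inl ⟨l, le_max_of_le_left hl, h⟩)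
    rcases eq_or_ne v'' [] with rfl | hne
    · exact Or.inr (Or.inl ⟨i, le_max_left _ _, by simp⟩)
    rcases prefix_xyPow_append hne h2 with ⟨l, hl, rfl⟩ | ⟨r, rfl, h3⟩
    · exact Or.inr (Or.inr (Or.inl ⟨l, hl, hv.lt_of_append₂, rfl⟩))
    rcases eq_or_ne r [] with rfl | hne
    · rw [List.append_nil] at hv ⊢
      exact Or.inr (Or.inr (Or.inl ⟨j, le_rfl, hv.lt_of_append₂, rfl⟩))
    obtain ⟨l, hl, rfl⟩ := prefix_xyPow hne h3
    exact Or.inr (Or.inr (Or.inr (Or.inr ⟨l, hl, hv.lt_of_append, rfl⟩)))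
  · rw [← hv'] at h
    rcases hv.infix_two h with h | ⟨l, hl, h⟩ | h
    · exact Or.inl h
    · exact Or.inr (Or.inl ⟨l, le_max_of_le_right hl, h⟩)
    · exact Or.inr (Or.inr (Or.inr (Or.inl h)))

theorem xyPow_append_injective {i j i' j' : ℕ} (h : xyPow i ++ xyPow j = xyPow i' ++ xyPow j') :
    i = i' ∧ j = j' := by
  have hl := congrArg List.length h
  simp only [List.length_append, length_xyPow] at hl
  rcases lt_trichotomy i i' with hlt | heq | hlt
  · exact absurd h (flipWord_append_lt (s := false) (by omega) hlt).ne
  · exact ⟨heq, by omega⟩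
  · exact absurd h (flipWord_append_lt (s := false) (by omega) hlt).ne'

/-! ### Lyndon pairs and their mirror images -/

/-- The analogue of a Lyndon pair for `FlipLyndon s` in place of `IsLyndon`. -/
structure IsFlipPair (s : Bool) (N W : Set Word) : Prop where
  lyndon : ∀ w ∈ W, FlipLyndon s w
  antichain : IsAntichain (fun u v : Word => u <:+: v) W
  no_letter : ∀ w ∈ W, 2 ≤ w.length
  atoms : N = {u : Word | FlipLyndon s u ∧ ∀ w ∈ W, ¬ w <:+: u}

theorem isFlipPair_false {N W : Set Word} : IsFlipPair false N W ↔ IsLyndonPair N W :=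
  ⟨fun h => ⟨h.1, h.2, h.3, h.4⟩, fun h => ⟨h.1, h.2, h.3, h.4⟩⟩

theorem flipWord_image_image (s : Bool) (N : Set Word) : flipWord s '' (flipWord s '' N) = N := by
  rw [Set.image_image]
  simp [flipWord_flipWord]

theorem mem_flipWord_image {N : Set Word} {u : Word} :
    u ∈ flipWord s '' N ↔ flipWord s u ∈ N := by
  constructor
  · rintro ⟨v, hv, rfl⟩
    rwa [flipWord_flipWord]
  · intro h
    exact ⟨_, h, flipWord_flipWord s u⟩

theorem isLyndonPair_image {N W : Set Word} :
    IsLyndonPair (flipWord s '' N) (flipWord s '' W) ↔ IsFlipPair s N W := by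
  constructor
  · intro h
    refine ⟨fun w hw => h.lyndon _ ⟨w, hw, rfl⟩, fun u hu v hv huv hinf => ?_, fun w hw => ?_, ?_⟩
    · exact h.antichain ⟨u, hu, rfl⟩ ⟨v, hv, rfl⟩ (fun h => huv (flipWord_injective s h))
        (flipWord_infix_flipWord.mpr hinf)
    · rw [← length_flipWord s]
      exact h.no_letter _ ⟨w, hw, rfl⟩
    · ext u
      rw [← flipWord_flipWord s u, ← mem_flipWord_image, h.atoms, flipWord_flipWord]
      refine and_congr Iff.rfl ?_
      rw [Set.forall_mem_image]
      exact forall₂_congr fun w _ => not_congr flipWord_infix_flipWord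
  · intro h
    refine ⟨?_, ?_, ?_, ?_⟩
    · rintro _ ⟨w, hw, rfl⟩
      exact h.lyndon w hw
    · rintro _ ⟨u, hu, rfl⟩ _ ⟨v, hv, rfl⟩ huv hinf
      exact h.antichain hu hv (fun h => huv (congrArg _ h)) (flipWord_infix_flipWord.mp hinf)
    · rintro _ ⟨w, hw, rfl⟩
      rw [length_flipWord]
      exact h.no_letter w hw
    · ext u
      rw [mem_flipWord_image, h.atoms, Set.mem_ofPred_eq, Set.mem_ofPred_eq, Set.forall_mem_image,
        FlipLyndon, flipWord_flipWord]
      refine and_congr Iff.rfl (forall₂_congr fun w _ => not_congr ?_)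
      rw [← flipWord_infix_flipWord (s := s), flipWord_flipWord]

namespace IsFlipPair

variable {N W : Set Word}

theorem flipLyndon (h : IsFlipPair s N W) {u : Word} (hu : u ∈ N) : FlipLyndon s u := by
  rw [h.atoms] at hu
  exact hu.1

theorem mem_of_infix (h : IsFlipPair s N W) {u v : Word} (hu : u ∈ N) (hvu : v <:+: u)
    (hv : FlipLyndon s v) : v ∈ N := by
  rw [h.atoms] at hu ⊢
  exact ⟨hv, fun w hw hwv => hu.2 w hw (hwv.trans hvu)⟩

/-- W consists of the minimal words outside N. One direction is the antichain condition; in the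
other, an obstruction contained in w cannot be a proper subword, since N would contain it. -/
theorem mem_iff (h : IsFlipPair s N W) {w : Word} : w ∈ W ↔
    FlipLyndon s w ∧ 2 ≤ w.length ∧ w ∉ N ∧ ∀ v, v <:+: w → v ≠ w → FlipLyndon s v → v ∈ N := by
  constructor
  · intro hw
    refine ⟨h.lyndon w hw, h.no_letter w hw, fun hN => ?_, fun v hvw hne hv => ?_⟩
    · rw [h.atoms] at hN
      exact hN.2 w hw List.infix_rfl
    · rw [h.atoms]
      refine ⟨hv, fun w' hw' hw'v => ?_⟩
      have hw'w : w' = w := by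
        by_contra hne'
        exact h.antichain hw' hw hne' (hw'v.trans hvw)
      subst hw'w
      exact hne (hvw.eq_of_length (le_antisymm hvw.length_le hw'v.length_le))
  · rintro ⟨hw, _, hN, hprop⟩
    rw [h.atoms, Set.mem_ofPred_eq, not_and] at hN
    have := hN hw
    push Not at this
    obtain ⟨w', hw', hinf⟩ := this
    by_cases heq : w' = w
    · rwa [heq] at hw'
    · have hmem := hprop w' hinf heq (h.lyndon w' hw')
      rw [h.atoms] at hmem
      exact absurd List.infix_rfl (hmem.2 w' hw')

/-- The set `W` of a Lyndon pair is determined by `N`. -/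
theorem unique {W' : Set Word} (h : IsFlipPair s N W) (h' : IsFlipPair s N W') : W = W' := by
  ext w
  rw [h.mem_iff, h'.mem_iff]

/-- A word that avoids W splits into two shorter Lyndon words that avoid W. By induction it suffices
to examine products of two members of N, a finite case distinction for the explicit sets. -/
theorem of_factor (hW : ∀ w ∈ W, FlipLyndon s w ∧ 2 ≤ w.length ∧ w ∉ N)
    (hprop : ∀ w ∈ W, ∀ v, v <:+: w → v ≠ w → FlipLyndon s v → v ∈ N)
    (hN : ∀ u ∈ N, FlipLyndon s u) (hinf : ∀ u ∈ N, ∀ v, v <:+: u → FlipLyndon s v → v ∈ N)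
    (hletter : ∀ a : Fin 2, [a] ∈ N)
    (hmul : ∀ a ∈ N, ∀ b ∈ N, FlipLyndon s (a ++ b) → a ++ b ∈ N ∨ ∃ w ∈ W, w <:+: a ++ b) :
    IsFlipPair s N W := by
  refine ⟨fun w hw => (hW w hw).1, fun u hu v hv huv hin => ?_, fun w hw => (hW w hw).2.1, ?_⟩
  · exact (hW u hu).2.2 (hprop v hv u hin huv (hW u hu).1)
  · ext u
    refine ⟨fun hu => ⟨hN u hu, fun w hw hwu => (hW w hw).2.2 (hinf u hu w hwu (hW w hw).1)⟩, ?_⟩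
    rintro ⟨hu, havoid⟩
    induction hn : u.length using Nat.strong_induction_on generalizing u with
    | _ n ih =>
    by_cases h2 : 2 ≤ u.length
    · obtain ⟨a, b, rfl, ha, hb⟩ := hu.exists_factor h2
      have hla := List.length_pos_of_ne_nil ha.ne_nil
      have hlb := List.length_pos_of_ne_nil hb.ne_nil
      rw [List.length_append] at hn
      have ha' := ih a.length (by omega) a ha
        (fun w hw hwa => havoid w hw (hwa.trans (List.prefix_append a b).isInfix)) rfl
      have hb' := ih b.length (by omega) b hb
        (fun w hw hwb => havoid w hw (hwb.trans (List.suffix_append a b).isInfix)) rfl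
      rcases hmul a ha' b hb' hu with h | ⟨w, hw, hwu⟩
      · exact h
      · exact absurd hwu (havoid w hw)
    · have := List.length_pos_of_ne_nil hu.ne_nil
      obtain ⟨a, rfl⟩ := List.length_eq_one_iff.mp (by omega : u.length = 1)
      exact hletter a

end IsFlipPair

/-! ### The explicit Lyndon pairs -/

theorem FlipLyndon.eq_of_infix_letter {v : Word} (hv : FlipLyndon s v) (h : v <:+: [1]) :
    v = [1] := by
  have := List.length_pos_of_ne_nil hv.ne_nil
  exact h.eq_of_length (le_antisymm h.length_le this)

theorem not_flipLyndon_letter_append {b : Word} (hb : b ≠ []) : ¬ FlipLyndon s ([1] ++ b) := by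
  intro h
  rcases h.eq_or_cons with h | ⟨v, h⟩
  · simp [hb] at h
  · simp at h

theorem xyPow_append_infix {i j k : ℕ} (h : j ≤ k) (r : Word) :
    xyPow i ++ xyPow j <:+: xyPow i ++ (xyPow k ++ r) :=
  ((List.prefix_append_right_inj _).mpr ((xyPow_prefix h).trans (List.prefix_append _ r))).isInfix

theorem xyPow_append_infix' {i j k : ℕ} (h : j ≤ k) :
    xyPow i ++ xyPow j <:+: xyPow i ++ xyPow k := by
  simpa using xyPow_append_infix (i := i) h []

/-- A Lyndon product of two blocks xy^i and xy^j has i < j, so it contains the obstruction xy^i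
xy^(i+1). -/
theorem isFlipPair_M0 (s : Bool) : IsFlipPair s atomsM0 obstructionsM0 := by
  have hmem : ∀ k, xyPow k ∈ atomsM0 := fun k => Or.inl ⟨k, rfl⟩
  have hy : [1] ∈ atomsM0 := Or.inr rfl
  refine IsFlipPair.of_factor ?_ ?_ ?_ ?_ ?_ ?_
  · rintro _ ⟨k, rfl⟩
    refine ⟨flipLyndon_append (Nat.lt_succ_self k), by simp [length_xyPow]; omega, ?_⟩
    rintro (⟨j, h⟩ | h) <;> have := congrArg (List.count 0) h <;>
      simp [count_xyPow] at this
  · rintro _ ⟨k, rfl⟩ v hvw hne hv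
    rcases hv.infix_two hvw with rfl | ⟨l, hl, rfl⟩ | ⟨l, hl, hkl, rfl⟩
    · exact hy
    · exact hmem l
    · exact absurd (by rw [show l = k + 1 by omega]) hne
  · rintro _ (⟨k, rfl⟩ | rfl)
    · exact flipLyndon_xyPow k
    · exact flipLyndon_singleton 1
  · rintro _ (⟨k, rfl⟩ | rfl) v hvu hv
    · rcases hv.infix_xyPow hvu with rfl | ⟨l, _, rfl⟩
      · exact hy
      · exact hmem l
    · rw [hv.eq_of_infix_letter hvu]
      exact hy
  · intro a
    fin_cases a
    · exact hmem 0
    · exact hy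
  · rintro _ (⟨i, rfl⟩ | rfl) b hb hab
    · rcases hb with ⟨j, rfl⟩ | rfl
      · have hij := hab.lt_of_append₂
        exact Or.inr ⟨_, ⟨i, rfl⟩, xyPow_append_infix' hij⟩
      · rw [← xyPow_succ]
        exact Or.inl (hmem _)
    · refine absurd hab (not_flipLyndon_letter_append ?_)
      rcases hb with ⟨j, rfl⟩ | rfl
      · exact xyPow_ne_nil j
      · simp

theorem isFlipPair_L (s : Bool) {d : ℕ} (hd : 2 ≤ d) :
    IsFlipPair s (atomsL d) (obstructionsL d) := by
  have hmem : ∀ k, k + 2 ≤ d → xyPow k ∈ atomsL d := fun k hk => Or.inl ⟨k, hk, rfl⟩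
  have hy : [1] ∈ atomsL d := Or.inr rfl
  refine IsFlipPair.of_factor ?_ ?_ ?_ ?_ ?_ ?_
  · rintro _ (⟨k, hk, rfl⟩ | rfl)
    · refine ⟨flipLyndon_append (Nat.lt_succ_self k), by simp [length_xyPow]; omega, ?_⟩
      rintro (⟨j, _, h⟩ | h) <;> have := congrArg (List.count 0) h <;>
        simp [count_xyPow] at this
    · refine ⟨flipLyndon_xyPow _, by rw [length_xyPow]; omega, ?_⟩
      rintro (⟨j, hj, h⟩ | h)
      · have := xyPow_injective h
        omega
      · have := congrArg (List.count 0) h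
        simp [count_xyPow] at this
  · rintro _ (⟨k, hk, rfl⟩ | rfl) v hvw hne hv
    · rcases hv.infix_two hvw with rfl | ⟨l, hl, rfl⟩ | ⟨l, hl, hkl, rfl⟩
      · exact hy
      · exact hmem l (by omega)
      · exact absurd (by rw [show l = k + 1 by omega]) hne
    · rcases hv.infix_xyPow hvw with rfl | ⟨l, hl, rfl⟩
      · exact hy
      · refine hmem l ?_
        have : l ≠ d - 1 := fun h => hne (by rw [h])
        omega
  · rintro _ (⟨k, _, rfl⟩ | rfl)
    · exact flipLyndon_xyPow k
    · exact flipLyndon_singleton 1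
  · rintro _ (⟨k, hk, rfl⟩ | rfl) v hvu hv
    · rcases hv.infix_xyPow hvu with rfl | ⟨l, hl, rfl⟩
      · exact hy
      · exact hmem l (by omega)
    · rw [hv.eq_of_infix_letter hvu]
      exact hy
  · intro a
    fin_cases a
    · exact hmem 0 (by omega)
    · exact hy
  · rintro _ (⟨i, hi, rfl⟩ | rfl) b hb hab
    · rcases hb with ⟨j, hj, rfl⟩ | rfl
      · have hij := hab.lt_of_append₂
        exact Or.inr ⟨_, Or.inl ⟨i, by omega, rfl⟩, xyPow_append_infix' hij⟩
      · rw [← xyPow_succ]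
        by_cases h : i + 3 ≤ d
        · exact Or.inl (hmem _ (by omega))
        · refine Or.inr ⟨_, Or.inr rfl, ?_⟩
          rw [show d - 1 = i + 1 by omega]
    · refine absurd hab (not_flipLyndon_letter_append ?_)
      rcases hb with ⟨j, _, rfl⟩ | rfl
      · exact xyPow_ne_nil j
      · simp

theorem count_length_of_mem_atomsQ {m : ℕ} (hm : 3 ≤ m) {u : Word} (hu : u ∈ atomsQ m) :
    (u.count 0 = 0 ∧ u.length = 1) ∨ (u.count 0 = 1 ∧ u.length + 2 ≤ 2 * m) ∨
      (u.count 0 = 2 ∧ u.length + 1 = 2 * m) := by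
  rcases hu with (⟨j, hj, rfl⟩ | rfl) | rfl
  · right; left
    rw [count_xyPow, length_xyPow]
    omega
  · right; right
    rw [List.count_append, List.length_append]
    simp only [count_xyPow, length_xyPow, true_and]
    omega
  · left
    exact ⟨rfl, rfl⟩

/-- The words in N are separated from the obstructions by their length and number of letters x. The
exceptional atom creates three new obstructions: its extension by y and its products with each of
its two blocks. -/
theorem isFlipPair_Q (s : Bool) {m : ℕ} (hm : 3 ≤ m) :
    IsFlipPair s (atomsQ m) (obstructionsQ m) := by
  have hmem : ∀ k, k + 3 ≤ 2 * m → xyPow k ∈ atomsQ m := fun k hk => Or.inl (Or.inl ⟨k, hk, rfl⟩)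
  have hw : xyPow (m - 2) ++ xyPow (m - 1) ∈ atomsQ m := Or.inl (Or.inr rfl)
  have hy : [1] ∈ atomsQ m := Or.inr rfl
  have hwL : FlipLyndon s (xyPow (m - 2) ++ xyPow (m - 1)) := flipLyndon_append (by omega)
  have hcl := fun u => count_length_of_mem_atomsQ hm (u := u)
  have hpair : ∀ k ≤ m - 1, m - 2 < k → xyPow (m - 2) ++ xyPow k ∈ atomsQ m := by
    intro k hk1 hk2
    rw [show k = m - 1 by omega]
    exact hw
  refine IsFlipPair.of_factor ?_ ?_ ?_ ?_ ?_ ?_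
  · rintro _ ((rfl | rfl | rfl | rfl) | ⟨k, hk, hkm, rfl⟩)
    · refine ⟨flipLyndon_xyPow _, by rw [length_xyPow]; omega, fun h => ?_⟩
      have := hcl _ h
      simp only [count_xyPow, length_xyPow] at this
      omega
    · refine ⟨flipLyndon_append (by omega), by simp [length_xyPow]; omega, fun h => ?_⟩
      have := hcl _ h
      simp only [List.count_append, List.length_append, count_xyPow, length_xyPow] at this
      omega
    · refine ⟨hwL.append_left (xyPow_ne_nil _), by simp [length_xyPow]; omega, fun h => ?_⟩
      have := hcl _ h
      simp only [List.count_append, List.length_append, count_xyPow, length_xyPow] at this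
      omega
    · refine ⟨hwL.append_right (xyPow_ne_nil _), by simp [length_xyPow]; omega, fun h => ?_⟩
      have := hcl _ h
      simp only [List.count_append, List.length_append, count_xyPow, length_xyPow] at this
      omega
    · refine ⟨flipLyndon_append (by omega), by simp [length_xyPow]; omega, fun h => ?_⟩
      have := hcl _ h
      simp only [List.count_append, List.length_append, count_xyPow, length_xyPow] at this
      omega
  · rintro _ ((rfl | rfl | rfl | rfl) | ⟨k, hk, hkm, rfl⟩) v hvw hne hv
    · rcases hv.infix_xyPow hvw with rfl | ⟨l, hl, rfl⟩
      · exact hy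
      · have : l ≠ 2 * m - 2 := fun h => hne (by rw [h])
        exact hmem l (by omega)
    · rcases hv.infix_two hvw with rfl | ⟨l, hl, rfl⟩ | ⟨l, hl, hkl, rfl⟩
      · exact hy
      · exact hmem l (by omega)
      · have : l ≠ m := fun h => hne (by rw [h])
        exact hpair l (by omega) hkl
    · rcases hv.infix_three hvw with rfl | ⟨l, hl, rfl⟩ | ⟨l, hl, hkl, rfl⟩ |
        ⟨l, hl, hkl, rfl⟩ | ⟨l, hl, hkl, rfl⟩
      · exact hy
      · exact hmem l (by omega)
      · omega
      · exact hpair l hl hkl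
      · exact absurd (by rw [show l = m - 1 by omega]) hne
    · rw [List.append_assoc] at hvw hne
      rcases hv.infix_three hvw with rfl | ⟨l, hl, rfl⟩ | ⟨l, hl, hkl, rfl⟩ |
        ⟨l, hl, hkl, rfl⟩ | ⟨l, hl, hkl, rfl⟩
      · exact hy
      · exact hmem l (by omega)
      · exact hpair l hl hkl
      · omega
      · exact absurd (by rw [show l = m - 1 by omega]) hne
    · rcases hv.infix_two hvw with rfl | ⟨l, hl, rfl⟩ | ⟨l, hl, hkl, rfl⟩
      · exact hy
      · exact hmem l (by omega)
      · exact absurd (by rw [show l = k + 1 by omega]) hne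
  · rintro _ ((⟨k, _, rfl⟩ | rfl) | rfl)
    · exact flipLyndon_xyPow k
    · exact hwL
    · exact flipLyndon_singleton 1
  · rintro _ ((⟨k, hk, rfl⟩ | rfl) | rfl) v hvu hv
    · rcases hv.infix_xyPow hvu with rfl | ⟨l, hl, rfl⟩
      · exact hy
      · exact hmem l (by omega)
    · rcases hv.infix_two hvu with rfl | ⟨l, hl, rfl⟩ | ⟨l, hl, hkl, rfl⟩
      · exact hy
      · exact hmem l (by omega)
      · exact hpair l hl hkl
    · rw [hv.eq_of_infix_letter hvu]
      exact hy
  · intro a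
    fin_cases a
    · exact hmem 0 (by omega)
    · exact hy
  · have hB : xyPow (m - 2) ++ xyPow m ∈ obstructionsQ m := Or.inl (Or.inr (Or.inl rfl))
    have hE : ∀ k, k + 4 ≤ 2 * m → k ≠ m - 2 → xyPow k ++ xyPow (k + 1) ∈ obstructionsQ m :=
      fun k h1 h2 => Or.inr ⟨k, h1, h2, rfl⟩
    rintro _ ((⟨i, hi, rfl⟩ | rfl) | rfl) b hb hab
    · rcases hb with (⟨j, hj, rfl⟩ | rfl) | rfl
      · have hij := hab.lt_of_append₂
        by_cases him : i = m - 2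
        · subst him
          by_cases hjm : j = m - 1
          · subst hjm
            exact Or.inl hw
          · exact Or.inr ⟨_, hB, xyPow_append_infix' (by omega)⟩
        · exact Or.inr ⟨_, hE i (by omega) him, xyPow_append_infix' hij⟩
      · have hij := hab.lt_of_append
        by_cases him : i = m - 2
        · subst him
          exact Or.inr ⟨_, Or.inl (Or.inr (Or.inr (Or.inl rfl))), List.infix_rfl⟩
        · exact Or.inr ⟨_, hE i (by omega) him, xyPow_append_infix (by omega) _⟩
      · rw [← xyPow_succ]
        by_cases h : i + 4 ≤ 2 * m
        · exact Or.inl (hmem _ (by omega))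
        · refine Or.inr ⟨_, Or.inl (Or.inl rfl), ?_⟩
          rw [show 2 * m - 2 = i + 1 by omega]
    · rcases hb with (⟨j, hj, rfl⟩ | rfl) | rfl
      · rw [List.append_assoc] at hab
        have hij := hab.lt_of_append
        refine Or.inr ⟨_, Or.inl (Or.inr (Or.inr (Or.inr rfl))), ?_⟩
        exact ((List.prefix_append_right_inj _).mpr (xyPow_prefix (by omega))).isInfix
      · exact absurd hab (not_flipLyndon_append_self _)
      · refine Or.inr ⟨_, hB, ?_⟩
        rw [List.append_assoc, ← xyPow_succ, show m - 1 + 1 = m by omega]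
    · refine absurd hab (not_flipLyndon_letter_append ?_)
      rcases hb with (⟨j, _, rfl⟩ | rfl) | rfl
      · exact xyPow_ne_nil j
      · simp [xyPow_ne_nil]
      · simp

end FlipPairs

section Classification

/-! ### The combinatorial classification -/

variable {s : Bool} {N W : Set Word}

theorem IsFlipPair.letters_mem (h : IsFlipPair s N W) (h2 : xyPow 2 ∈ N) (a : Fin 2) : [a] ∈ N := by
  refine h.mem_of_infix h2 ?_ (flipLyndon_singleton a)
  fin_cases a
  · exact ⟨[], [1, 1], rfl⟩
  · exact ⟨[0, 1], [], rfl⟩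

theorem IsFlipPair.xyPow_mem_of_le (h : IsFlipPair s N W) {i j : ℕ} (hj : xyPow j ∈ N)
    (hij : i ≤ j) : xyPow i ∈ N :=
  h.mem_of_infix hj (xyPow_prefix hij).isInfix (flipLyndon_xyPow i)

theorem eq_letter_of_length_eq_one {u : Word} (hu : u.length = 1) : u = xyPow 0 ∨ u = [1] := by
  obtain ⟨a, rfl⟩ := List.length_eq_one_iff.mp hu
  fin_cases a
  · exact Or.inl rfl
  · exact Or.inr rfl

/-- In a narrow set, a word of the length of some `x y ^ k` is a letter or that word. -/
theorem IsNarrow.eq_xyPow (hnarrow : IsNarrow N) {u : Word} (hu : u ∈ N) {k : ℕ}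
    (hk : xyPow k ∈ N) (hl : u.length = k + 1) : u = [1] ∨ u = xyPow k := by
  by_cases h2 : 2 ≤ u.length
  · exact Or.inr (hnarrow u hu _ hk h2 (by rw [hl, length_xyPow]))
  · obtain rfl : k = 0 := by omega
    exact (eq_letter_of_length_eq_one hl).symm

theorem two_xyPow_ne (i j k : ℕ) : xyPow i ++ xyPow j ≠ xyPow k := by
  intro h
  have := congrArg (List.count 0) h
  simp [count_xyPow] at this

/-- The algebra enters only through `H1` and `H2`. Here K is the largest exponent with xy^K in N, if
there is one. Up to length K + 1 the words xy^k leave no room for others by narrowness, so the shape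
of N depends on its words of length K + 2. -/
theorem IsFlipPair.classification (h : IsFlipPair s N W) (hconn : IsConnectedSet N)
    (hnarrow : IsNarrow N) (h2 : xyPow 2 ∈ N)
    (H1 : ∀ K, (∀ c, 2 * c + 1 ≤ K → xyPow c ++ xyPow (c + 1) ∈ W) →
      ∀ i j, i < j → i + j = K → xyPow i ++ xyPow j ∉ N)
    (H2 : ∀ c, (∀ c' < c, xyPow c' ++ xyPow (c' + 1) ∈ W) → xyPow (2 * c + 2) ∈ W →
      xyPow c ++ xyPow (c + 2) ∉ N) :
    N = atomsM0 ∨ (∃ d, 4 ≤ d ∧ N = atomsL d) ∨ ∃ m, 3 ≤ m ∧ N = atomsQ m := by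
  have hy := h.letters_mem h2 1
  by_cases hall : ∀ k, xyPow k ∈ N
  · left
    ext u
    constructor
    · intro hu
      have hpos := List.length_pos_of_ne_nil (h.flipLyndon hu).ne_nil
      rcases hnarrow.eq_xyPow hu (hall (u.length - 1)) (by omega) with h | h
      · exact Or.inr h
      · exact Or.inl ⟨_, h⟩
    · rintro (⟨k, rfl⟩ | rfl)
      · exact hall k
      · exact hy
  right
  obtain ⟨K, hK2, hK⟩ : ∃ K, 2 ≤ K ∧ ∀ k, xyPow k ∈ N ↔ k ≤ K := by
    push Not at hall
    classical
    have hfind := Nat.find_spec hall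
    have hgt : 2 < Nat.find hall := by
      by_contra hcon
      exact hfind (h.xyPow_mem_of_le h2 (not_lt.mp hcon))
    refine ⟨Nat.find hall - 1, by omega, fun k => ⟨fun hk => ?_, fun hk => ?_⟩⟩
    · by_contra hcon
      exact hfind (h.xyPow_mem_of_le hk (by omega))
    · by_contra hcon
      have := Nat.find_min' hall hcon
      omega
  have hlen : ∀ u ∈ N, 0 < u.length := fun u hu =>
    List.length_pos_of_ne_nil (h.flipLyndon hu).ne_nil
  have hshort : ∀ u ∈ N, u.length ≤ K + 1 → u = [1] ∨ ∃ k ≤ K, u = xyPow k := by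
    intro u hu hl
    have := hlen u hu
    rcases hnarrow.eq_xyPow hu ((hK (u.length - 1)).mpr (by omega)) (by omega) with h | h
    · exact Or.inl h
    · exact Or.inr ⟨_, by omega, h⟩
  have hWc : ∀ c, c + 1 ≤ K → xyPow c ++ xyPow (c + 1) ∉ N → xyPow c ++ xyPow (c + 1) ∈ W := by
    intro c hc hN
    rw [h.mem_iff]
    refine ⟨flipLyndon_append (Nat.lt_succ_self c), by simp [length_xyPow]; omega, hN, ?_⟩
    intro v hvw hne hv
    rcases hv.infix_two hvw with rfl | ⟨l, hl, rfl⟩ | ⟨l, hl, hkl, rfl⟩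
    · exact hy
    · exact (hK l).mpr (by omega)
    · exact absurd (by rw [show l = c + 1 by omega]) hne
  have hc_notMem : ∀ c, 2 * c + 1 < K → xyPow c ++ xyPow (c + 1) ∉ N := by
    intro c hc hmem
    rcases hshort _ hmem (by simp [length_xyPow]; omega) with h | ⟨k, _, h⟩
    · have := congrArg List.length h
      simp [length_xyPow] at this
      omega
    · exact two_xyPow_ne _ _ _ h
  by_cases hex : ∃ v ∈ N, v.length = K + 2
  -- Without a word of length K + 2, connectedness excludes all longer words, and N is of type L
  -- with d = K + 2.
  swap
  · left
    refine ⟨K + 2, by omega, ?_⟩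
    ext u
    constructor
    · intro hu
      have hl : u.length ≤ K + 1 := by
        by_contra hcon
        exact hex (hconn u.length (by omega) ⟨u, hu, rfl⟩ (K + 2) (by omega) (by omega))
      rcases hshort u hu hl with h | ⟨k, hk, h⟩
      · exact Or.inr h
      · exact Or.inl ⟨k, by omega, h⟩
    · rintro (⟨k, hk, rfl⟩ | rfl)
      · exact (hK k).mpr (by omega)
      · exact hy
  right
  obtain ⟨v, hv, hvl⟩ := hex
  -- Both factors are short, hence y or a block. A last factor y would give xy^(K+1), which is not
  -- in N.
  obtain ⟨i, j, hij, hsum, rfl⟩ : ∃ i j, i < j ∧ i + j = K ∧ v = xyPow i ++ xyPow j := by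
    obtain ⟨a, b, rfl, ha, hb⟩ := (h.flipLyndon hv).exists_factor (by omega)
    have hla := List.length_pos_of_ne_nil ha.ne_nil
    have hlb := List.length_pos_of_ne_nil hb.ne_nil
    rw [List.length_append] at hvl
    have haN := h.mem_of_infix hv (List.prefix_append a b).isInfix ha
    have hbN := h.mem_of_infix hv (List.suffix_append a b).isInfix hb
    rcases hshort a haN (by omega) with rfl | ⟨i, _, rfl⟩
    · exact absurd (h.flipLyndon hv) (not_flipLyndon_letter_append hb.ne_nil)
    · rcases hshort b hbN (by omega) with rfl | ⟨j, _, rfl⟩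
      · rw [← xyPow_succ] at hv
        have := (hK _).mp hv
        simp only [length_xyPow, List.length_singleton] at hvl
        omega
      · refine ⟨i, j, (h.flipLyndon hv).lt_of_append₂, ?_, rfl⟩
        simp only [length_xyPow] at hvl
        omega
  -- If v were not the middle word, all words xy^c xy^(c+1) with 2c + 1 ≤ K would be obstructions:
  -- the shorter ones compete with some xy^k, the one of length K + 2 with v.
  obtain rfl : j = i + 1 := by
    by_contra hne
    refine H1 K (fun c hc => hWc c (by omega) ?_) i j hij hsum hv
    rcases hc.eq_or_lt with heq | hlt
    · intro hmem
      have := hnarrow _ hmem _ hv (by simp [length_xyPow]; omega) (by simp [length_xyPow]; omega)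
      have := xyPow_append_injective this
      omega
    · exact hc_notMem c hlt
  have hmid : ∀ u ∈ N, u.length ≤ K + 2 →
      u = [1] ∨ (∃ k ≤ K, u = xyPow k) ∨ u = xyPow i ++ xyPow (i + 1) := by
    intro u hu hl
    by_cases heq : u.length = K + 2
    · exact Or.inr (Or.inr (hnarrow u hu _ hv (by omega) (by rw [heq, hvl])))
    · rcases hshort u hu (by omega) with h | h
      · exact Or.inl h
      · exact Or.inr (Or.inl h)
  -- Now K = 2i + 1, so xy^(2i+2) is an obstruction and `H2` applies.
  have hi2 : xyPow i ++ xyPow (i + 2) ∉ N := by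
    refine H2 i (fun c' hc' => hWc c' (by omega) (hc_notMem c' (by omega))) ?_
    rw [h.mem_iff]
    refine ⟨flipLyndon_xyPow _, by rw [length_xyPow]; omega, ?_, fun w hw hne hwL => ?_⟩
    · rw [hK]
      omega
    · rcases hwL.infix_xyPow hw with rfl | ⟨l, hl, rfl⟩
      · exact hy
      · have : l ≠ 2 * i + 2 := fun h => hne (by rw [h])
        exact (hK l).mpr (by omega)
  -- Any candidate product is xy^i xy^(i+2), contains a forbidden xy^k xy^(k+1) with k < i, or fails
  -- to be Lyndon.
  have hlong : ∀ u ∈ N, u.length ≠ K + 3 := by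
    intro u hu hul
    obtain ⟨a, b, rfl, ha, hb⟩ := (h.flipLyndon hu).exists_factor (by omega)
    have hla := List.length_pos_of_ne_nil ha.ne_nil
    have hlb := List.length_pos_of_ne_nil hb.ne_nil
    rw [List.length_append] at hul
    have haN := h.mem_of_infix hu (List.prefix_append a b).isInfix ha
    have hbN := h.mem_of_infix hu (List.suffix_append a b).isInfix hb
    have huL := h.flipLyndon hu
    rcases hmid a haN (by omega) with rfl | ⟨k, hk, rfl⟩ | rfl
    · exact not_flipLyndon_letter_append hb.ne_nil huL
    · rcases hmid b hbN (by omega) with rfl | ⟨l, hl, rfl⟩ | rfl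
      · simp only [length_xyPow, List.length_singleton] at hul
        omega
      · have hkl := huL.lt_of_append₂
        simp only [length_xyPow] at hul
        by_cases hki : k = i
        · rw [hki, show l = i + 2 by omega] at hu
          exact hi2 hu
        · refine hc_notMem k (by omega) (h.mem_of_infix hu (xyPow_append_infix' hkl) ?_)
          exact flipLyndon_append (Nat.lt_succ_self k)
      · simp only [length_xyPow, List.length_append] at hul
        refine hc_notMem k (by omega) (h.mem_of_infix hu (xyPow_append_infix (by omega) _) ?_)
        exact flipLyndon_append (Nat.lt_succ_self k)
    · rcases hmid b hbN (by omega) with rfl | ⟨l, hl, rfl⟩ | rfl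
      · rw [List.append_assoc, ← xyPow_succ] at hu
        exact hi2 hu
      · simp only [length_xyPow, List.length_append] at hul
        rw [List.append_assoc] at huL
        have := huL.lt_of_append
        omega
      · exact not_flipLyndon_append_self _ huL
  refine ⟨i + 2, by omega, ?_⟩
  ext u
  constructor
  · intro hu
    have hl : u.length ≤ K + 2 := by
      by_contra hcon
      obtain ⟨w, hw, hwl⟩ :=
        hconn u.length (by omega) ⟨u, hu, rfl⟩ (K + 3) (by omega) (by omega)
      exact hlong w hw hwl
    rcases hmid u hu hl with h | ⟨k, hk, h⟩ | h
    · exact Or.inr h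
    · exact Or.inl (Or.inl ⟨k, by omega, h⟩)
    · exact Or.inl (Or.inr h)
  · rintro ((⟨k, hk, rfl⟩ | rfl) | rfl)
    · exact (hK k).mpr (by omega)
    · exact hv
    · exact hy

end Classification

/-! ### Lie algebras with two generators -/

section TwoGenerators

variable {K : Type*} [Field K] {A : Type*} [LieRing A] [LieAlgebra K A]

/-- `[…[[X, Y], Y]…, Y]` with `k` letters `Y`. -/
def engelElt (X Y : A) : ℕ → A
  | 0 => X
  | k + 1 => ⁅engelElt X Y k, Y⁆

/-- The brackets of length `n` and degree `c ≤ 2` in `X`, where `E_k = [X, Y, …, Y]`: they are `Y`,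
`E_k` and `[E_i, E_j]`. In higher degree, all elements. -/
def engelGen (X Y : A) : ℕ → ℕ → Set A
  | 0, n => {z | n = 1 ∧ z = Y}
  | 1, n => {z | ∃ k, k + 1 = n ∧ z = engelElt X Y k}
  | 2, n => {z | ∃ i j, i + j + 2 = n ∧ z = ⁅engelElt X Y i, engelElt X Y j⁆}
  | _ + 3, _ => Set.univ

variable {X Y : A}

/-- The derivation rule for bracketing with Y is the source of all relations between the brackets of
degree two. -/
theorem lie_engelElt_lie (i j : ℕ) : ⁅⁅engelElt X Y i, engelElt X Y j⁆, Y⁆ =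
    ⁅engelElt X Y i, engelElt X Y (j + 1)⁆ + ⁅engelElt X Y (i + 1), engelElt X Y j⁆ := by
  rw [lie_lie, ← lie_skew (engelElt X Y j) ⁅engelElt X Y i, Y⁆, sub_neg_eq_add]
  rfl

theorem lie_engelElt_right (k : ℕ) : ⁅Y, engelElt X Y k⁆ = -engelElt X Y (k + 1) := by
  rw [← lie_skew]
  rfl

theorem lie_mem_of_mem_span {S T : Set A} {U : Submodule K A} (h : ∀ u ∈ S, ∀ v ∈ T, ⁅u, v⁆ ∈ U)
    {x y : A} (hx : x ∈ Submodule.span K S) (hy : y ∈ Submodule.span K T) : ⁅x, y⁆ ∈ U := by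
  induction hx, hy using Submodule.span_induction₂ with
  | mem_mem x y hx hy => exact h x hx y hy
  | zero_left y hy => simp
  | zero_right x hx => simp
  | add_left x y z _ _ _ h1 h2 => rw [add_lie]; exact Submodule.add_mem _ h1 h2
  | add_right x y z _ _ _ h1 h2 => rw [lie_add]; exact Submodule.add_mem _ h1 h2
  | smul_left r x y _ _ h => rw [smul_lie]; exact Submodule.smul_mem _ _ h
  | smul_right r x y _ _ h => rw [lie_smul]; exact Submodule.smul_mem _ _ h

theorem lie_mem_engelGen (i j n : ℕ) (h : i + j + 2 = n) :
    ⁅engelElt X Y i, engelElt X Y j⁆ ∈ Submodule.span K (engelGen X Y 2 n) :=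
  Submodule.subset_span ⟨i, j, h, rfl⟩

/-- Brackets respect the grading by the number of letters X and by total length; taking everything
in degree three and higher makes those cases trivial. -/
theorem engelGen_lie {c d n m : ℕ} {u v : A} (hu : u ∈ engelGen X Y c n)
    (hv : v ∈ engelGen X Y d m) :
    ⁅u, v⁆ ∈ Submodule.span K (engelGen X Y (c + d) (n + m)) := by
  match c, d with
  | 0, 0 =>
    obtain ⟨rfl, rfl⟩ := hu
    obtain ⟨rfl, rfl⟩ := hv
    rw [lie_self]
    exact Submodule.zero_mem _
  | 0, 1 =>
    obtain ⟨rfl, rfl⟩ := hu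
    obtain ⟨k, rfl, rfl⟩ := hv
    rw [lie_engelElt_right]
    exact Submodule.neg_mem _ (Submodule.subset_span ⟨k + 1, by omega, rfl⟩)
  | 1, 0 =>
    obtain ⟨k, rfl, rfl⟩ := hu
    obtain ⟨rfl, rfl⟩ := hv
    exact Submodule.subset_span ⟨k + 1, rfl, rfl⟩
  | 1, 1 =>
    obtain ⟨i, rfl, rfl⟩ := hu
    obtain ⟨j, rfl, rfl⟩ := hv
    exact lie_mem_engelGen i j _ (by omega)
  | 0, 2 =>
    obtain ⟨rfl, rfl⟩ := hu
    obtain ⟨i, j, rfl, rfl⟩ := hv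
    rw [← lie_skew, lie_engelElt_lie]
    exact Submodule.neg_mem _ (Submodule.add_mem _ (lie_mem_engelGen _ _ _ (by omega))
      (lie_mem_engelGen _ _ _ (by omega)))
  | 2, 0 =>
    obtain ⟨i, j, rfl, rfl⟩ := hu
    obtain ⟨rfl, rfl⟩ := hv
    rw [lie_engelElt_lie]
    exact Submodule.add_mem _ (lie_mem_engelGen _ _ _ (by omega))
      (lie_mem_engelGen _ _ _ (by omega))
  | 0, d + 3 => rw [Nat.zero_add]; exact Submodule.subset_span (Set.mem_univ _)
  | c + 3, d =>
    rw [show c + 3 + d = c + d + 3 by omega]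
    exact Submodule.subset_span (Set.mem_univ _)
  | 1, d + 2 =>
    rw [show 1 + (d + 2) = d + 3 by omega]
    exact Submodule.subset_span (Set.mem_univ _)
  | 2, d + 1 =>
    rw [show 2 + (d + 1) = d + 3 by omega]
    exact Submodule.subset_span (Set.mem_univ _)

/-! ### Images of standard bracketings under homomorphisms -/

section Evaluation

variable {s : Bool} {φ : FreeLieAlgebra K (Fin 2) →ₗ⁅K⁆ A}

theorem count_of_length_eq_one {w : Word} (h : w.length = 1) :
    (w = [flipLetter s] ∧ w.count (flipLetter s) = 1) ∨
      (w = [flipLetter !s] ∧ w.count (flipLetter s) = 0) := by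
  obtain ⟨a, rfl⟩ := List.length_eq_one_iff.mp h
  cases s <;> fin_cases a <;> simp [flipLetter]

theorem map_stdBracket_mem (hX : φ (FreeLieAlgebra.of K (flipLetter s)) = X)
    (hY : φ (FreeLieAlgebra.of K (flipLetter !s)) = Y) (w : Word) (hw : 0 < w.length) :
    φ (stdBracket K w) ∈
      Submodule.span K (engelGen X Y (w.count (flipLetter s)) w.length) := by
  induction hn : w.length using Nat.strong_induction_on generalizing w with
  | _ n ih =>
  by_cases h2 : 2 ≤ w.length
  · obtain ⟨h1, hlt⟩ := stdCut_spec w h2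
    have hlu : (w.take (stdCut w)).length = stdCut w := by
      rw [List.length_take]
      omega
    have hlv : (w.drop (stdCut w)).length = w.length - stdCut w := List.length_drop
    have hc : w.count (flipLetter s) =
        (w.take (stdCut w)).count (flipLetter s) + (w.drop (stdCut w)).count (flipLetter s) := by
      rw [← List.count_append, List.take_append_drop]
    have ihu := ih _ (by omega) (w.take (stdCut w)) (by omega) rfl
    have ihv := ih _ (by omega) (w.drop (stdCut w)) (by omega) rfl
    have hn' : n = (w.take (stdCut w)).length + (w.drop (stdCut w)).length := by omega
    rw [stdBracket_of_two_le K h2, LieHom.map_lie, hc, hn']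
    exact lie_mem_of_mem_span (fun u hu v hv => engelGen_lie hu hv) ihu ihv
  · rcases count_of_length_eq_one (s := s) (by omega : w.length = 1) with ⟨h, hc⟩ | ⟨h, hc⟩
    · rw [hc, h, stdBracket_letter, hX]
      exact Submodule.subset_span ⟨0, by omega, rfl⟩
    · rw [hc, h, stdBracket_letter, hY]
      exact Submodule.subset_span ⟨by omega, rfl⟩

theorem map_stdBracket_mem_of_count_two (hX : φ (FreeLieAlgebra.of K (flipLetter s)) = X)
    (hY : φ (FreeLieAlgebra.of K (flipLetter !s)) = Y) {w : Word}
    (hc : w.count (flipLetter s) = 2) {U : Submodule K A}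
    (hU : ∀ i j, i + j + 2 = w.length → ⁅engelElt X Y i, engelElt X Y j⁆ ∈ U) :
    φ (stdBracket K w) ∈ U := by
  have hw : 0 < w.length := by
    have := List.count_le_length (a := flipLetter s) (l := w)
    omega
  have h := map_stdBracket_mem hX hY w hw
  rw [hc] at h
  refine Submodule.span_le.mpr ?_ h
  rintro _ ⟨i, j, hij, rfl⟩
  exact hU i j hij

/-- If neither standard factor has degree three or more, their degrees are 1 and 2 in some order, or
both are 2. The first two cases are the hypothesis, and the last follows by the Leibniz rule. -/
theorem map_stdBracket_eq_zero (hX : φ (FreeLieAlgebra.of K (flipLetter s)) = X)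
    (hY : φ (FreeLieAlgebra.of K (flipLetter !s)) = Y)
    (hcent : ∀ k i j, ⁅engelElt X Y k, ⁅engelElt X Y i, engelElt X Y j⁆⁆ = 0)
    (w : Word) (hc : 3 ≤ w.count (flipLetter s)) : φ (stdBracket K w) = 0 := by
  induction hn : w.length using Nat.strong_induction_on generalizing w with
  | _ n ih =>
  have hw := List.count_le_length (a := flipLetter s) (l := w)
  have h2 : 2 ≤ w.length := by omega
  obtain ⟨h1, hlt⟩ := stdCut_spec w h2
  have hlu : (w.take (stdCut w)).length = stdCut w := by
    rw [List.length_take]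
    omega
  have hlv : (w.drop (stdCut w)).length = w.length - stdCut w := List.length_drop
  have hcount : w.count (flipLetter s) =
      (w.take (stdCut w)).count (flipLetter s) + (w.drop (stdCut w)).count (flipLetter s) := by
    rw [← List.count_append, List.take_append_drop]
  have ihu := fun h => ih _ (by omega) (w.take (stdCut w)) h rfl
  have ihv := fun h => ih _ (by omega) (w.drop (stdCut w)) h rfl
  have hu := map_stdBracket_mem hX hY (w.take (stdCut w)) (by omega)
  have hv := map_stdBracket_mem hX hY (w.drop (stdCut w)) (by omega)
  rw [stdBracket_of_two_le K h2, LieHom.map_lie]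
  generalize w.take (stdCut w) = u at *
  generalize w.drop (stdCut w) = v at *
  by_cases hcu : 3 ≤ u.count (flipLetter s)
  · rw [ihu hcu, zero_lie]
  by_cases hcv : 3 ≤ v.count (flipLetter s)
  · rw [ihv hcv, lie_zero]
  have hcent' : ∀ i j k, ⁅⁅engelElt X Y i, engelElt X Y j⁆, engelElt X Y k⁆ = 0 := by
    intro i j k
    rw [← lie_skew, hcent, neg_zero]
  rw [← Submodule.mem_bot K]
  refine lie_mem_of_mem_span ?_ hu hv
  intro p hp q hq
  rw [Submodule.mem_bot]
  have hcases : (u.count (flipLetter s) = 1 ∧ v.count (flipLetter s) = 2) ∨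
      (u.count (flipLetter s) = 2 ∧ v.count (flipLetter s) = 1) ∨
      (u.count (flipLetter s) = 2 ∧ v.count (flipLetter s) = 2) := by omega
  rcases hcases with ⟨hcu, hcv⟩ | ⟨hcu, hcv⟩ | ⟨hcu, hcv⟩ <;> rw [hcu] at hp <;> rw [hcv] at hq
  · obtain ⟨k, _, rfl⟩ := hp
    obtain ⟨i, j, _, rfl⟩ := hq
    exact hcent k i j
  · obtain ⟨i, j, _, rfl⟩ := hp
    obtain ⟨k, _, rfl⟩ := hq
    exact hcent' i j k
  · obtain ⟨i, j, _, rfl⟩ := hp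
    obtain ⟨k, l, _, rfl⟩ := hq
    rw [leibniz_lie, hcent', hcent', zero_lie, lie_zero, add_zero]

theorem isLyndon_xyPow (k : ℕ) : IsLyndon (xyPow k) := flipLyndon_xyPow (s := false) k

theorem isLyndon_mirror_xyPow (k : ℕ) : IsLyndon (mirror (xyPow k)) :=
  flipLyndon_xyPow (s := true) k

theorem drop_stdCut_xyPow (k : ℕ) :
    (xyPow k).length = 1 ∨ (xyPow k).drop (stdCut (xyPow k)) = [1] := by
  induction k with
  | zero => exact Or.inl rfl
  | succ k ih =>
    right
    rw [xyPow_succ, stdCut_append (isLyndon_xyPow k) (isLyndon_singleton 1) (ih.imp id ge_of_eq),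
      List.drop_left]

theorem drop_stdCut_mirror_xyPow (k : ℕ) :
    (mirror (xyPow (k + 1))).drop (stdCut (mirror (xyPow (k + 1)))) = mirror (xyPow k) := by
  have hm : mirror (xyPow (k + 1)) = [0] ++ mirror (xyPow k) := by
    rw [xyPow_succ, mirror_append]
    rfl
  rw [hm, stdCut_append (isLyndon_singleton 0) (isLyndon_mirror_xyPow k) (Or.inl rfl)]
  rfl

/-- The standard factorizations are (xy^k)(y) and, mirrored, (x)(x^k y). In the second, Y stands on
the left, so each step changes the sign. -/
theorem map_stdBracket_xyPow (hX : φ (FreeLieAlgebra.of K (flipLetter s)) = X)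
    (hY : φ (FreeLieAlgebra.of K (flipLetter !s)) = Y) (k : ℕ) :
    ∃ c : K, c ≠ 0 ∧ φ (stdBracket K (flipWord s (xyPow k))) = c • engelElt X Y k := by
  induction k with
  | zero =>
    refine ⟨1, one_ne_zero, ?_⟩
    have : flipWord s (xyPow 0) = [flipLetter s] := by cases s <;> rfl
    rw [this, stdBracket_letter, hX, one_smul, engelElt]
  | succ k ih =>
    obtain ⟨c, hc, ih⟩ := ih
    cases s
    · refine ⟨c, hc, ?_⟩
      rw [flipWord_false] at ih ⊢
      rw [xyPow_succ, stdBracket_append K (isLyndon_xyPow k) (isLyndon_singleton 1)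
        ((drop_stdCut_xyPow k).imp id ge_of_eq), LieHom.map_lie, ih, stdBracket_letter]
      have : φ (FreeLieAlgebra.of K 1) = Y := hY
      rw [this, smul_lie, engelElt]
    · refine ⟨-c, neg_ne_zero.mpr hc, ?_⟩
      rw [flipWord_true] at ih ⊢
      have hm : mirror (xyPow (k + 1)) = [0] ++ mirror (xyPow k) := by
        rw [xyPow_succ, mirror_append]
        rfl
      rw [hm, stdBracket_append K (isLyndon_singleton 0) (isLyndon_mirror_xyPow k)
        (Or.inl rfl), LieHom.map_lie, ih, stdBracket_letter]
      have : φ (FreeLieAlgebra.of K 0) = Y := hY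
      rw [this, lie_smul, lie_engelElt_right, smul_neg, neg_smul]

/-- The consecutive exponents matter for mirror images: the right standard factor of x^(k+1) y is
x^k y, exactly the second block, so the product is standardly factored. For a larger gap it is not.
-/
theorem map_stdBracket_xyPow_append (hX : φ (FreeLieAlgebra.of K (flipLetter s)) = X)
    (hY : φ (FreeLieAlgebra.of K (flipLetter !s)) = Y) (k : ℕ) :
    ∃ c : K, c ≠ 0 ∧ φ (stdBracket K (flipWord s (xyPow k ++ xyPow (k + 1)))) =
      c • ⁅engelElt X Y k, engelElt X Y (k + 1)⁆ := by
  obtain ⟨c, hc, h⟩ := map_stdBracket_xyPow hX hY k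
  obtain ⟨d, hd, h'⟩ := map_stdBracket_xyPow hX hY (k + 1)
  cases s
  · refine ⟨c * d, mul_ne_zero hc hd, ?_⟩
    rw [flipWord_false] at h h' ⊢
    rw [stdBracket_append K (isLyndon_xyPow k) (isLyndon_xyPow (k + 1)),
      LieHom.map_lie, h, h', smul_lie, lie_smul, smul_smul]
    refine (drop_stdCut_xyPow k).imp id fun h => ?_
    rw [h, xyPow]
    exact le_of_lt (List.cons_lt_cons_iff.mpr (Or.inl (by decide)))
  · refine ⟨-(c * d), neg_ne_zero.mpr (mul_ne_zero hc hd), ?_⟩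
    rw [flipWord_true] at h h' ⊢
    rw [mirror_append, stdBracket_append K (isLyndon_mirror_xyPow (k + 1))
      (isLyndon_mirror_xyPow k), LieHom.map_lie, h, h', smul_lie, lie_smul, smul_smul,
      ← lie_skew, smul_neg, neg_smul, mul_comm c d]
    right
    rw [drop_stdCut_mirror_xyPow]

end Evaluation

/-! ### Relations between the brackets of degree two -/

section Relations

/-- Bracketing with Y shows that moving one Y across only changes the sign. Hence all brackets of
sum n + 1 agree up to sign with the middle one, which is [E_c, E_c] = 0 or [E_c, E_(c+1)]. -/
theorem lie_engelElt_eq_zero_of_middle {n : ℕ}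
    (h : ∀ i j, i + j = n → ⁅engelElt X Y i, engelElt X Y j⁆ = 0)
    (hmid : ∀ c, 2 * c = n → ⁅engelElt X Y c, engelElt X Y (c + 1)⁆ = 0) :
    ∀ i j, i + j = n + 1 → ⁅engelElt X Y i, engelElt X Y j⁆ = 0 := by
  have hstep : ∀ i j, i + j = n → ⁅engelElt X Y i, engelElt X Y (j + 1)⁆ +
      ⁅engelElt X Y (i + 1), engelElt X Y j⁆ = 0 := by
    intro i j hij
    rw [← lie_engelElt_lie, h i j hij, zero_lie]
  have hle : ∀ r i, i + (i + r) = n + 1 → ⁅engelElt X Y i, engelElt X Y (i + r)⁆ = 0 := by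
    intro r
    induction r using Nat.strong_induction_on with
    | _ r ih =>
    intro i hi
    match r with
    | 0 => rw [Nat.add_zero, lie_self]
    | 1 => exact hmid i (by omega)
    | r + 2 =>
      have h1 := hstep i (i + r + 1) (by omega)
      have h2 := ih r (by omega) (i + 1) (by omega)
      rw [show i + 1 + r = i + r + 1 by omega] at h2
      rwa [h2, add_zero] at h1
  intro i j hij
  rcases le_total i j with hle' | hle'
  · obtain ⟨r, rfl⟩ := Nat.exists_eq_add_of_le hle'
    exact hle r i hij
  · obtain ⟨r, rfl⟩ := Nat.exists_eq_add_of_le hle'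
    rw [← lie_skew, hle r j (by omega), neg_zero]

theorem lie_engelElt_eq_zero_of_le {n : ℕ}
    (hmid : ∀ c, 2 * c + 1 ≤ n → ⁅engelElt X Y c, engelElt X Y (c + 1)⁆ = 0) :
    ∀ i j, i + j ≤ n → ⁅engelElt X Y i, engelElt X Y j⁆ = 0 := by
  have key : ∀ m ≤ n, ∀ i j, i + j = m → ⁅engelElt X Y i, engelElt X Y j⁆ = 0 := by
    intro m
    induction m with
    | zero =>
      intro _ i j hij
      obtain rfl : i = j := by omega
      exact lie_self _
    | succ m ih =>
      intro hm
      exact lie_engelElt_eq_zero_of_middle (ih (by omega)) fun c hc => hmid c (by omega)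
  exact fun i j hij => key _ hij i j rfl

theorem lie_engelElt_eq_pow_smul {n : ℕ}
    (h : ∀ i j, i + j = n → ⁅engelElt X Y i, engelElt X Y j⁆ = 0) (i j : ℕ) (hij : i + j = n + 1) :
    ⁅engelElt X Y i, engelElt X Y j⁆ =
      (-1 : K) ^ i • ⁅engelElt X Y 0, engelElt X Y (n + 1)⁆ := by
  induction i generalizing j with
  | zero =>
    obtain rfl : j = n + 1 := by omega
    rw [pow_zero, one_smul]
  | succ i ih =>
    have h1 := lie_engelElt_lie (X := X) (Y := Y) i j
    rw [h i j (by omega), zero_lie, ih (j + 1) (by omega)] at h1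
    rw [pow_succ, mul_neg_one, neg_smul]
    exact eq_neg_of_add_eq_zero_right h1.symm

/-- With D = [[E_0, E_(2c+1)], Y], the brackets f_i of sum 2c + 2 satisfy f_i + f_(i+1) = (−1)^i D
and f_0 = 0, whence f_i = (−1)^(i+1) i D. For larger sums every bracket is up to sign [E_0, E_n]
with E_n = 0. -/
theorem lie_engelElt_eq_zero_above [CharZero K] {c : ℕ}
    (h : ∀ i j, i + j = 2 * c → ⁅engelElt X Y i, engelElt X Y j⁆ = 0)
    (hE : engelElt X Y (2 * c + 2) = 0) :
    ⁅⁅engelElt X Y 0, engelElt X Y (2 * c + 1)⁆, Y⁆ = 0 ∧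
      ∀ i j, 2 * c + 2 ≤ i + j → ⁅engelElt X Y i, engelElt X Y j⁆ = 0 := by
  set D : A := ⁅⁅engelElt X Y 0, engelElt X Y (2 * c + 1)⁆, Y⁆ with hD
  have hzero : ∀ k, engelElt X Y (2 * c + 2 + k) = 0 := by
    intro k
    induction k with
    | zero => exact hE
    | succ k ih => rw [← Nat.add_assoc, engelElt, ih, zero_lie]
  have hform : ∀ i j, i + j = 2 * c + 2 → ⁅engelElt X Y i, engelElt X Y j⁆ =
      ((-1 : K) ^ i * (-(i : K))) • D := by
    intro i
    induction i with
    | zero =>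
      intro j hj
      obtain rfl : j = 2 * c + 2 := by omega
      rw [hE]
      simp
    | succ i ih =>
      intro j hj
      have h1 := lie_engelElt_lie (X := X) (Y := Y) i j
      rw [lie_engelElt_eq_pow_smul (K := K) h i j (by omega), smul_lie, ← hD,
        ih (j + 1) (by omega)] at h1
      have h2 := eq_sub_of_add_eq' h1.symm
      rw [h2, ← sub_smul]
      congr 1
      push_cast
      ring
  -- Skew-symmetry at i = j = c + 1 gives (c + 1) D = 0; characteristic zero enters here.
  have hD0 : D = 0 := by
    have h1 := hform (c + 1) (c + 1) (by omega)
    rw [lie_self] at h1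
    refine (smul_eq_zero.mp h1.symm).resolve_left ?_
    refine mul_ne_zero (pow_ne_zero _ (by simp)) (neg_ne_zero.mpr ?_)
    exact Nat.cast_ne_zero.mpr (by omega)
  refine ⟨hD0, ?_⟩
  have key : ∀ r i j, i + j = 2 * c + 2 + r → ⁅engelElt X Y i, engelElt X Y j⁆ = 0 := by
    intro r
    induction r with
    | zero =>
      intro i j hij
      rw [hform i j hij, hD0, smul_zero]
    | succ r ih =>
      intro i j hij
      rw [lie_engelElt_eq_pow_smul (K := K) ih i j hij, Nat.add_assoc, hzero (r + 1), lie_zero,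
        smul_zero]
  intro i j hij
  obtain ⟨r, hr⟩ := Nat.exists_eq_add_of_le hij
  exact key r i j hr

/-- For k = 0 rewrite the element as −[E_1, E_n] and apply the Leibniz rule: [E_0, E_1] and [E_0,
E_n] vanish. As the element commutes with Y, the rest follows from E_(k+1) = [E_k, Y]. -/
theorem lie_engelElt_central {n : ℕ} (hn : 2 ≤ n)
    (h : ∀ i j, i + j ≤ n → ⁅engelElt X Y i, engelElt X Y j⁆ = 0)
    (hD : ⁅⁅engelElt X Y 0, engelElt X Y (n + 1)⁆, Y⁆ = 0) (k : ℕ) :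
    ⁅engelElt X Y k, ⁅engelElt X Y 0, engelElt X Y (n + 1)⁆⁆ = 0 := by
  induction k with
  | zero =>
    have h1 := lie_engelElt_lie (X := X) (Y := Y) 0 n
    rw [h 0 n (by omega), zero_lie] at h1
    rw [eq_neg_of_add_eq_zero_left h1.symm, lie_neg, leibniz_lie, h 0 1 (by omega),
      h 0 n (by omega), zero_lie, lie_zero, add_zero, neg_zero]
  | succ k ih =>
    have : engelElt X Y (k + 1) = ⁅engelElt X Y k, Y⁆ := rfl
    rw [this, lie_lie, ih, lie_zero, sub_zero, ← lie_skew Y, hD, neg_zero, lie_zero]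

end Relations

end TwoGenerators

/-! ### Presentations of filiform Lie algebras -/

section Presentation

variable {K : Type*} [Field K]

/-- The projection of the free Lie algebra onto the monomial Lie algebra. -/
noncomputable def monomialMk (W : Set Word) :
    FreeLieAlgebra K (Fin 2) →ₗ⁅K⁆ MonomialLie K W :=
  { (LieSubmodule.Quotient.mk' (monomialIdeal K W) :
      FreeLieAlgebra K (Fin 2) →ₗ[K] MonomialLie K W) with
    map_lie' := fun {x y} => LieSubmodule.Quotient.mk_bracket _ x y }

theorem monomialMk_surjective (W : Set Word) : Function.Surjective (monomialMk (K := K) W) :=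
  LieSubmodule.Quotient.surjective_mk' _

theorem monomialMk_eq_zero {W : Set Word} {x : FreeLieAlgebra K (Fin 2)} :
    monomialMk W x = 0 ↔ x ∈ monomialIdeal K W :=
  LieSubmodule.Quotient.mk_eq_zero _

theorem monomialMk_stdBracket {W : Set Word} {w : Word} (hw : w ∈ W) :
    monomialMk W (stdBracket K w) = 0 :=
  monomialMk_eq_zero.mpr (LieSubmodule.subset_lieSpan ⟨w, hw, rfl⟩)

/-! ### Homomorphisms out of the monomial Lie algebra -/

variable {A : Type*} [LieRing A] [LieAlgebra K A]

theorem map_eq_zero_of_mem_monomialIdeal {W : Set Word} (φ : FreeLieAlgebra K (Fin 2) →ₗ⁅K⁆ A)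
    (h : ∀ w ∈ W, φ (stdBracket K w) = 0) {f : FreeLieAlgebra K (Fin 2)}
    (hf : f ∈ monomialIdeal K W) : φ f = 0 := by
  have hle : monomialIdeal K W ≤ φ.ker := by
    rw [monomialIdeal, LieSubmodule.lieSpan_le]
    rintro _ ⟨w, hw, rfl⟩
    exact (LieHom.mem_ker).mpr (h w hw)
  exact (LieHom.mem_ker).mp (hle hf)

/-- The Lie algebra homomorphism from `g` induced by a homomorphism that kills `[W]`. -/
noncomputable def monomialLift {W : Set Word} (φ : FreeLieAlgebra K (Fin 2) →ₗ⁅K⁆ A)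
    (h : ∀ w ∈ W, φ (stdBracket K w) = 0) : MonomialLie K W →ₗ⁅K⁆ A :=
  { (Submodule.liftQ (monomialIdeal K W).toSubmodule (φ : FreeLieAlgebra K (Fin 2) →ₗ[K] A)
      fun _ hf => map_eq_zero_of_mem_monomialIdeal φ h hf) with
    map_lie' := fun {x y} => by
      obtain ⟨x, rfl⟩ := monomialMk_surjective W x
      obtain ⟨y, rfl⟩ := monomialMk_surjective W y
      rw [← LieHom.map_lie]
      exact LieHom.map_lie φ x y }

theorem monomialLift_mk {W : Set Word} (φ : FreeLieAlgebra K (Fin 2) →ₗ⁅K⁆ A)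
    (h : ∀ w ∈ W, φ (stdBracket K w) = 0) (x : FreeLieAlgebra K (Fin 2)) :
    monomialLift φ h (monomialMk W x) = φ x := rfl

/-- The induced map sends the spanning family of the quotient to a basis of the model, so the family
is itself a basis and the map is bijective. -/
theorem isBracketBasis_and_equiv {N W : Set Word} (φ : FreeLieAlgebra K (Fin 2) →ₗ⁅K⁆ A)
    (h : ∀ w ∈ W, φ (stdBracket K w) = 0)
    (hind : LinearIndependent K fun u : N => φ (stdBracket K (u : Word)))
    (hspanA : Submodule.span K (Set.range fun u : N => φ (stdBracket K (u : Word))) = ⊤)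
    (hspan : Submodule.span K
      (Set.range fun u : N => monomialMk W (stdBracket K (u : Word))) = ⊤) :
    IsBracketBasis K N W ∧ Nonempty (MonomialLie K W ≃ₗ⁅K⁆ A) := by
  have hindg : LinearIndependent K fun u : N => monomialMk W (stdBracket K (u : Word)) :=
    LinearIndependent.of_comp (monomialLift φ h : MonomialLie K W →ₗ[K] A) hind
  refine ⟨⟨hindg, hspan⟩, ⟨LieEquiv.ofBijective (monomialLift φ h) ⟨?_, ?_⟩⟩⟩
  · rw [injective_iff_map_eq_zero]
    intro x hx
    have hmem : x ∈ Submodule.span K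
        (Set.range fun u : N => monomialMk W (stdBracket K (u : Word))) := by
      rw [hspan]
      trivial
    obtain ⟨l, rfl⟩ := (Finsupp.mem_span_range_iff_exists_finsupp).mp hmem
    have h0 : (l.sum fun u c => c • φ (stdBracket K (u : Word))) = 0 := by
      rw [Finsupp.sum, map_sum] at hx
      rw [Finsupp.sum, ← hx]
      exact Finset.sum_congr rfl fun u _ => by rw [map_smul, monomialLift_mk]
    have := linearIndependent_iff.mp hind l h0
    rw [this, Finsupp.sum_zero_index]
  · have htop : LinearMap.range (monomialLift φ h : MonomialLie K W →ₗ[K] A) = ⊤ := by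
      rw [eq_top_iff, ← hspanA, Submodule.span_le]
      rintro _ ⟨u, rfl⟩
      exact ⟨monomialMk W (stdBracket K (u : Word)), rfl⟩
    exact LinearMap.range_eq_top.mp htop

/-- The relations of the filiform Lie algebras: `[E_i, E_j]` is a multiple of a central element `t`
if `i + j = 2 c + 1`, and zero otherwise. -/
structure FiliformRel (K : Type*) [Field K] {A : Type*} [LieRing A] [LieAlgebra K A] (X Y t : A)
    (c : ℕ) : Prop where
  lie_right : ⁅t, Y⁆ = 0
  central : ∀ k, ⁅engelElt X Y k, t⁆ = 0
  eq_zero : ∀ i j, i + j ≠ 2 * c + 1 → ⁅engelElt X Y i, engelElt X Y j⁆ = 0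
  mem_span : ∀ i j, i + j = 2 * c + 1 →
    ⁅engelElt X Y i, engelElt X Y j⁆ ∈ Submodule.span K {t}
  mem_span_lie : t ∈ Submodule.span K {⁅engelElt X Y c, engelElt X Y (c + 1)⁆}

variable {X Y t : A} {c : ℕ}

theorem FiliformRel.of_abelian (h : ∀ i j, ⁅engelElt X Y i, engelElt X Y j⁆ = 0) (c : ℕ) :
    FiliformRel K X Y 0 c :=
  ⟨zero_lie _, fun _ => lie_zero _, fun i j _ => h i j, fun i j _ => by
    rw [h]; exact Submodule.zero_mem _, Submodule.zero_mem _⟩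

theorem FiliformRel.lie_mem_span (h : FiliformRel K X Y t c) (i j : ℕ) :
    ⁅engelElt X Y i, engelElt X Y j⁆ ∈ Submodule.span K {t} := by
  by_cases hij : i + j = 2 * c + 1
  · exact h.mem_span i j hij
  · rw [h.eq_zero i j hij]
    exact Submodule.zero_mem _

theorem FiliformRel.lie_lie_eq_zero (h : FiliformRel K X Y t c) (k i j : ℕ) :
    ⁅engelElt X Y k, ⁅engelElt X Y i, engelElt X Y j⁆⁆ = 0 := by
  obtain ⟨a, ha⟩ := Submodule.mem_span_singleton.mp (h.lie_mem_span i j)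
  rw [← ha, lie_smul, h.central, smul_zero]

/-- The vanishing middle brackets kill all sums up to 2c, and E_(2c+2) = 0 kills those from 2c + 2
on. What survives has sum 2c + 1 and is one element up to sign. -/
theorem FiliformRel.of_obstructions [CharZero K] (hc : 1 ≤ c)
    (hmid : ∀ k < c, ⁅engelElt X Y k, engelElt X Y (k + 1)⁆ = 0)
    (hE : engelElt X Y (2 * c + 2) = 0) :
    FiliformRel K X Y ⁅engelElt X Y 0, engelElt X Y (2 * c + 1)⁆ c := by
  have hle : ∀ i j, i + j ≤ 2 * c → ⁅engelElt X Y i, engelElt X Y j⁆ = 0 :=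
    lie_engelElt_eq_zero_of_le fun k hk => hmid k (by omega)
  have habove := lie_engelElt_eq_zero_above (K := K) (fun i j hij => hle i j hij.le) hE
  have hpow := lie_engelElt_eq_pow_smul (K := K) (fun i j hij => hle i j hij.le)
  refine ⟨habove.1, lie_engelElt_central (by omega) hle habove.1, fun i j hij => ?_,
    fun i j hij => ?_, ?_⟩
  · rcases le_or_gt (i + j) (2 * c) with h | h
    · exact hle i j h
    · exact habove.2 i j (by omega)
  · rw [hpow i j hij]
    exact Submodule.smul_mem _ _ (Submodule.mem_span_singleton_self _)
  · rw [hpow c (c + 1) (by omega), Submodule.span_singleton_smul_eq (IsUnit.pow _ (by simp))]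
    exact Submodule.mem_span_singleton_self _

/-! ### Spanning sets and reduction under the filiform relations -/

section Generators

variable {s : Bool} {φ : FreeLieAlgebra K (Fin 2) →ₗ⁅K⁆ A}

theorem map_letter_mem (hX : φ (FreeLieAlgebra.of K (flipLetter s)) = X)
    (hY : φ (FreeLieAlgebra.of K (flipLetter !s)) = Y) (a : Fin 2) :
    φ (FreeLieAlgebra.of K a) = X ∨ φ (FreeLieAlgebra.of K a) = Y := by
  have : a = flipLetter s ∨ a = flipLetter !s := by
    cases s <;> fin_cases a <;> simp [flipLetter]
  rcases this with rfl | rfl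
  · exact Or.inl hX
  · exact Or.inr hY

/-- The span of Y, the E_k and t contains the generators and is closed under brackets, by the
relations. -/
theorem FiliformRel.span_eq_top (h : FiliformRel K X Y t c)
    (hX : φ (FreeLieAlgebra.of K (flipLetter s)) = X)
    (hY : φ (FreeLieAlgebra.of K (flipLetter !s)) = Y) (hφ : Function.Surjective φ)
    {S : Submodule K A} (hSY : Y ∈ S) (hSE : ∀ k, engelElt X Y k ∈ S) (hSt : t ∈ S) : S = ⊤ := by
  set G : Set A := {z | z = Y ∨ (∃ k, z = engelElt X Y k) ∨ z = t} with hG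
  have hGY : Y ∈ Submodule.span K G := Submodule.subset_span (Or.inl rfl)
  have hGE : ∀ k, engelElt X Y k ∈ Submodule.span K G := fun k =>
    Submodule.subset_span (Or.inr (Or.inl ⟨k, rfl⟩))
  have hGt : t ∈ Submodule.span K G := Submodule.subset_span (Or.inr (Or.inr rfl))
  have hskew : ∀ x y : A, ⁅x, y⁆ = 0 → ⁅y, x⁆ = 0 := fun x y hxy => by
    rw [← lie_skew, hxy, neg_zero]
  have htop : (Submodule.span K G).comap (φ : FreeLieAlgebra K (Fin 2) →ₗ[K] A) = ⊤ := by
    refine FreeLieAlgebra.submodule_eq_top K _ (fun a => ?_) (fun x hx y hy => ?_)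
    · rw [Submodule.mem_comap]
      rcases map_letter_mem hX hY a with h | h
      · rw [LieHom.coe_toLinearMap, h]
        exact hGE 0
      · rw [LieHom.coe_toLinearMap, h]
        exact hGY
    · rw [Submodule.mem_comap, LieHom.coe_toLinearMap] at hx hy ⊢
      rw [LieHom.map_lie]
      refine lie_mem_of_mem_span ?_ hx hy
      rintro u (rfl | ⟨i, rfl⟩ | rfl) v (rfl | ⟨j, rfl⟩ | rfl)
      · rw [lie_self]
        exact Submodule.zero_mem _
      · rw [lie_engelElt_right]
        exact Submodule.neg_mem _ (hGE _)
      · rw [hskew _ _ h.lie_right]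
        exact Submodule.zero_mem _
      · exact hGE (i + 1)
      · refine Submodule.span_le.mpr ?_ (h.lie_mem_span i j)
        rintro _ rfl
        exact hGt
      · rw [h.central]
        exact Submodule.zero_mem _
      · rw [h.lie_right]
        exact Submodule.zero_mem _
      · rw [hskew _ _ (h.central _)]
        exact Submodule.zero_mem _
      · rw [lie_self]
        exact Submodule.zero_mem _
  rw [eq_top_iff]
  intro x _
  obtain ⟨f, rfl⟩ := hφ x
  have hf : f ∈ (Submodule.span K G).comap (φ : FreeLieAlgebra K (Fin 2) →ₗ[K] A) := by
    rw [htop]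
    trivial
  refine Submodule.span_le.mpr ?_ hf
  rintro u (rfl | ⟨i, rfl⟩ | rfl)
  · exact hSY
  · exact hSE i
  · exact hSt

theorem map_stdBracket_letter (hY : φ (FreeLieAlgebra.of K (flipLetter !s)) = Y) :
    φ (stdBracket K (flipWord s [1])) = Y := by
  have : flipWord s [1] = [flipLetter !s] := by cases s <;> rfl
  rw [this, stdBracket_letter, hY]

theorem FiliformRel.span_range_eq_top (h : FiliformRel K X Y t c)
    (hX : φ (FreeLieAlgebra.of K (flipLetter s)) = X)
    (hY : φ (FreeLieAlgebra.of K (flipLetter !s)) = Y) (hφ : Function.Surjective φ) {N : Set Word}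
    (hy : [1] ∈ N) (hE : ∀ k, xyPow k ∉ N → engelElt X Y k = 0)
    (ht : t ≠ 0 → xyPow c ++ xyPow (c + 1) ∈ N) :
    Submodule.span K (Set.range fun u : (flipWord s '' N : Set Word) =>
      φ (stdBracket K (u : Word))) = ⊤ := by
  have hmem : ∀ u ∈ N, φ (stdBracket K (flipWord s u)) ∈ Submodule.span K
      (Set.range fun u : (flipWord s '' N : Set Word) => φ (stdBracket K (u : Word))) :=
    fun u hu => Submodule.subset_span ⟨⟨_, u, hu, rfl⟩, rfl⟩
  refine h.span_eq_top hX hY hφ ?_ (fun k => ?_) ?_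
  · have := hmem _ hy
    rwa [map_stdBracket_letter hY] at this
  · by_cases hk : xyPow k ∈ N
    · obtain ⟨a, ha, hka⟩ := map_stdBracket_xyPow hX hY k
      have := hmem _ hk
      rw [hka] at this
      exact (Submodule.smul_mem_iff _ ha).mp this
    · rw [hE k hk]
      exact Submodule.zero_mem _
  · by_cases ht0 : t = 0
    · rw [ht0]
      exact Submodule.zero_mem _
    · obtain ⟨a, ha, hka⟩ := map_stdBracket_xyPow_append hX hY c
      have := hmem _ (ht ht0)
      rw [hka] at this
      have := (Submodule.smul_mem_iff _ ha).mp this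
      refine Submodule.span_le.mpr ?_ h.mem_span_lie
      rintro _ rfl
      exact this

/-- A Lie algebra with the filiform relations in which the brackets of the words in `N` are
independent shows that `[W]` is a Gröbner–Shirshov basis. -/
theorem FiliformRel.isGroebnerShirshov (h : FiliformRel K X Y t c)
    (hX : φ (FreeLieAlgebra.of K (flipLetter s)) = X)
    (hY : φ (FreeLieAlgebra.of K (flipLetter !s)) = Y) {N W : Set Word} (hNW : IsFlipPair s N W)
    (hy : [1] ∈ N) (hE : ∀ k, xyPow k ∉ N → engelElt X Y k = 0)
    (ht : t ≠ 0 → xyPow c ++ xyPow (c + 1) ∈ N ∧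
      ∀ w ∈ W, w.count 0 = 2 → w.length ≠ 2 * c + 3)
    (hind : LinearIndependent K fun u : (flipWord s '' N : Set Word) =>
      φ (stdBracket K (u : Word))) :
    (∀ w ∈ flipWord s '' W, φ (stdBracket K w) = 0) ∧ IsGroebnerShirshov K (flipWord s '' W) := by
  -- Degree three and higher vanishes by centrality, degree one by the assumption on the E_k, and
  -- degree two away from the length 2c + 3 of t.
  have key : ∀ v, FlipLyndon s v → v ∉ N →
      (t ≠ 0 → v.count 0 = 2 → v.length ≠ 2 * c + 3) → φ (stdBracket K (flipWord s v)) = 0 := by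
    intro v hv hvN hv2
    by_cases h3 : 3 ≤ v.count 0
    · exact map_stdBracket_eq_zero hX hY h.lie_lie_eq_zero _ (by rwa [count_flipWord])
    have hcases : v.count 0 = 0 ∨ v.count 0 = 1 ∨ v.count 0 = 2 := by omega
    rcases hcases with h0 | h1 | h2
    · exact absurd (by rwa [hv.eq_of_count_eq_zero h0]) hvN
    · obtain ⟨k, rfl⟩ := hv.eq_of_count_eq_one h1
      obtain ⟨a, _, hka⟩ := map_stdBracket_xyPow hX hY k
      rw [hka, hE k hvN, smul_zero]
    · rw [← Submodule.mem_bot K]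
      refine map_stdBracket_mem_of_count_two hX hY (by rwa [count_flipWord]) fun i j hij => ?_
      rw [length_flipWord] at hij
      rw [Submodule.mem_bot]
      by_cases ht0 : t = 0
      · simpa [ht0] using h.lie_mem_span i j
      · exact h.eq_zero i j fun h => hv2 ht0 h2 (by omega)
  have hW : ∀ w ∈ flipWord s '' W, φ (stdBracket K w) = 0 := by
    rintro _ ⟨w, hw, rfl⟩
    exact key w (hNW.lyndon w hw) (hNW.mem_iff.mp hw).2.2.1 fun ht0 => (ht ht0).2 w hw
  refine ⟨hW, isGroebnerShirshov_of_reduction K (isLyndonPair_image.mpr hNW)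
    (φ : FreeLieAlgebra K (Fin 2) →ₗ[K] A)
    (fun f hf => map_eq_zero_of_mem_monomialIdeal φ hW hf) hind fun v hv hvN => ?_⟩
  obtain ⟨v, rfl⟩ : ∃ v', v = flipWord s v' := ⟨_, (flipWord_flipWord s v).symm⟩
  rw [mem_flipWord_image, flipWord_flipWord] at hvN
  rw [LieHom.coe_toLinearMap]
  by_cases hv2 : t ≠ 0 → v.count 0 = 2 → v.length ≠ 2 * c + 3
  · rw [key v hv hvN hv2]
    exact Submodule.zero_mem _
  · push Not at hv2
    obtain ⟨ht0, h2, hl⟩ := hv2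
    have htN := (ht ht0).1
    obtain ⟨i, j, hij, rfl⟩ := FlipLyndon.eq_of_count_eq_two hv h2
    simp only [List.length_append, length_xyPow] at hl
    -- The remaining words are xy^i xy^j with i + j = 2c + 1. Since i = c is the word in N, i < c,
    -- and the image, a multiple of t, is a multiple of the image of that smaller word.
    have hi : i < c := by
      by_contra hcon
      obtain rfl : i = c := by omega
      rw [show j = i + 1 by omega] at hvN
      exact hvN htN
    have hlt : DegLexLT (flipWord s (xyPow c ++ xyPow (c + 1)))
        (flipWord s (xyPow i ++ xyPow j)) := by
      refine Or.inr ⟨?_, flipWord_append_lt (by omega) hi⟩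
      rw [length_flipWord, length_flipWord]
      simp only [List.length_append, length_xyPow]
      omega
    obtain ⟨a, ha, hka⟩ := map_stdBracket_xyPow_append hX hY c
    refine map_stdBracket_mem_of_count_two hX hY (by rwa [count_flipWord]) fun p q _ => ?_
    have hmem := Submodule.subset_span (R := K)
      (s := (fun u => φ (stdBracket K u)) '' {u | u ∈ flipWord s '' N ∧
        DegLexLT u (flipWord s (xyPow i ++ xyPow j))})
      ⟨_, ⟨⟨_, htN, rfl⟩, hlt⟩, rfl⟩
    simp only [hka] at hmem
    have hmem' := (Submodule.smul_mem_iff _ ha).mp hmem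
    refine Submodule.span_le.mpr ?_ (h.lie_mem_span p q)
    rintro _ rfl
    refine Submodule.span_le.mpr ?_ h.mem_span_lie
    rintro _ rfl
    exact hmem'

end Generators

/-! ### Consequences of the Gröbner–Shirshov property -/

section Quotient

variable {s : Bool} {W : Set Word} {X Y : MonomialLie K (flipWord s '' W)}
  (hX : monomialMk (flipWord s '' W) (FreeLieAlgebra.of K (flipLetter s)) = X)
  (hY : monomialMk (flipWord s '' W) (FreeLieAlgebra.of K (flipLetter !s)) = Y)

include hX hY in
theorem engelElt_eq_zero_of_mem {k : ℕ} (h : xyPow k ∈ W) : engelElt X Y k = 0 := by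
  obtain ⟨a, ha, hk⟩ := map_stdBracket_xyPow hX hY k
  rw [monomialMk_stdBracket (Set.mem_image_of_mem _ h)] at hk
  exact (smul_eq_zero.mp hk.symm).resolve_left ha

include hX hY in
theorem lie_engelElt_eq_zero_of_mem {k : ℕ} (h : xyPow k ++ xyPow (k + 1) ∈ W) :
    ⁅engelElt X Y k, engelElt X Y (k + 1)⁆ = 0 := by
  obtain ⟨a, ha, hk⟩ := map_stdBracket_xyPow_append hX hY k
  rw [monomialMk_stdBracket (Set.mem_image_of_mem _ h)] at hk
  exact (smul_eq_zero.mp hk.symm).resolve_left ha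

end Quotient

/-- If all brackets of its length and of degree two vanish in the quotient, then the standard
bracketing of the word lies in J, which is impossible for a word of N. -/
theorem IsGroebnerShirshov.two_xyPow_notMem {s : Bool} {N W : Set Word}
    (hGS : IsGroebnerShirshov K (flipWord s '' W)) (hNW : IsFlipPair s N W)
    {X Y : MonomialLie K (flipWord s '' W)}
    (hX : monomialMk (flipWord s '' W) (FreeLieAlgebra.of K (flipLetter s)) = X)
    (hY : monomialMk (flipWord s '' W) (FreeLieAlgebra.of K (flipLetter !s)) = Y) {i j : ℕ}
    (h : ∀ p q, p + q = i + j → ⁅engelElt X Y p, engelElt X Y q⁆ = 0) :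
    xyPow i ++ xyPow j ∉ N := by
  intro hN
  have hN' : flipWord s (xyPow i ++ xyPow j) ∈ flipWord s '' N := ⟨_, hN, rfl⟩
  rw [(isLyndonPair_image.mpr hNW).atoms] at hN'
  refine hGS.stdBracket_notMem K hN'.1 hN'.2 ?_
  rw [← monomialMk_eq_zero, ← Submodule.mem_bot K]
  refine map_stdBracket_mem_of_count_two hX hY ?_ fun p q hpq => ?_
  · rw [count_flipWord, List.count_append, count_xyPow, count_xyPow]
  · rw [length_flipWord, List.length_append, length_xyPow, length_xyPow] at hpq
    rw [Submodule.mem_bot]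
    exact h p q (by omega)

theorem IsGroebnerShirshov.classification [CharZero K] {s : Bool} {N W : Set Word}
    (hGS : IsGroebnerShirshov K (flipWord s '' W)) (hNW : IsFlipPair s N W)
    (hconn : IsConnectedSet N) (hnarrow : IsNarrow N) (h2 : xyPow 2 ∈ N) :
    N = atomsM0 ∨ (∃ d, 4 ≤ d ∧ N = atomsL d) ∨ ∃ m, 3 ≤ m ∧ N = atomsQ m := by
  obtain ⟨X, hX⟩ : ∃ X, monomialMk (K := K) (flipWord s '' W)
    (FreeLieAlgebra.of K (flipLetter s)) = X := ⟨_, rfl⟩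
  obtain ⟨Y, hY⟩ : ∃ Y, monomialMk (K := K) (flipWord s '' W)
    (FreeLieAlgebra.of K (flipLetter !s)) = Y := ⟨_, rfl⟩
  refine hNW.classification hconn hnarrow h2 ?_ ?_
  · intro n hn i j _ hsum
    refine hGS.two_xyPow_notMem hNW hX hY fun p q hpq => ?_
    exact lie_engelElt_eq_zero_of_le
      (fun c hc => lie_engelElt_eq_zero_of_mem hX hY (hn c hc)) p q (by omega)
  · intro c hc hE
    refine hGS.two_xyPow_notMem hNW hX hY fun p q hpq => ?_
    have hle : ∀ i j, i + j ≤ 2 * c → ⁅engelElt X Y i, engelElt X Y j⁆ = 0 :=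
      lie_engelElt_eq_zero_of_le fun k hk => lie_engelElt_eq_zero_of_mem hX hY (hc k (by omega))
    exact (lie_engelElt_eq_zero_above (K := K) (fun i j hij => hle i j hij.le)
      (engelElt_eq_zero_of_mem hX hY hE)).2 p q (by omega)

end Presentation

/-! ### The filiform Lie algebras as models -/

section Models

variable {K : Type*} [Field K]

/-! ### Homomorphisms given by two elements, and transfer to the quotient -/

section General

variable {A : Type*} [LieRing A] [LieAlgebra K A]

theorem map_engelElt {B : Type*} [LieRing B] [LieAlgebra K B] (φ : A →ₗ⁅K⁆ B) (X Y : A) (k : ℕ) :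
    φ (engelElt X Y k) = engelElt (φ X) (φ Y) k := by
  induction k with
  | zero => rfl
  | succ k ih => rw [engelElt, LieHom.map_lie, ih, engelElt]

theorem engelElt_eq_zero_of_le {X Y : A} {i j : ℕ} (h : engelElt X Y i = 0) (hij : i ≤ j) :
    engelElt X Y j = 0 := by
  induction j, hij using Nat.le_induction with
  | base => exact h
  | succ j _ ih => rw [engelElt, ih, zero_lie]

/-- The homomorphism from the free Lie algebra that maps `x, y` to `X, Y`, or to `Y, X`. -/
noncomputable def pairHom (s : Bool) (X Y : A) : FreeLieAlgebra K (Fin 2) →ₗ⁅K⁆ A :=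
  FreeLieAlgebra.lift K fun a => if a = flipLetter s then X else Y

theorem pairHom_left (s : Bool) (X Y : A) :
    pairHom s X Y (FreeLieAlgebra.of K (flipLetter s)) = X := by
  simp [pairHom]

theorem pairHom_right (s : Bool) (X Y : A) :
    pairHom s X Y (FreeLieAlgebra.of K (flipLetter !s)) = Y := by
  have : flipLetter (!s) ≠ flipLetter s := by cases s <;> decide
  simp [pairHom, this]

theorem pairHom_engelElt (s : Bool) (X Y : A) (k : ℕ) :
    ∃ f : FreeLieAlgebra K (Fin 2), pairHom s X Y f = engelElt X Y k :=
  ⟨engelElt (FreeLieAlgebra.of K (flipLetter s)) (FreeLieAlgebra.of K (flipLetter !s)) k, by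
    rw [map_engelElt, pairHom_left, pairHom_right]⟩

theorem linearIndependent_of_encard {s : Bool} {N : Set Word} {d : ℕ} (hN : N.encard = d)
    (hd : Module.finrank K A = d) (f : Word → A)
    (hspan : Submodule.span K (Set.range fun u : (flipWord s '' N : Set Word) => f u) = ⊤) :
    LinearIndependent K fun u : (flipWord s '' N : Set Word) => f u := by
  have hcard : (flipWord s '' N).encard = d := by rw [(flipWord_injective s).encard_image, hN]
  have hfin : (flipWord s '' N).Finite := Set.finite_of_encard_eq_coe hcard
  have : Fintype (flipWord s '' N : Set Word) := hfin.fintype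
  refine linearIndependent_of_top_le_span_of_card_eq_finrank hspan.ge ?_
  rw [hd, ← Nat.card_eq_fintype_card, Nat.card_coe_set_eq, Set.ncard, hcard, ENat.toNat_natCast]

/-- `[W]` is a Gröbner–Shirshov basis, `[N]` induces a basis of `g`, and `g` is isomorphic
to `A`. -/
def IsPresentation (K : Type*) [Field K] (N W : Set Word) (A : Type*) [LieRing A]
    [LieAlgebra K A] : Prop :=
  IsGroebnerShirshov K W ∧ IsBracketBasis K N W ∧ Nonempty (MonomialLie K W ≃ₗ⁅K⁆ A)

/-- The filiform relations are used twice: `h` in the model, for the Gröbner–Shirshov property and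
spanning, and `h'` in the quotient, where they show that [N] spans. -/
theorem FiliformRel.isPresentation {s : Bool} {N W : Set Word} {X Y t : A} {c : ℕ}
    (h : FiliformRel K X Y t c) (hNW : IsFlipPair s N W) (hy : [1] ∈ N)
    (hE : ∀ k, xyPow k ∉ N → engelElt X Y k = 0)
    (ht : t ≠ 0 → xyPow c ++ xyPow (c + 1) ∈ N ∧
      ∀ w ∈ W, w.count 0 = 2 → w.length ≠ 2 * c + 3)
    (hφ : Function.Surjective (pairHom (K := K) s X Y))
    (hind : LinearIndependent K fun u : (flipWord s '' N : Set Word) =>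
      pairHom (K := K) s X Y (stdBracket K (u : Word)))
    {X' Y' t' : MonomialLie K (flipWord s '' W)} {c' : ℕ}
    (hX' : monomialMk (flipWord s '' W) (FreeLieAlgebra.of K (flipLetter s)) = X')
    (hY' : monomialMk (flipWord s '' W) (FreeLieAlgebra.of K (flipLetter !s)) = Y')
    (h' : FiliformRel K X' Y' t' c') (hE' : ∀ k, xyPow k ∉ N → engelElt X' Y' k = 0)
    (ht' : t' ≠ 0 → xyPow c' ++ xyPow (c' + 1) ∈ N) :
    IsPresentation K (flipWord s '' N) (flipWord s '' W) A := by
  have hX := pairHom_left (K := K) s X Y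
  have hY := pairHom_right (K := K) s X Y
  obtain ⟨hW, hGS⟩ := h.isGroebnerShirshov hX hY hNW hy hE ht hind
  exact ⟨hGS, isBracketBasis_and_equiv _ hW hind
    (h.span_range_eq_top hX hY hφ hy hE fun ht0 => (ht ht0).1)
    (h'.span_range_eq_top hX' hY' (monomialMk_surjective _) hy hE' ht')⟩

theorem hasNilpotencyClass_congr {B : Type*} [LieRing B] [LieAlgebra K B] (e : A ≃ₗ⁅K⁆ B) {m : ℕ}
    (h : HasNilpotencyClass K B m) : HasNilpotencyClass K A m := by
  have key : ∀ k, LieModule.lowerCentralSeries K A A k = ⊥ ↔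
      LieModule.lowerCentralSeries K B B k = ⊥ := by
    intro k
    have h1 := LieIdeal.lowerCentralSeries_map_eq (R := K) k (f := e.toLieHom) e.surjective
    have h2 := LieIdeal.lowerCentralSeries_map_eq (R := K) k (f := e.symm.toLieHom)
      e.symm.surjective
    constructor
    · intro h
      rw [← h1, h, LieIdeal.map_eq_bot_iff]
      exact bot_le
    · intro h
      rw [← h2, h, LieIdeal.map_eq_bot_iff]
      exact bot_le
  unfold HasNilpotencyClass at h ⊢
  simpa only [key] using h

end General

/-! ### Lie algebras given by a table -/

/-- The identification of the underlying vector space. -/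
noncomputable def LieTable.toAlg {ι : Type*} (T : LieTable K ι) : (ι →₀ K) ≃ₗ[K] T.Alg :=
  LinearEquiv.refl K (ι →₀ K)

theorem LieTable.toAlg_lie {ι : Type*} (T : LieTable K ι) (v w : ι →₀ K) :
    ⁅T.toAlg v, T.toAlg w⁆ = T.toAlg (tableMul T.t v w) := rfl

theorem LieTable.submodule_eq_top {ι : Type*} (T : LieTable K ι) {S : Submodule K T.Alg}
    (h : ∀ i, T.toAlg (Finsupp.single i 1) ∈ S) : S = ⊤ := by
  rw [eq_top_iff, ← ((Finsupp.basisSingleOne (R := K) (ι := ι)).map T.toAlg).span_eq,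
    Submodule.span_le]
  rintro _ ⟨i, rfl⟩
  rw [Module.Basis.map_apply, Finsupp.coe_basisSingleOne]
  exact h i

theorem finrank_alg {n : ℕ} (T : LieTable K (Fin (n + 1))) : Module.finrank K T.Alg = n + 1 := by
  rw [← T.toAlg.finrank_eq]
  simp

theorem tableMul_apply_eq_zero {ι : Type*} {t : ι → ι → ι →₀ K} {l : ι} {v w : ι →₀ K}
    (h : ∀ i j, w j ≠ 0 → t i j l = 0) : tableMul t v w l = 0 := by
  rw [tableMul, Finsupp.linearCombination_apply, Finsupp.sum, LinearMap.sum_apply,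
    Finsupp.finsetSum_apply]
  refine Finset.sum_eq_zero fun i _ => ?_
  rw [LinearMap.smul_apply, Finsupp.smul_apply, Finsupp.linearCombination_apply, Finsupp.sum,
    Finsupp.finsetSum_apply, Finset.sum_eq_zero, smul_zero]
  intro j hj
  rw [Finsupp.smul_apply, h i j (Finsupp.mem_support_iff.mp hj), smul_zero]

/-- Step k + 1 of the series has zero coordinates at 0, …, k + 1, because bracketing raises the
index; conversely X_(k+1) survives in step k, as an iterated bracket with X_0. -/
theorem hasNilpotencyClass_of_table {n : ℕ} (hn : 1 ≤ n) (T : LieTable K (Fin (n + 1)))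
    (h1 : ∀ i j l : Fin (n + 1), l.val ≤ 1 → T.t i j l = 0)
    (h2 : ∀ i j l : Fin (n + 1), 1 ≤ j.val → l.val ≤ j.val → T.t i j l = 0)
    (h3 : ∀ j, 1 ≤ j → j < n → tableMul T.t (basisVec K n 0) (basisVec K n j) =
      basisVec K n (j + 1)) : HasNilpotencyClass K T.Alg n := by
  have hspan : ∀ k (U : Submodule K T.Alg),
      (∀ v w, T.toAlg w ∈ LieModule.lowerCentralSeries K T.Alg T.Alg k →
        T.toAlg (tableMul T.t v w) ∈ U) →
      (LieModule.lowerCentralSeries K T.Alg T.Alg (k + 1)).toSubmodule ≤ U := by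
    intro k U hU
    rw [LieModule.lowerCentralSeries_succ, LieSubmodule.lieIdeal_oper_eq_linear_span',
      Submodule.span_le]
    rintro _ ⟨v, _, w, hw, rfl⟩
    obtain ⟨v, rfl⟩ := T.toAlg.surjective v
    obtain ⟨w, rfl⟩ := T.toAlg.surjective w
    rw [LieTable.toAlg_lie]
    exact hU v w hw
  have hle : ∀ k z, T.toAlg z ∈ LieModule.lowerCentralSeries K T.Alg T.Alg (k + 1) →
      ∀ l : Fin (n + 1), l.val ≤ k + 1 → z l = 0 := by
    intro k
    induction k with
    | zero =>
      intro z hz l hl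
      have h := hspan 0 ((LinearMap.ker (Finsupp.lapply (R := K) l)).map T.toAlg.toLinearMap)
        fun v w _ => ⟨_, tableMul_apply_eq_zero fun i j _ => h1 i j l hl, rfl⟩
      obtain ⟨z', hz', hzz⟩ := h hz
      rw [← T.toAlg.injective hzz]
      exact hz'
    | succ k ih =>
      intro z hz l hl
      have h := hspan (k + 1)
        ((LinearMap.ker (Finsupp.lapply (R := K) l)).map T.toAlg.toLinearMap)
        fun v w hw => ⟨_, tableMul_apply_eq_zero fun i j hj => by
          have hkj : ¬ j.val ≤ k + 1 := fun hjk => hj (ih w hw j hjk)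
          exact h2 i j l (by omega) (by omega), rfl⟩
      obtain ⟨z', hz', hzz⟩ := h hz
      rw [← T.toAlg.injective hzz]
      exact hz'
  have hmem : ∀ k, k < n →
      T.toAlg (basisVec K n (k + 1)) ∈ LieModule.lowerCentralSeries K T.Alg T.Alg k := by
    intro k
    induction k with
    | zero => intro _; exact LieSubmodule.mem_top _
    | succ k ih =>
      intro hk
      rw [LieModule.lowerCentralSeries_succ, ← h3 (k + 1) (by omega) hk, ← LieTable.toAlg_lie]
      exact LieSubmodule.lie_mem_lie (LieSubmodule.mem_top _) (ih (by omega))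
  constructor
  · rw [Set.mem_ofPred_eq, LieSubmodule.eq_bot_iff]
    intro z hz
    obtain ⟨z, rfl⟩ := T.toAlg.surjective z
    obtain ⟨k, rfl⟩ : ∃ k, n = k + 1 := ⟨n - 1, by omega⟩
    have : z = 0 := Finsupp.ext fun l => hle k z hz l (by omega)
    rw [this, map_zero]
  · intro k hk
    by_contra hcon
    have h := hmem (n - 1) (by omega)
    have hanti := LieModule.antitone_lowerCentralSeries K T.Alg T.Alg (show k ≤ n - 1 by omega)
    rw [Set.mem_ofPred_eq] at hk
    have h0 := hanti h
    rw [hk, LieSubmodule.mem_bot, Nat.sub_add_cancel hn] at h0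
    have h2 := basisVec_val K (Fin.last n)
    rw [Fin.val_last, T.toAlg.map_eq_zero_iff.mp h0] at h2
    exact one_ne_zero (Finsupp.single_eq_zero.mp h2.symm)

theorem engelElt_succ {A : Type*} [LieRing A] (X Y : A) (k : ℕ) :
    engelElt X Y (k + 1) = ⁅engelElt X Y k, Y⁆ := rfl

theorem basisVec_apply_of_lt {n k : ℕ} {l : Fin (n + 1)} (hl : l.val < k) :
    basisVec K n k l = 0 := by
  unfold basisVec
  split_ifs with h
  · refine Finsupp.single_eq_of_ne fun h' => ?_
    rw [h'] at hl
    exact lt_irrefl _ hl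
  · rfl

theorem basisVec_mem {n : ℕ} {T : LieTable K (Fin (n + 1))} {S : Submodule K T.Alg}
    (h : ∀ k ≤ n, T.toAlg (basisVec K n k) ∈ S) : S = ⊤ := by
  refine T.submodule_eq_top fun i => ?_
  rw [← basisVec_val]
  exact h i (by omega)

/-! ### The algebra `M_0` -/

/-- The generator Y is −e_1: brackets with Y are taken on the right, while the table has e_1 on the
left. -/
theorem engelElt_M0 (k : ℕ) :
    engelElt ((filiformM0 K).toAlg (Finsupp.single 1 1))
      ((filiformM0 K).toAlg (-Finsupp.single 0 1)) k =
      (filiformM0 K).toAlg (Finsupp.single (k + 1) 1) := by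
  induction k with
  | zero => rfl
  | succ k ih =>
    have ht : (filiformM0 K).t = filiformM0Table K := rfl
    rw [engelElt_succ, ih, LieTable.toAlg_lie, map_neg, ht, tableMul_single]
    simp [filiformM0Table]

theorem filiformRel_M0 : FiliformRel K ((filiformM0 K).toAlg (Finsupp.single 1 1))
    ((filiformM0 K).toAlg (-Finsupp.single 0 1)) 0 0 := by
  refine FiliformRel.of_abelian (fun i j => ?_) 0
  have ht : (filiformM0 K).t = filiformM0Table K := rfl
  rw [engelElt_M0, engelElt_M0, LieTable.toAlg_lie, ht, tableMul_single]
  simp [filiformM0Table]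

/-! ### The algebras `L_n` -/

theorem engelElt_L (n k : ℕ) :
    engelElt ((filiformL K n).toAlg (basisVec K n 1)) ((filiformL K n).toAlg (-basisVec K n 0)) k =
      (filiformL K n).toAlg (basisVec K n (k + 1)) := by
  induction k with
  | zero => rfl
  | succ k ih =>
    have ht : (filiformL K n).t = filiformLTable K n := rfl
    rw [engelElt_succ, ih, LieTable.toAlg_lie, map_neg, ht, filiformLTable_mul]
    simp

theorem filiformRel_L (n : ℕ) : FiliformRel K ((filiformL K n).toAlg (basisVec K n 1))
    ((filiformL K n).toAlg (-basisVec K n 0)) 0 0 := by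
  refine FiliformRel.of_abelian (fun i j => ?_) 0
  have ht : (filiformL K n).t = filiformLTable K n := rfl
  rw [engelElt_L, engelElt_L, LieTable.toAlg_lie, ht, filiformLTable_mul]
  simp

theorem hasNilpotencyClass_L {n : ℕ} (hn : 1 ≤ n) : HasNilpotencyClass K (filiformL K n).Alg n := by
  refine hasNilpotencyClass_of_table hn _ (fun i j l hl => ?_) (fun i j l hj hl => ?_)
    fun j h1 h2 => ?_
  · change filiformLTable K n i j l = 0
    unfold filiformLTable
    split_ifs
    · exact basisVec_apply_of_lt (by omega)
    · rw [Finsupp.neg_apply, basisVec_apply_of_lt (by omega), neg_zero]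
    · rfl
  · change filiformLTable K n i j l = 0
    unfold filiformLTable
    split_ifs
    · exact basisVec_apply_of_lt (by omega)
    · omega
    · rfl
  · change tableMul (filiformLTable K n) _ _ = _
    rw [filiformLTable_mul, if_pos rfl, if_neg (by omega)]

/-! ### The algebras `Q_n` -/

theorem hasNilpotencyClass_Q {n : ℕ} (hn : 2 ≤ n) (hodd : Odd n) :
    HasNilpotencyClass K (filiformQ K n hodd).Alg n := by
  refine hasNilpotencyClass_of_table (by omega) _ (fun i j l hl => ?_) (fun i j l hj hl => ?_)
    fun j h1 h2 => ?_
  · change filiformQTable K n i j l = 0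
    unfold filiformQTable
    split_ifs
    · exact basisVec_apply_of_lt (by omega)
    · rw [Finsupp.neg_apply, basisVec_apply_of_lt (by omega), neg_zero]
    · rw [Finsupp.smul_apply, basisVec_apply_of_lt (by omega), smul_zero]
    · rfl
  · change filiformQTable K n i j l = 0
    unfold filiformQTable
    split_ifs
    · exact basisVec_apply_of_lt (by omega)
    · omega
    · rw [Finsupp.smul_apply, basisVec_apply_of_lt (by omega), smul_zero]
    · rfl
  · change tableMul (filiformQTable K n) _ _ = _
    rw [filiformQTable_mul, if_pos rfl, if_neg (by omega)]

section FiliformQ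

variable (K) (c : ℕ) (hodd : Odd (2 * c + 3))

/-- The summand −X_1 of Y has no effect in this range, since [X_(k+1), X_1] is nonzero only if k =
2c + 1, one step beyond the induction. -/
theorem engelElt_Q_of_le {k : ℕ} (hk : k ≤ 2 * c + 1) :
    engelElt ((filiformQ K (2 * c + 3) hodd).toAlg (basisVec K (2 * c + 3) 1))
      ((filiformQ K (2 * c + 3) hodd).toAlg (-basisVec K (2 * c + 3) 0 - basisVec K (2 * c + 3) 1))
      k = (filiformQ K (2 * c + 3) hodd).toAlg (basisVec K (2 * c + 3) (k + 1)) := by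
  induction k with
  | zero => rfl
  | succ k ih =>
    have ht : (filiformQ K (2 * c + 3) hodd).t = filiformQTable K (2 * c + 3) := rfl
    rw [engelElt_succ, ih (by omega), LieTable.toAlg_lie, map_sub, map_neg, ht, filiformQTable_mul,
      filiformQTable_mul]
    have : k ≠ 2 * c + 1 := by omega
    simp [this]

/-- This is the purpose of the summand −X_1: the contribution X_n of −X_0 is cancelled by −[X_(n−1),
X_1] = −X_n, with n = 2c + 3. With Y = −X_0 alone the obstruction xy^(2c+2) would not be respected.
-/
theorem engelElt_Q_eq_zero {k : ℕ} (hk : 2 * c + 2 ≤ k) :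
    engelElt ((filiformQ K (2 * c + 3) hodd).toAlg (basisVec K (2 * c + 3) 1))
      ((filiformQ K (2 * c + 3) hodd).toAlg (-basisVec K (2 * c + 3) 0 - basisVec K (2 * c + 3) 1))
      k = 0 := by
  refine engelElt_eq_zero_of_le ?_ hk
  have ht : (filiformQ K (2 * c + 3) hodd).t = filiformQTable K (2 * c + 3) := rfl
  have hpow : (-1 : K) ^ (2 * c + 1 + 1) = 1 := Even.neg_one_pow ⟨c + 1, by omega⟩
  rw [engelElt_succ, engelElt_Q_of_le K c hodd le_rfl, LieTable.toAlg_lie, map_sub, map_neg, ht,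
    filiformQTable_mul, filiformQTable_mul]
  simp [hpow]

/-- Here t is the central element X_n, and E_i = X_(i+1) turns the condition that indices add up to
n = 2c + 3 into i + j = 2c + 1. -/
theorem filiformRel_Q : FiliformRel K
    ((filiformQ K (2 * c + 3) hodd).toAlg (basisVec K (2 * c + 3) 1))
    ((filiformQ K (2 * c + 3) hodd).toAlg (-basisVec K (2 * c + 3) 0 - basisVec K (2 * c + 3) 1))
    ((filiformQ K (2 * c + 3) hodd).toAlg (basisVec K (2 * c + 3) (2 * c + 3))) c := by
  have ht : (filiformQ K (2 * c + 3) hodd).t = filiformQTable K (2 * c + 3) := rfl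
  have hz : basisVec K (2 * c + 3) (2 * c + 3 + 1) = 0 := basisVec_of_lt K (Nat.lt_succ_self _)
  have hval : ∀ i j, i ≤ 2 * c + 1 → j ≤ 2 * c + 1 →
      ⁅engelElt ((filiformQ K (2 * c + 3) hodd).toAlg (basisVec K (2 * c + 3) 1))
        ((filiformQ K (2 * c + 3) hodd).toAlg
          (-basisVec K (2 * c + 3) 0 - basisVec K (2 * c + 3) 1)) i,
        engelElt ((filiformQ K (2 * c + 3) hodd).toAlg (basisVec K (2 * c + 3) 1))
        ((filiformQ K (2 * c + 3) hodd).toAlg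
          (-basisVec K (2 * c + 3) 0 - basisVec K (2 * c + 3) 1)) j⁆ =
      (filiformQ K (2 * c + 3) hodd).toAlg (if i + j = 2 * c + 1 then
        (-1 : K) ^ (i + 1) • basisVec K (2 * c + 3) (2 * c + 3) else 0) := by
    intro i j hi hj
    rw [engelElt_Q_of_le K c hodd hi, engelElt_Q_of_le K c hodd hj, LieTable.toAlg_lie, ht,
      filiformQTable_mul, if_neg (by omega), if_neg (by omega)]
    congr 1
    exact if_congr (by omega) rfl rfl
  refine ⟨?_, fun k => ?_, fun i j hij => ?_, fun i j hij => ?_, ?_⟩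
  · rw [LieTable.toAlg_lie, map_sub, map_neg, ht, filiformQTable_mul, filiformQTable_mul]
    simp [hz]
  · rcases le_or_gt k (2 * c + 1) with hk | hk
    · rw [engelElt_Q_of_le K c hodd hk, LieTable.toAlg_lie, ht, filiformQTable_mul]
      simp
    · rw [engelElt_Q_eq_zero K c hodd hk, zero_lie]
  · rcases le_or_gt i (2 * c + 1) with hi | hi
    · rcases le_or_gt j (2 * c + 1) with hj | hj
      · rw [hval i j hi hj, if_neg hij, map_zero]
      · rw [engelElt_Q_eq_zero K c hodd hj, lie_zero]
    · rw [engelElt_Q_eq_zero K c hodd hi, zero_lie]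
  · rw [hval i j (by omega) (by omega), if_pos hij, map_smul]
    exact Submodule.smul_mem _ _ (Submodule.mem_span_singleton_self _)
  · rw [hval c (c + 1) (by omega) (by omega), if_pos (by omega), map_smul,
      Submodule.span_singleton_smul_eq (IsUnit.pow _ (by simp))]
    exact Submodule.mem_span_singleton_self _

end FiliformQ

end Models

/-! ### The three presentations -/

theorem encard_xyPow_Iio (n : ℕ) : (xyPow '' Set.Iio n).encard = n := by
  rw [xyPow_injective.encard_image, ← Finset.coe_Iio, Set.encard_coe_eq_coe_finsetCard,
    Nat.card_Iio]

theorem atomsL_eq (d : ℕ) : atomsL d = insert [1] (xyPow '' Set.Iio (d - 1)) := by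
  ext u
  constructor
  · rintro (⟨k, hk, rfl⟩ | rfl)
    · exact Or.inr ⟨k, by rw [Set.mem_Iio]; omega, rfl⟩
    · exact Or.inl rfl
  · rintro (rfl | ⟨k, hk, rfl⟩)
    · exact Or.inr rfl
    · rw [Set.mem_Iio] at hk
      exact Or.inl ⟨k, by omega, rfl⟩

theorem atomsQ_eq (m : ℕ) : atomsQ m =
    insert [1] (insert (xyPow (m - 2) ++ xyPow (m - 1)) (xyPow '' Set.Iio (2 * m - 2))) := by
  ext u
  constructor
  · rintro ((⟨k, hk, rfl⟩ | rfl) | rfl)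
    · exact Or.inr (Or.inr ⟨k, by rw [Set.mem_Iio]; omega, rfl⟩)
    · exact Or.inr (Or.inl rfl)
    · exact Or.inl rfl
  · rintro (rfl | rfl | ⟨k, hk, rfl⟩)
    · exact Or.inr rfl
    · exact Or.inl (Or.inr rfl)
    · rw [Set.mem_Iio] at hk
      exact Or.inl (Or.inl ⟨k, by omega, rfl⟩)

theorem letter_ne_xyPow (k : ℕ) : ([1] : Word) ≠ xyPow k := by
  intro h
  have := congrArg (List.count 0) h
  rw [count_xyPow] at this
  simp at this

theorem letter_ne_two_xyPow (i j : ℕ) : ([1] : Word) ≠ xyPow i ++ xyPow j := by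
  intro h
  have := congrArg (List.count 0) h
  rw [List.count_append, count_xyPow, count_xyPow] at this
  simp at this

theorem encard_atomsL {d : ℕ} (hd : 1 ≤ d) : (atomsL d).encard = d := by
  rw [atomsL_eq, Set.encard_insert_of_notMem, encard_xyPow_Iio]
  · norm_cast
    omega
  · rintro ⟨k, _, h⟩
    exact letter_ne_xyPow k h.symm

theorem encard_atomsQ {m : ℕ} (hm : 1 ≤ m) : (atomsQ m).encard = (2 * m : ℕ) := by
  rw [atomsQ_eq, Set.encard_insert_of_notMem, Set.encard_insert_of_notMem, encard_xyPow_Iio]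
  · norm_cast
    omega
  · rintro ⟨k, _, h⟩
    exact two_xyPow_ne _ _ _ h.symm
  · rintro (h | ⟨k, _, h⟩)
    · exact letter_ne_two_xyPow _ _ h
    · exact letter_ne_xyPow k h.symm

theorem infinite_atomsM0 : atomsM0.Infinite := by
  refine (Set.infinite_range_of_injective xyPow_injective).mono ?_
  rintro _ ⟨k, rfl⟩
  exact Or.inl ⟨k, rfl⟩

section Presentations

variable {K : Type*} [Field K]

theorem surjective_of_forall_exists {A : Type*} [LieRing A] [LieAlgebra K A] {s : Bool} {X Y : A}
    (h : ∀ S : Submodule K A, Y ∈ S → (∀ k, engelElt X Y k ∈ S) →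
      (∀ i j, ⁅engelElt X Y i, engelElt X Y j⁆ ∈ S) → S = ⊤) :
    Function.Surjective (pairHom (K := K) s X Y) := by
  refine LinearMap.range_eq_top.mp (h (LinearMap.range
    (pairHom (K := K) s X Y : FreeLieAlgebra K (Fin 2) →ₗ[K] A)) ?_ (fun k => ?_) fun i j => ?_)
  · exact ⟨_, pairHom_right s X Y⟩
  · exact pairHom_engelElt s X Y k
  · obtain ⟨f, hf⟩ := pairHom_engelElt (K := K) s X Y i
    obtain ⟨g, hg⟩ := pairHom_engelElt (K := K) s X Y j
    refine ⟨⁅f, g⁆, ?_⟩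
    rw [LieHom.coe_toLinearMap, LieHom.map_lie, hf, hg]

theorem linearIndependent_M0 (s : Bool) :
    LinearIndependent K fun u : (flipWord s '' atomsM0 : Set Word) =>
      pairHom (K := K) s ((filiformM0 K).toAlg (Finsupp.single 1 1))
        ((filiformM0 K).toAlg (-Finsupp.single 0 1)) (stdBracket K (u : Word)) := by
  have hX := pairHom_left (K := K) s ((filiformM0 K).toAlg (Finsupp.single 1 1))
    ((filiformM0 K).toAlg (-Finsupp.single 0 1))
  have hY := pairHom_right (K := K) s ((filiformM0 K).toAlg (Finsupp.single 1 1))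
    ((filiformM0 K).toAlg (-Finsupp.single 0 1))
  -- The product of the number of letters x and the length is the index of the basis vector: 0 for
  -- y, which maps to −e_1, and k + 1 for xy^k.
  have key : ∀ u : (flipWord s '' atomsM0 : Set Word), ∃ a : Kˣ,
      pairHom (K := K) s ((filiformM0 K).toAlg (Finsupp.single 1 1))
        ((filiformM0 K).toAlg (-Finsupp.single 0 1)) (stdBracket K (u : Word)) =
      a • (filiformM0 K).toAlg
        (Finsupp.single ((flipWord s (u : Word)).count 0 * (u : Word).length) 1) := by
    rintro ⟨_, u, ⟨k, rfl⟩ | rfl, rfl⟩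
    · obtain ⟨a, ha, h⟩ := map_stdBracket_xyPow hX hY k
      refine ⟨Units.mk0 a ha, ?_⟩
      simp only [h, engelElt_M0, flipWord_flipWord, count_xyPow, length_flipWord, length_xyPow,
        one_mul]
      rfl
    · refine ⟨-1, ?_⟩
      simp only [map_stdBracket_letter hY, flipWord_flipWord]
      simp
  choose a ha using key
  have hidx : Function.Injective fun u : (flipWord s '' atomsM0 : Set Word) =>
      (flipWord s (u : Word)).count 0 * (u : Word).length := by
    rintro ⟨_, u, hu, rfl⟩ ⟨_, v, hv, rfl⟩ h
    simp only [flipWord_flipWord, length_flipWord] at h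
    apply Subtype.ext
    refine congrArg (flipWord s) ?_
    rcases hu with ⟨k, rfl⟩ | rfl <;> rcases hv with ⟨l, rfl⟩ | rfl
    · simp only [count_xyPow, length_xyPow, one_mul, Nat.add_right_cancel_iff] at h
      rw [h]
    · simp [count_xyPow, length_xyPow] at h
    · simp [count_xyPow, length_xyPow] at h
    · rfl
  have hbasis := ((Finsupp.basisSingleOne (R := K) (ι := ℕ)).map
    (filiformM0 K).toAlg).linearIndependent.comp _ hidx
  convert hbasis.units_smul a using 2 with u
  rw [ha u]
  simp

theorem isPresentation_M0 (s : Bool) :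
    IsPresentation K (flipWord s '' atomsM0) (flipWord s '' obstructionsM0)
      (filiformM0 K).Alg := by
  have hN : ∀ k, xyPow k ∈ atomsM0 := fun k => Or.inl ⟨k, rfl⟩
  obtain ⟨X, hX⟩ : ∃ X, monomialMk (K := K) (flipWord s '' obstructionsM0)
    (FreeLieAlgebra.of K (flipLetter s)) = X := ⟨_, rfl⟩
  obtain ⟨Y, hY⟩ : ∃ Y, monomialMk (K := K) (flipWord s '' obstructionsM0)
    (FreeLieAlgebra.of K (flipLetter !s)) = Y := ⟨_, rfl⟩
  refine filiformRel_M0.isPresentation (isFlipPair_M0 s) (Or.inr rfl)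
    (fun k hk => absurd (hN k) hk) (fun h => absurd rfl h) ?_ (linearIndependent_M0 s) hX hY
    (FiliformRel.of_abelian (fun i j => ?_) 0) (fun k hk => absurd (hN k) hk)
    (fun h => absurd rfl h)
  · refine surjective_of_forall_exists fun S hSY hSE _ => ?_
    refine (filiformM0 K).submodule_eq_top fun i => ?_
    rcases i with _ | i
    · rw [map_neg] at hSY
      exact (Submodule.neg_mem_iff _).mp hSY
    · rw [← engelElt_M0]
      exact hSE i
  · exact lie_engelElt_eq_zero_of_le (n := i + j)
      (fun c _ => lie_engelElt_eq_zero_of_mem hX hY ⟨c, rfl⟩) i j le_rfl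

theorem isPresentation_L (s : Bool) {d : ℕ} (hd : 2 ≤ d) :
    IsPresentation K (flipWord s '' atomsL d) (flipWord s '' obstructionsL d)
      (filiformL K (d - 1)).Alg := by
  obtain ⟨X, hX⟩ : ∃ X, monomialMk (K := K) (flipWord s '' obstructionsL d)
    (FreeLieAlgebra.of K (flipLetter s)) = X := ⟨_, rfl⟩
  obtain ⟨Y, hY⟩ : ∃ Y, monomialMk (K := K) (flipWord s '' obstructionsL d)
    (FreeLieAlgebra.of K (flipLetter !s)) = Y := ⟨_, rfl⟩
  have hle : ∀ k, xyPow k ∉ atomsL d → d - 1 ≤ k := by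
    intro k hk
    by_contra hcon
    exact hk (Or.inl ⟨k, by omega, rfl⟩)
  have hE : ∀ k, xyPow k ∉ atomsL d → engelElt ((filiformL K (d - 1)).toAlg (basisVec K (d - 1) 1))
      ((filiformL K (d - 1)).toAlg (-basisVec K (d - 1) 0)) k = 0 := by
    intro k hk
    have := hle k hk
    rw [engelElt_L, basisVec_of_lt K (by omega), map_zero]
  have hE' : ∀ k, d - 1 ≤ k → engelElt X Y k = 0 := fun k hk =>
    engelElt_eq_zero_of_le (engelElt_eq_zero_of_mem hX hY (Or.inr rfl)) hk
  have hφ : Function.Surjective (pairHom (K := K) s ((filiformL K (d - 1)).toAlg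
      (basisVec K (d - 1) 1)) ((filiformL K (d - 1)).toAlg (-basisVec K (d - 1) 0))) := by
    refine surjective_of_forall_exists fun S hSY hSE _ => basisVec_mem fun k _ => ?_
    rcases k with _ | k
    · rw [map_neg] at hSY
      exact (Submodule.neg_mem_iff _).mp hSY
    · rw [← engelElt_L]
      exact hSE k
  refine (filiformRel_L (d - 1)).isPresentation (isFlipPair_L s hd) (Or.inr rfl) hE
    (fun h => absurd rfl h) hφ ?_ hX hY (FiliformRel.of_abelian (fun i j => ?_) 0)
    (fun k hk => hE' k (hle k hk)) (fun h => absurd rfl h)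
  · refine linearIndependent_of_encard (encard_atomsL (by omega)) ?_
      (fun u => pairHom s _ _ (stdBracket K u)) ?_
    · rw [finrank_alg]
      omega
    · exact (filiformRel_L (d - 1)).span_range_eq_top (pairHom_left s _ _) (pairHom_right s _ _) hφ
        (Or.inr rfl) hE fun h => absurd rfl h
  · refine lie_engelElt_eq_zero_of_le (n := i + j) (fun c _ => ?_) i j le_rfl
    -- The bracket is an obstruction for small c; otherwise E_(c+1) is already zero because of
    -- xy^(d−1).
    by_cases hc : c + 3 ≤ d
    · exact lie_engelElt_eq_zero_of_mem hX hY (Or.inl ⟨c, hc, rfl⟩)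
    · rw [hE' (c + 1) (by omega), lie_zero]

/-- With c = m − 2, the omitted obstruction xy^c xy^(c+1) is the one place where a bracket of degree
two survives. The relations in the quotient need only xy^(2c+2) and the words xy^k xy^(k+1) with k <
c. -/
theorem isPresentation_Q [CharZero K] (s : Bool) {m : ℕ} (hm : 3 ≤ m) (hodd : Odd (2 * m - 1)) :
    IsPresentation K (flipWord s '' atomsQ m) (flipWord s '' obstructionsQ m)
      (filiformQ K (2 * m - 1) hodd).Alg := by
  obtain ⟨c, rfl⟩ : ∃ c, m = c + 2 := ⟨m - 2, by omega⟩
  obtain ⟨X, hX⟩ : ∃ X, monomialMk (K := K) (flipWord s '' obstructionsQ (c + 2))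
    (FreeLieAlgebra.of K (flipLetter s)) = X := ⟨_, rfl⟩
  obtain ⟨Y, hY⟩ : ∃ Y, monomialMk (K := K) (flipWord s '' obstructionsQ (c + 2))
    (FreeLieAlgebra.of K (flipLetter !s)) = Y := ⟨_, rfl⟩
  have hn : 2 * (c + 2) - 1 = 2 * c + 3 := by omega
  revert hodd
  rw [hn]
  intro hodd
  have hle : ∀ k, xyPow k ∉ atomsQ (c + 2) → 2 * c + 2 ≤ k := by
    intro k hk
    by_contra hcon
    exact hk (Or.inl (Or.inl ⟨k, by omega, rfl⟩))
  have hE := fun k hk => engelElt_Q_eq_zero K c hodd (hle k hk)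
  have hE' : engelElt X Y (2 * c + 2) = 0 :=
    engelElt_eq_zero_of_mem hX hY (Or.inl (Or.inl rfl))
  have hw : xyPow c ++ xyPow (c + 1) ∈ atomsQ (c + 2) := Or.inl (Or.inr rfl)
  have hW : ∀ w ∈ obstructionsQ (c + 2), w.count 0 = 2 → w.length ≠ 2 * c + 3 := by
    rintro _ ((rfl | rfl | rfl | rfl) | ⟨k, _, hk, rfl⟩) hcount <;>
      simp only [List.count_append, List.length_append, count_xyPow, length_xyPow] at hcount ⊢ <;>
      omega
  have hφ := surjective_of_forall_exists (K := K) (s := s) (A := (filiformQ K (2 * c + 3) hodd).Alg)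
    (X := (filiformQ K (2 * c + 3) hodd).toAlg (basisVec K (2 * c + 3) 1))
    (Y := (filiformQ K (2 * c + 3) hodd).toAlg
      (-basisVec K (2 * c + 3) 0 - basisVec K (2 * c + 3) 1)) fun S hSY hSE hSb => by
    have h1 := hSE 0
    rw [map_sub, map_neg] at hSY
    refine basisVec_mem fun k hk => ?_
    rcases k with _ | k
    · exact (Submodule.neg_mem_iff _).mp ((Submodule.sub_mem_iff_left _ h1).mp hSY)
    rcases Nat.lt_or_ge k (2 * c + 2) with hk' | hk'
    · rw [← engelElt_Q_of_le K c hodd (by omega)]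
      exact hSE k
    -- The top vector X_n is not one of the E_k; it is obtained from [E_c, E_(c+1)].
    · obtain rfl : k = 2 * c + 2 := by omega
      refine Submodule.span_le.mpr ?_ (filiformRel_Q K c hodd).mem_span_lie
      rintro _ rfl
      exact hSb c (c + 1)
  refine (filiformRel_Q K c hodd).isPresentation (isFlipPair_Q s hm) (Or.inr rfl) hE
    (fun _ => ⟨hw, hW⟩) hφ ?_ hX hY (FiliformRel.of_obstructions (by omega) (fun k hk => ?_) hE')
    (fun k hk => engelElt_eq_zero_of_le hE' (hle k hk)) (fun _ => hw)
  · refine linearIndependent_of_encard (encard_atomsQ (by omega)) ?_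
      (fun u => pairHom s _ _ (stdBracket K u)) ?_
    · rw [finrank_alg]
      omega
    · exact (filiformRel_Q K c hodd).span_range_eq_top (pairHom_left s _ _) (pairHom_right s _ _) hφ
        (Or.inr rfl) hE fun _ => hw
  · exact lie_engelElt_eq_zero_of_mem hX hY (Or.inr ⟨k, by omega, by omega, rfl⟩)

/-- Each of the three kinds of `N` determines `W`, is compatible with mirror images, and has a
presentation that is the same for `N` and its mirror image. -/
theorem exists_isPresentation.{u} {K : Type u} [Field K] [CharZero K] {s : Bool}
    {N W : Set Word} (hNW : IsFlipPair s N W)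
    (h : N = atomsM0 ∨ (∃ d, 4 ≤ d ∧ N = atomsL d) ∨ ∃ m, 3 ≤ m ∧ N = atomsQ m) :
    (∀ s', IsFlipPair s' N W) ∧ ∃ (A : Type u) (_ : LieRing A) (_ : LieAlgebra K A),
      ∀ s', IsPresentation K (flipWord s' '' N) (flipWord s' '' W) A := by
  rcases h with rfl | ⟨d, hd, rfl⟩ | ⟨m, hm, rfl⟩
  · rw [hNW.unique (isFlipPair_M0 s)]
    exact ⟨isFlipPair_M0, _, _, _, isPresentation_M0⟩
  · rw [hNW.unique (isFlipPair_L s (by omega))]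
    have hd' : 2 ≤ d := by omega
    exact ⟨fun s' => isFlipPair_L s' hd', _, _, _, fun s' => isPresentation_L s' hd'⟩
  · rw [hNW.unique (isFlipPair_Q s hm)]
    exact ⟨fun s' => isFlipPair_Q s' hm, _, _, _,
      fun s' => isPresentation_Q s' hm (odd_two_mul_sub_one hm)⟩

end Presentations

/-! ### Mirror images -/

theorem IsConnectedSet.mirror {N : Set Word} (h : IsConnectedSet N) :
    IsConnectedSet (mirror '' N) := by
  rintro n hn ⟨_, ⟨u, hu, rfl⟩, hl⟩ r hr hrn
  rw [length_mirror] at hl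
  obtain ⟨v, hv, hvl⟩ := h n hn ⟨u, hu, hl⟩ r hr hrn
  exact ⟨_, ⟨v, hv, rfl⟩, by rw [length_mirror, hvl]⟩

theorem IsNarrow.mirror {N : Set Word} (h : IsNarrow N) : IsNarrow (mirror '' N) := by
  rintro _ ⟨u, hu, rfl⟩ _ ⟨v, hv, rfl⟩ h2 hl
  rw [length_mirror] at h2 hl
  rw [length_mirror] at hl
  rw [h u hu v hv h2 hl]

theorem encard_mirror (N : Set Word) : (mirror '' N).encard = N.encard :=
  (flipWord_injective true).encard_image N

theorem mirror_image_image (N : Set Word) : mirror '' (mirror '' N) = N :=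
  flipWord_image_image true N

/-! ### Lyndon words of length at most three -/

theorem IsLyndon.eq_of_length_two {u : Word} (hu : IsLyndon u) (hl : u.length = 2) :
    u = xyPow 1 := by
  have h2 := hu.exists_factor hl.ge
  obtain ⟨a, b, rfl, ha, hb, hab⟩ := h2
  have hla := ha.length_pos
  have hlb := hb.length_pos
  rw [List.length_append] at hl
  obtain ⟨a, rfl⟩ := List.length_eq_one_iff.mp (by omega : a.length = 1)
  obtain ⟨b, rfl⟩ := List.length_eq_one_iff.mp (by omega : b.length = 1)
  rw [List.cons_lt_cons_iff] at hab
  have hab' : a < b := hab.resolve_right fun h => List.not_lt_nil _ h.2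
  obtain rfl : a = 0 := by omega
  obtain rfl : b = 1 := by omega
  rfl

theorem IsLyndon.eq_of_length_three {u : Word} (hu : IsLyndon u) (hl : u.length = 3) :
    u = xyPow 2 ∨ u = [0, 0, 1] := by
  obtain ⟨a, b, rfl, ha, hb, hab⟩ := hu.exists_factor (by omega)
  have hla := ha.length_pos
  have hlb := hb.length_pos
  rw [List.length_append] at hl
  by_cases h1 : a.length = 1
  · obtain rfl := hb.eq_of_length_two (by omega)
    rcases eq_letter_of_length_eq_one h1 with rfl | rfl
    · exact Or.inr rfl
    · exact absurd hu (not_flipLyndon_letter_append (s := false) hb.ne_nil)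
  · obtain rfl := ha.eq_of_length_two (by omega)
    rcases eq_letter_of_length_eq_one (by omega : b.length = 1) with rfl | rfl
    · exact absurd (FlipLyndon.lt_of_append₂ (s := false) hu) (by omega)
    · exact Or.inl rfl

/-- Only x, y and xy are Lyndon words of length at most two, so a fourth member is longer, and
connectedness supplies one of length three. -/
theorem xyPow_two_mem_or {N W : Set Word} (hNW : IsLyndonPair N W) (hconn : IsConnectedSet N)
    (hcard : 4 ≤ N.encard) : xyPow 2 ∈ N ∨ [0, 0, 1] ∈ N := by
  have hL : ∀ u ∈ N, IsLyndon u := fun u hu => (isFlipPair_false.mpr hNW).flipLyndon hu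
  have hlong : ∃ u ∈ N, 3 ≤ u.length := by
    by_contra hcon
    push Not at hcon
    have hsub : N ⊆ (({xyPow 0, [1], xyPow 1} : Finset Word) : Set Word) := by
      intro u hu
      have hpos := (hL u hu).length_pos
      have hlt := hcon u hu
      by_cases h1 : u.length = 1
      · rcases eq_letter_of_length_eq_one h1 with rfl | rfl <;> simp
      · rw [(hL u hu).eq_of_length_two (by omega)]
        simp
    have h4 := hcard.trans (Set.encard_le_encard hsub)
    rw [Set.encard_coe_eq_coe_finsetCard] at h4
    have h3 := Finset.card_le_three (a := xyPow 0) (b := [1]) (c := xyPow 1)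
    have : 4 ≤ ({xyPow 0, [1], xyPow 1} : Finset Word).card := by exact_mod_cast h4
    omega
  obtain ⟨u, hu, hl⟩ := hlong
  obtain ⟨v, hv, hvl⟩ := hconn u.length (by omega) ⟨u, hu, rfl⟩ 3 (by omega) hl
  rcases (hL v hv).eq_of_length_three hvl with h | h
  · exact Or.inl (h ▸ hv)
  · exact Or.inr (h ▸ hv)

/-! ### The main theorem -/

theorem mainTheorem6 {K : Type*} [Field K] [CharZero K] (N W : Set Word)
    (hNW : IsLyndonPair N W) (hconn : IsConnectedSet N) (hcard : 4 ≤ N.encard)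
    (hnarrow : IsNarrow N) :
    -- one of `xyy`, `xxy` is in `N`
    (xyPow 2 ∈ N ∨ [0, 0, 1] ∈ N) ∧
    -- the case `xxy ∈ N` reduces to the case `xyy ∈ N`
    ([0, 0, 1] ∈ N →
      (IsConnectedSet (mirror '' N) ∧ 4 ≤ (mirror '' N).encard ∧ IsNarrow (mirror '' N) ∧
        xyPow 2 ∈ mirror '' N) ∧
      (IsGroebnerShirshov K W ↔
        IsLyndonPair (mirror '' N) (mirror '' W) ∧ IsGroebnerShirshov K (mirror '' W)) ∧
      (IsGroebnerShirshov K W → IsBracketBasis K N W ∧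
        Nonempty (MonomialLie K W ≃ₗ⁅K⁆ MonomialLie K (mirror '' W)))) ∧
    -- the case `xyy ∈ N`
    (xyPow 2 ∈ N →
      -- infinite `N`
      ((N = atomsM0 ↔ W = obstructionsM0) ∧
        (IsGroebnerShirshov K W → (N.Infinite ↔ N = atomsM0)) ∧
        (N = atomsM0 →
          IsGroebnerShirshov K W ∧ IsBracketBasis K N W ∧
          Nonempty (MonomialLie K W ≃ₗ⁅K⁆ (filiformM0 K).Alg))) ∧
      -- finite `N`
      (∀ d : ℕ,
        (IsGroebnerShirshov K W →
          (N.encard = d ↔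
            (N = atomsL d ∧ W = obstructionsL d) ∨
            ∃ m : ℕ, d = 2 * m ∧ 6 ≤ d ∧ N = atomsQ m ∧ W = obstructionsQ m)) ∧
        (N = atomsL d ∧ W = obstructionsL d →
          IsGroebnerShirshov K W ∧ IsBracketBasis K N W ∧
          Nonempty (MonomialLie K W ≃ₗ⁅K⁆ (filiformL K (d - 1)).Alg) ∧
          Module.finrank K (MonomialLie K W) = d ∧
          HasNilpotencyClass K (MonomialLie K W) (d - 1)) ∧
        (∀ (m : ℕ) (hm : 3 ≤ m), d = 2 * m → N = atomsQ m ∧ W = obstructionsQ m →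
          IsGroebnerShirshov K W ∧ IsBracketBasis K N W ∧
          Nonempty (MonomialLie K W ≃ₗ⁅K⁆
            (filiformQ K (2 * m - 1) (odd_two_mul_sub_one hm)).Alg) ∧
          Module.finrank K (MonomialLie K W) = d ∧
          HasNilpotencyClass K (MonomialLie K W) (d - 1)))) := by
  have hflip := isFlipPair_false.mpr hNW
  have himage : ∀ S : Set Word, flipWord false '' S = S := fun S => Set.image_id S
  refine ⟨xyPow_two_mem_or hNW hconn hcard, fun hxxy => ?_,
    fun h2 => ⟨⟨?_, ?_, ?_⟩, fun d => ⟨?_, ?_, ?_⟩⟩⟩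
  · have hflip' : IsFlipPair true (mirror '' N) (mirror '' W) := by
      have h := isLyndonPair_image (s := true) (N := mirror '' N) (W := mirror '' W)
      have hi : ∀ S : Set Word, flipWord true '' (mirror '' S) = S := mirror_image_image
      rw [hi, hi] at h
      exact h.mp hNW
    have hconn' := hconn.mirror
    have hnarrow' := hnarrow.mirror
    have h2 : xyPow 2 ∈ mirror '' N := ⟨_, hxxy, rfl⟩
    have himage' : ∀ S : Set Word, flipWord true '' (mirror '' S) = S := mirror_image_image
    -- The mirrored sets form a pair for s = true whose mirror image is the given (N, W), so the
    -- classification applies without knowing that (N', W') is a Lyndon pair. That is a consequence,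
    -- since the three shapes are pairs for both s.
    have hclass : IsGroebnerShirshov K W → _ := fun hGS =>
      IsGroebnerShirshov.classification (K := K) (s := true) (by rwa [himage']) hflip' hconn'
        hnarrow' h2
    refine ⟨⟨hconn', by rwa [encard_mirror], hnarrow', h2⟩, ⟨fun hGS => ?_, ?_⟩, fun hGS => ?_⟩
    · obtain ⟨hpair, A, _, _, hA⟩ := exists_isPresentation (K := K) hflip' (hclass hGS)
      have := (hA false).1
      rw [himage] at this
      exact ⟨isFlipPair_false.mp (hpair false), this⟩
    · rintro ⟨hpair, hGS⟩
      have hclass' := IsGroebnerShirshov.classification (K := K) (s := false) (by rwa [himage])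
        (isFlipPair_false.mpr hpair) hconn' hnarrow' h2
      obtain ⟨_, A, _, _, hA⟩ := exists_isPresentation (K := K) hflip' hclass'
      have := (hA true).1
      rwa [himage'] at this
    · obtain ⟨_, A, _, _, hA⟩ := exists_isPresentation (K := K) hflip' (hclass hGS)
      have h1 := hA true
      have h0 := hA false
      rw [himage', himage'] at h1
      rw [himage, himage] at h0
      obtain ⟨_, hbasis, ⟨e1⟩⟩ := h1
      obtain ⟨_, _, ⟨e0⟩⟩ := h0
      exact ⟨hbasis, ⟨e1.trans e0.symm⟩⟩
  · constructor
    · rintro rfl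
      exact hflip.unique (isFlipPair_M0 false)
    · rintro rfl
      rw [hflip.atoms, (isFlipPair_M0 false).atoms]
  · intro hGS
    constructor
    · intro hinf
      rcases IsGroebnerShirshov.classification (K := K) (s := false) (by rwa [himage]) hflip hconn
        hnarrow h2 with h | ⟨d, hd, rfl⟩ | ⟨m, hm, rfl⟩
      · exact h
      · exact absurd (Set.finite_of_encard_eq_coe (encard_atomsL (by omega))) hinf
      · exact absurd (Set.finite_of_encard_eq_coe (encard_atomsQ (by omega))) hinf
    · rintro rfl
      exact infinite_atomsM0
  · rintro rfl
    have h := isPresentation_M0 (K := K) false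
    rwa [himage, himage, ← hflip.unique (isFlipPair_M0 false)] at h
  · intro hGS
    constructor
    · intro hd
      rcases IsGroebnerShirshov.classification (K := K) (s := false) (by rwa [himage]) hflip hconn
        hnarrow h2 with rfl | ⟨d', hd', rfl⟩ | ⟨m, hm, rfl⟩
      · exact absurd (Set.finite_of_encard_eq_coe hd) infinite_atomsM0
      · rw [encard_atomsL (by omega)] at hd
        obtain rfl : d' = d := by exact_mod_cast hd
        exact Or.inl ⟨rfl, hflip.unique (isFlipPair_L false (by omega))⟩
      · rw [encard_atomsQ (by omega)] at hd
        have hd' : 2 * m = d := by exact_mod_cast hd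
        exact Or.inr ⟨m, hd'.symm, by omega, rfl, hflip.unique (isFlipPair_Q false hm)⟩
    · rintro (⟨rfl, _⟩ | ⟨m, rfl, hm, rfl, _⟩)
      · refine encard_atomsL ?_
        -- For d = 0 the set of atoms is {y}, with one element; the assumption of four elements
        -- excludes it.
        by_contra hd
        obtain rfl : d = 0 := by omega
        rw [atomsL_eq] at hcard
        have : Set.Iio (0 - 1) = (∅ : Set ℕ) := by simp
        rw [this, Set.image_empty, insert_empty_eq, Set.encard_singleton] at hcard
        norm_num at hcard
      · exact encard_atomsQ (by omega)
  · rintro ⟨rfl, rfl⟩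
    have hd : 4 ≤ d := by
      rcases h2 with ⟨k, hk, h⟩ | h
      · have := xyPow_injective h
        omega
      · exact absurd h.symm (letter_ne_xyPow 2)
    have h := isPresentation_L (K := K) false (d := d) (by omega)
    rw [himage, himage] at h
    obtain ⟨hGS, hbasis, ⟨e⟩⟩ := h
    refine ⟨hGS, hbasis, ⟨e⟩, ?_, hasNilpotencyClass_congr e (hasNilpotencyClass_L (by omega))⟩
    rw [e.toLinearEquiv.finrank_eq, finrank_alg]
    omega
  · rintro m hm rfl ⟨rfl, rfl⟩
    have h := isPresentation_Q (K := K) false hm (odd_two_mul_sub_one hm)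
    rw [himage, himage] at h
    obtain ⟨hGS, hbasis, ⟨e⟩⟩ := h
    refine ⟨hGS, hbasis, ⟨e⟩, ?_,
      hasNilpotencyClass_congr e (hasNilpotencyClass_Q (by omega) (odd_two_mul_sub_one hm))⟩
    rw [e.toLinearEquiv.finrank_eq, finrank_alg]
    omega
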